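/- Let $g\ge 0$ and $n\ge 1$. **Graphs.** Graphs are finite multigraphs $\Gamma$ with loops allowed, vertex weights $w\colon V(\Gamma)\to\mathbb Z_{\ge 0}$ and $n$ labelled legs. The genus is $\sum_v w(v)+b_1(\Gamma)$, and $\Gamma$ is stable if $2w(v)-2+\deg(v)+L(v)>0$ for all $v$, where $L(v)$ is the number of legs at $v$. Stable graphs of genus $g$ are taken connected, and $v_0$ is the vertex of the first leg. The graph $\Gamma/S$ is obtained by contracting $S\subset E(\Gamma)$ (a new vertex has as weight the genus of the subgraph contracted to it). A specialization $\iota\colon\Gamma\to\Gamma'$ is an isomorphism $\Gamma'\cong\Gamma/S$; it gives a surjection $V(\Gamma)\to V(\Gamma')$ and an injection $E(\Gamma')\subset E(\Gamma)$. For $\mathcal E\subset E(\Gamma)$, $\Gamma^{\mathcal E}$ is obtained by inserting one (exceptional) vertex of weight $0$ in every $e\in\mathcal E$. **Pseudo-divisors.** A pseudo-divisor on $\Gamma$ is a pair $(\mathcal E,D)$ with $D\colon V(\Gamma^{\mathcal E})\to\mathbb Z$ equal to $-1$ at the exceptional vertices. Put $K_\Gamma(v)=2w(v)-2+\deg(v)$,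 $\mu(v)=K_\Gamma(v)/2$, extended by $0$ to the exceptional vertices. For $W\subset V(\Gamma^{\mathcal E})$ let $\beta_D(W)=\sum_{W}D-\sum_W\mu+\frac12\#E(W,W^c)$. For $D$ of the same degree as $\mu$, $(\mathcal E,D)$ is semistable if $\beta_D(W)\ge0$ for all $W\subsetneq V(\Gamma^{\mathcal E})$, and $v_0$-quasistable if moreover $\beta_D(W)>0$ whenever $v_0\in W\subsetneq V(\Gamma^{\mathcal E})$. It is polystable if for all $W\subset V(\Gamma)$ the number $\sum_W D-\sum_{v\in W}(\mu(v)+\frac12\deg_{\mathcal E}(v))+\frac12\#(E(W,W^c)\setminus\mathcal E)$ is $\ge0$, and is $>0$ if $E(W,W^c)\not\subset\mathcal E$. A specialization $(\Gamma,\mathcal E,D)\ge(\Gamma',\mathcal E',D')$ is a specialization $\iota\colon\Gamma\to\Gamma'$ with $\mathcal E'\subset\mathcal E\cap E(\Gamma')$ and a specialization $\widehat\iota\colon\Gamma^{\mathcal E}\to\Gamma'^{\mathcal E'}$ compatible with $\iota$ on vertices and edges such that $\widehat\iota_*(D)=D'$. For semistable $(\mathcal E,D)$, $\mathrm{pol}(\mathcal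 E,D)$ is the unique minimal polystable pseudo-divisor on $\Gamma$ specializing to $(\mathcal E,D)$ over the identity of $\Gamma$. **Spin roots.** A pseudo-root is a pseudo-divisor $(\mathcal E,D)$ such that $2D+\mathrm{Div}(\phi)=K_{\Gamma^{\mathcal E}}$ for an acyclic flow $\phi$ on $\Gamma^{\mathcal E}$, where $\mathrm{Div}(\phi)=\sum_{e}\phi(e)\,t(e)$ over the oriented edges $e$, with target $t(e)$, and acyclic means that every oriented cycle along which $\phi\ge0$ has $\phi=0$ along it. In the semistable case $\phi=\phi_{(\mathcal E,D)}$ is unique; $P_{(\mathcal E,D)}=\{e\mid\phi(e)=0\}$, which is a set of edges of $\Gamma$. A spin semistable pseudo-root $(\mathcal E,D,s)$ is a semistable pseudo-root with a function $s\colon V(\Gamma/P_{(\mathcal E,D)})\to\mathbb Z/2$ vanishing at the vertices of weight $0$. Specializations of spin semistable pseudo-roots are specializations as above with $\widehat\iota_*(\phi_{(\mathcal E,D)})=\phi_{(\mathcal E',D')}$ and such that $s'$ is the push-forward of $s$ along $V(\Gamma/P_{(\mathcal E,D)})\to V(\Gamma'/P_{(\mathcal E',D')})$. Put $\mathrm{pol}(\mathcal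 E,D,s)=(\mathrm{pol}(\mathcal E,D),s)$, where $P_{\mathrm{pol}(\mathcal E,D)}=P_{(\mathcal E,D)}$. **Cones.** $\lambda_{(\Gamma,\mathcal E,D,s)}\subset\mathbb R_{\ge0}^{E(\Gamma^{\mathcal E})}$ is the cone defined by $\sum_{e\in\gamma}\phi_{(\mathcal E,D)}(e)x_e=0$ for all oriented cycles $\gamma$ of $\Gamma^{\mathcal E}$, and $\lambda^\circ$ is its intersection with $\mathbb R_{>0}^{E(\Gamma^{\mathcal E})}$. For $W\subset V(\Gamma)$ with $E(W,W^c)\subset\mathcal E$, let $u_W\in\mathbb R^{E(\Gamma^{\mathcal E})}$ have coordinate $1$ (resp. $-1$) at the edges lying over an edge of $E(W,W^c)$ and incident to $W$ (resp. $W^c$), and $0$ elsewhere; $\mathcal L_{\mathcal E}$ is the span of these vectors. $\kappa$ and $\kappa^\circ$ are the images of $\lambda$ and $\lambda^\circ$ in $\mathbb R^{E(\Gamma^{\mathcal E})}/\mathcal L_{\mathcal E}$ (with the lattice that is the image of $\mathbb Z^{E(\Gamma^{\mathcal E})}$). A specialization with map $\widehat\iota$ induces maps of these spaces in the opposite direction,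 by extension by zero along $E(\Gamma'^{\mathcal E'})\subset E(\Gamma^{\mathcal E})$. A generalized cone complex is the colimit of an (essentially) finite diagram of rational polyhedral cones and face morphisms. A morphism of these is a continuous map such that the map on every cone of the source factors through an integral linear map to a cone of the target. A refinement is a bijective morphism. $Q^{\mathrm{trop}}_{g,n}=\varinjlim\lambda$ over the category $\mathbf{SPQ}_{g,n}$ of $(\Gamma,\mathcal E,D,s)$ with $\Gamma$ stable of genus $g$ with $n$ legs and $(\mathcal E,D,s)$ a spin $v_0$-quasistable pseudo-root; $S^{\mathrm{trop}}_{g,n}=\varinjlim\kappa$ over the analogous category of spin polystable pseudo-roots. **Theorem A.** $Q^{\mathrm{trop}}_{g,n}$ and $S^{\mathrm{trop}}_{g,n}$ are generalized cone complexes. For every $(\Gamma,\mathcal E,D,s)\in\mathbf{SPQ}_{g,n}$ there is exactly one spin polystable pseudo-root $\mathrm{pol}(\mathcal E,D,s)$ on $\Gamma$, and it specializes to $(\mathcal E,D,s)$ over the identity of $\Gamma$. There is exactly one map $\rho_S^{\mathrm{trop}}\colon Q^{\mathrm{trop}}_{g,n}\to S^{\mathrm{trop}}_{g,n}$ which is given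 on the cones by the maps $\lambda_{(\Gamma,\mathcal E,D,s)}\to\kappa_{(\Gamma,\mathrm{pol}(\mathcal E,D,s))}$ that these specializations induce, and it is a refinement. For every stable graph $\Gamma$ of genus $g$ with $n$ legs and every spin polystable pseudo-root $(\mathcal E,D,s)$ on $\Gamma$ we have decompositions $$\kappa^\circ_{(\Gamma,\mathcal E,D,s)}=\coprod_{(\mathcal E,D,s)=\mathrm{pol}(\mathcal E',D',s')}\lambda^\circ_{(\Gamma,\mathcal E',D',s')},\qquad \kappa_{(\Gamma,\mathcal E,D,s)}=\coprod_{(\Gamma,\mathcal E,D,s)\ge(\Gamma',\mathcal E',D',s')}\lambda^\circ_{(\Gamma',\mathcal E',D',s')}.$$ The first union is over the spin $v_0$-quasistable pseudo-roots $(\mathcal E',D',s')$ on $\Gamma$ with the indicated $\mathrm{pol}$. The second is over the contractions $\Gamma'=\Gamma/S$, $S\subset E(\Gamma)$, and the spin quasistable pseudo-roots $(\mathcal E',D',s')$ on $\Gamma'$, with respect to the image of $v_0$, such that there is a specialization of spin semistable pseudo-roots $(\Gamma,\mathcal E,D,s)\ge(\Gamma',\mathcal E',D',s')$ over $\Gamma\to\Gamma/S$.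 Each $\lambda_{(\Gamma',\mathcal E',D',s')}$ is mapped to $\mathbb R^{E(\Gamma^{\mathcal E})}/\mathcal L_{\mathcal E}$ by these specializations; this map is injective and does not depend on the choice of the specialization. -/

import Mathlib

noncomputable section

namespace SpinTrop

/-- A finite weighted graph with `n` (labelled) legs; loops and multiple edges are allowed.
Every edge `e` has two ends `ends e false`, `ends e true`; the reference direction that this
gives carries no information, since isomorphisms may reverse edges. -/
structure WGraph (n : ℕ) where
  V : Type
  E : Type
  [fintypeV : Fintype V]
  [fintypeE : Fintype E]
  ends : E → Bool → V
  weight : V → ℕ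
  leg : Fin n → V

attribute [instance] WGraph.fintypeV WGraph.fintypeE

namespace WGraph

variable {n : ℕ}

/-- Oriented edges: `(e, b)` is the edge `e` directed away from its end `b`. -/
abbrev Dart (G : WGraph n) : Type := G.E × Bool

def src (G : WGraph n) (d : G.Dart) : G.V := G.ends d.1 d.2

def tgt (G : WGraph n) (d : G.Dart) : G.V := G.ends d.1 (!d.2)

/-- `deg_S(v)`: the number of edges in `S` at `v`, loops counting twice. -/
def degIn (G : WGraph n) (S : Set G.E) (v : G.V) : ℕ :=
  {d : G.Dart | d.1 ∈ S ∧ G.src d = v}.ncard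

def deg (G : WGraph n) (v : G.V) : ℕ := G.degIn Set.univ v

/-- The set of edges `E(W, Wᶜ)`. -/
def cut (G : WGraph n) (W : Finset G.V) : Set G.E :=
  {e | ¬ (G.ends e false ∈ W ↔ G.ends e true ∈ W)}

/-- Two vertices are related if they are joined by a path with edges in `S`. -/
def connSetoid (G : WGraph n) (S : Set G.E) : Setoid G.V :=
  Relation.EqvGen.setoid fun u v => ∃ e ∈ S, G.ends e false = u ∧ G.ends e true = v

def b0 (G : WGraph n) : ℕ := Nat.card (Quotient (G.connSetoid Set.univ))

def b1 (G : WGraph n) : ℤ := (Fintype.card G.E : ℤ) - Fintype.card G.V + G.b0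

def genus (G : WGraph n) : ℤ := (∑ v, (G.weight v : ℤ)) + G.b1

/-- `G` is a connected stable graph of genus `g`. -/
structure IsStable (G : WGraph n) (g : ℕ) : Prop where
  connected : G.b0 = 1
  genus_eq : G.genus = g
  stable : ∀ v, 2 < 2 * G.weight v + G.deg v + {i : Fin n | G.leg i = v}.ncard

open scoped Classical in
/-- The contraction `G / S`. The weight of a vertex of `G / S` is the genus of the (connected)
subgraph of `G` that is contracted to it: the sum of the weights plus the first Betti number. -/
def contract (G : WGraph n) (S : Set G.E) : WGraph n where
  V := Quotient (G.connSetoid S)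
  E := {e : G.E // e ∉ S}
  fintypeV := Fintype.ofFinite _
  fintypeE := Fintype.ofFinite _
  ends e b := Quotient.mk _ (G.ends e.1 b)
  weight c := (∑ v, if Quotient.mk (G.connSetoid S) v = c then G.weight v else 0) +
    ({e : G.E | e ∈ S ∧ Quotient.mk (G.connSetoid S) (G.ends e false) = c}.ncard + 1 -
      {v : G.V | Quotient.mk (G.connSetoid S) v = c}.ncard)
  leg i := Quotient.mk _ (G.leg i)

/-- The natural surjection `V(G) → V(G / S)`. -/
def contractMk (G : WGraph n) (S : Set G.E) (v : G.V) : (G.contract S).V :=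
  Quotient.mk (G.connSetoid S) v

open scoped Classical in
/-- The graph `G^S`: an exceptional vertex `Sum.inr e` of weight `0` is inserted in every
`e ∈ S`. The edges of `G^S` are the edges `Sum.inl e`, `e ∉ S`, and the exceptional edges
`Sum.inr (e, b)`, `e ∈ S`, joining the end `b` of `e` to the exceptional vertex of `e`. -/
def subdivide (G : WGraph n) (S : Set G.E) : WGraph n where
  V := G.V ⊕ {e : G.E // e ∈ S}
  E := {e : G.E // e ∉ S} ⊕ ({e : G.E // e ∈ S} × Bool)
  fintypeV := inferInstance
  fintypeE := inferInstance
  ends a c := match a with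
    | Sum.inl e => Sum.inl (G.ends e.1 c)
    | Sum.inr (e, b) => if c then Sum.inr e else Sum.inl (G.ends e.1 b)
  weight := Sum.elim G.weight fun _ => 0
  leg i := Sum.inl (G.leg i)

/-- The edge of `G` over which an edge of `G^S` lies. -/
def below (G : WGraph n) (S : Set G.E) : (G.subdivide S).E → G.E
  | Sum.inl e => e.1
  | Sum.inr (e, _) => e.1

/-! ### Specializations -/

/-- Isomorphisms of weighted graphs with labelled legs; `flip e` tells whether the reference
direction of `e` is reversed. -/
structure GraphIso (G H : WGraph n) where
  vert : G.V ≃ H.V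
  edge : G.E ≃ H.E
  flip : G.E → Bool
  ends_eq : ∀ e b, vert (G.ends e b) = H.ends (edge e) (xor b (flip e))
  weight_eq : ∀ v, H.weight (vert v) = G.weight v
  leg_eq : ∀ i, vert (G.leg i) = H.leg i

/-- A specialization `G → H`: an isomorphism of `H` with a contraction of `G`. -/
structure Specialization (G H : WGraph n) where
  S : Set G.E
  iso : GraphIso (G.contract S) H

namespace Specialization

variable {G H : WGraph n} (f : Specialization G H)

/-- The surjection on vertices. -/
def vMap (v : G.V) : H.V := f.iso.vert (G.contractMk f.S v)

/-- The injection `E(H) → E(G)`. -/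
def incl (e : H.E) : G.E := (f.iso.edge.symm e).1

/-- The injection on oriented edges. -/
def dartIncl (d : H.Dart) : G.Dart :=
  (f.incl d.1, xor d.2 (f.iso.flip (f.iso.edge.symm d.1)))

open scoped Classical in
/-- The linear injection `ℝ^{E(H)} → ℝ^{E(G)}` that is zero on the contracted edges. -/
def ext : (H.E → ℝ) →ₗ[ℝ] (G.E → ℝ) where
  toFun p e := if h : e ∈ f.S then 0 else p (f.iso.edge ⟨e, h⟩)
  map_add' p q := by
    funext e
    by_cases h : e ∈ f.S <;> simp [h]
  map_smul' c p := by
    funext e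
    by_cases h : e ∈ f.S <;> simp [h]

end Specialization

/-! ### Divisors, flows, cycles -/

/-- The canonical divisor. -/
def canonical (G : WGraph n) (v : G.V) : ℤ := 2 * (G.weight v : ℤ) - 2 + G.deg v

/-- The canonical polarization of degree `g - 1`. -/
def mu (G : WGraph n) (v : G.V) : ℝ := (2 * (G.weight v : ℝ) - 2 + G.deg v) / 2

/-- `β_D(W)` with respect to a polarization `m`. -/
def beta (G : WGraph n) (m : G.V → ℝ) (D : G.V → ℤ) (W : Finset G.V) : ℝ :=
  (∑ v ∈ W, (D v : ℝ)) - (∑ v ∈ W, m v) + ((G.cut W).ncard : ℝ) / 2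

/-- `D` is `m`-semistable. -/
def DivSemistable (G : WGraph n) (m : G.V → ℝ) (D : G.V → ℤ) : Prop :=
  ∑ v, (D v : ℝ) = ∑ v, m v ∧ ∀ W : Finset G.V, W ≠ Finset.univ → 0 ≤ G.beta m D W

/-- `D` is `(v₀, m)`-quasistable. -/
def DivQuasistable (G : WGraph n) (v₀ : G.V) (m : G.V → ℝ) (D : G.V → ℤ) : Prop :=
  G.DivSemistable m D ∧
    ∀ W : Finset G.V, W ≠ Finset.univ → v₀ ∈ W → 0 < G.beta m D W

def IsFlow (G : WGraph n) (φ : G.Dart → ℤ) : Prop := ∀ e, φ (e, true) = -φ (e, false)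

open scoped Classical in
/-- The divisor of a flow. -/
def divFlow (G : WGraph n) (φ : G.Dart → ℤ) (v : G.V) : ℤ :=
  ∑ d : G.Dart, if G.tgt d = v then φ d else 0

/-- An oriented (simple) cycle, as a cyclic sequence of `len + 1` oriented edges that visits
each vertex and each edge at most once. The index `i + 1` is taken modulo `len + 1`. -/
structure OrientedCycle (G : WGraph n) where
  len : ℕ
  dart : Fin (len + 1) → G.Dart
  closed : ∀ i, G.tgt (dart i) = G.src (dart (i + 1))
  src_inj : Function.Injective fun i => G.src (dart i)
  edge_inj : Function.Injective fun i => (dart i).1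

/-- `φ` is acyclic: an oriented cycle along which `φ` is nonnegative is null for `φ`. -/
def IsAcyclicFlow (G : WGraph n) (φ : G.Dart → ℤ) : Prop :=
  ∀ γ : G.OrientedCycle, (∀ i, 0 ≤ φ (γ.dart i)) → ∀ i, φ (γ.dart i) = 0

end WGraph

open WGraph

variable {n : ℕ}

/-! ### Pseudo-divisors and pseudo-roots -/

/-- A pseudo-divisor `(𝓔, D)` on `G`: `exc` is `𝓔`, and `D` is a divisor on `G^𝓔` with value
`-1` at the exceptional vertices. -/
structure PseudoDivisor (G : WGraph n) where
  exc : Set G.E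
  D : (G.subdivide exc).V → ℤ
  D_exc : ∀ e : {e : G.E // e ∈ exc}, D (Sum.inr e) = -1

namespace PseudoDivisor

variable {G H : WGraph n}

/-- The graph `G^𝓔`. -/
abbrev sub (x : PseudoDivisor G) : WGraph n := G.subdivide x.exc

/-- The extension by zero of the canonical polarization to `G^𝓔`. -/
def muSub (x : PseudoDivisor G) : x.sub.V → ℝ := Sum.elim G.mu fun _ => 0

def Semistable (x : PseudoDivisor G) : Prop := x.sub.DivSemistable x.muSub x.D

def Quasistable (v₀ : G.V) (x : PseudoDivisor G) : Prop :=
  x.sub.DivQuasistable (Sum.inl v₀) x.muSub x.D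

/-- `β_{𝓔,D}(W)` for `W ⊆ V(G)`, computed on the graph `G` with the edges of `𝓔` removed. -/
def betaExc (x : PseudoDivisor G) (W : Finset G.V) : ℝ :=
  (∑ v ∈ W, (x.D (Sum.inl v) : ℝ)) - (∑ v ∈ W, (G.mu v + (G.degIn x.exc v : ℝ) / 2)) +
    ((G.cut W \ x.exc).ncard : ℝ) / 2

def Polystable (x : PseudoDivisor G) : Prop :=
  ∑ v, (x.D v : ℝ) = ∑ v, x.muSub v ∧
    ∀ W : Finset G.V, 0 ≤ x.betaExc W ∧ (¬ G.cut W ⊆ x.exc → 0 < x.betaExc W)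

/-- `φ` is an acyclic flow on `G^𝓔` with `2D + Div(φ) = K`. -/
def IsRootFlow (x : PseudoDivisor G) (φ : x.sub.Dart → ℤ) : Prop :=
  x.sub.IsFlow φ ∧ x.sub.IsAcyclicFlow φ ∧
    ∀ v, 2 * x.D v + x.sub.divFlow φ v = x.sub.canonical v

def IsPseudoRoot (x : PseudoDivisor G) : Prop := ∃ φ, x.IsRootFlow φ

/-- The flow `φ_{(𝓔,D)}` of a (semistable) pseudo-root, i.e. the acyclic flow with
`2D + Div(φ) = K`. -/
def flow (x : PseudoDivisor G) : x.sub.Dart → ℤ := Classical.epsilon x.IsRootFlow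

/-- The set of edges `P_{(𝓔,D)}` where the flow vanishes, as a set of edges of `G`. -/
def zeroEdges (x : PseudoDivisor G) : Set G.E :=
  G.below x.exc '' {a | x.flow (a, false) = 0}

end PseudoDivisor

open scoped Classical in
/-- A specialization of triples `(G, x) ≥ (H, y)`: a specialization `base : G → H`, a
compatible specialization `hat : G^𝓔 → H^𝓔'`, with `hat_*(D) = D'`. -/
structure PDSpec {G H : WGraph n} (x : PseudoDivisor G) (y : PseudoDivisor H) where
  base : Specialization G H
  hat : Specialization x.sub y.sub
  exc_sub : ∀ e ∈ y.exc, base.incl e ∈ x.exc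
  vert_comm : ∀ v : G.V, hat.vMap (Sum.inl v) = Sum.inl (base.vMap v)
  edge_comm : ∀ a : y.sub.E, G.below x.exc (hat.incl a) = base.incl (H.below y.exc a)
  push_D : ∀ u : y.sub.V, y.D u = ∑ v, if hat.vMap v = u then x.D v else 0

/-- A specialization of root-graphs: moreover `hat_*(φ) = φ'`. -/
structure RootSpec {G H : WGraph n} (x : PseudoDivisor G) (y : PseudoDivisor H) extends
    PDSpec x y where
  push_flow : ∀ d : y.sub.Dart, y.flow d = x.flow (hat.dartIncl d)

namespace WGraph.Specialization

/-- A specialization `G → G` which is the identity on vertices and edges. -/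
def IsId {G : WGraph n} (f : Specialization G G) : Prop :=
  (∀ v, f.vMap v = v) ∧ ∀ e, f.incl e = e

/-- A specialization `G → G / S` which is the natural one on vertices and edges. -/
def IsCanonical {G : WGraph n} {S : Set G.E} (f : Specialization G (G.contract S)) : Prop :=
  (∀ v, f.vMap v = G.contractMk S v) ∧ ∀ e : {e : G.E // e ∉ S}, f.incl e = e.1

end WGraph.Specialization

namespace PseudoDivisor

variable {G : WGraph n}

/-- The order `x ≥ y` on pseudo-divisors on a fixed graph. -/
def SpecializesTo (x y : PseudoDivisor G) : Prop := ∃ f : PDSpec x y, f.base.IsId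

/-- `y = pol(x)`: `y` is the unique minimal polystable pseudo-divisor on `G` with `y ≥ x`. -/
def IsPol (y x : PseudoDivisor G) : Prop :=
  y.Polystable ∧ y.SpecializesTo x ∧
    ∀ z : PseudoDivisor G, z.Polystable → z.SpecializesTo x → z.SpecializesTo y

end PseudoDivisor

/-! ### Spin pseudo-roots -/

/-- A spin semistable pseudo-root `(𝓔, D, s)` on `G`. -/
structure SpinRoot (G : WGraph n) where
  pd : PseudoDivisor G
  isRoot : pd.IsPseudoRoot
  semistable : pd.Semistable
  sign : (G.contract pd.zeroEdges).V → ZMod 2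
  sign_eq_zero : ∀ u, (G.contract pd.zeroEdges).weight u = 0 → sign u = 0

open scoped Classical in
/-- A specialization of spin semistable root-graphs: a specialization of root-graphs such that
the sign function of the target is the push-forward of that of the source along the map
`V(G/P) → V(H/P')` induced by `V(G) → V(H)`. -/
structure SpinSpec {G H : WGraph n} (x : SpinRoot G) (y : SpinRoot H) extends
    RootSpec x.pd y.pd where
  push_sign : ∀ u' : (H.contract y.pd.zeroEdges).V, y.sign u' =
    ∑ u : (G.contract x.pd.zeroEdges).V,
      if ∃ v : G.V, G.contractMk x.pd.zeroEdges v = u ∧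
        H.contractMk y.pd.zeroEdges (base.vMap v) = u' then x.sign u else 0

/-- `y = pol(x)` for spin semistable pseudo-roots: `pol` of the underlying pseudo-divisors, and
the two sign functions agree (both zero sets are equal, so both are functions on the same
quotient of `V(G)`). -/
def IsSpinPol {G : WGraph n} (y x : SpinRoot G) : Prop :=
  y.pd.IsPol x.pd ∧ ∀ v : G.V,
    y.sign (G.contractMk y.pd.zeroEdges v) = x.sign (G.contractMk x.pd.zeroEdges v)

/-! ### The cones -/

/-- The vectors with integral coordinates. -/
def intLattice (E : Type) : AddSubgroup (E → ℝ) :=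
  ((Int.castAddHom ℝ).compLeft E).range

open scoped Classical in
/-- The vector `u_W` in `ℝ^{E(G^S)}`. -/
def uVec (G : WGraph n) (S : Set G.E) (W : Finset G.V) : (G.subdivide S).E → ℝ
  | Sum.inl _ => 0
  | Sum.inr (e, b) => if e.1 ∈ G.cut W then (if G.ends e.1 b ∈ W then 1 else -1) else 0

/-- The subspace `𝓛_S` of `ℝ^{E(G^S)}`. -/
def excSpace (G : WGraph n) (S : Set G.E) : Submodule ℝ ((G.subdivide S).E → ℝ) :=
  Submodule.span ℝ {u | ∃ W : Finset G.V, G.cut W ⊆ S ∧ u = uVec G S W}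

namespace PseudoDivisor

variable {G : WGraph n}

/-- The closed cone `λ`. -/
def lam (x : PseudoDivisor G) : Set (x.sub.E → ℝ) :=
  {p | (∀ a, 0 ≤ p a) ∧
    ∀ γ : x.sub.OrientedCycle, ∑ i, (x.flow (γ.dart i) : ℝ) * p (γ.dart i).1 = 0}

/-- The open cone `λ°`. -/
def lamOpen (x : PseudoDivisor G) : Set (x.sub.E → ℝ) := {p | p ∈ x.lam ∧ ∀ a, 0 < p a}

/-- The space `ℝ^{E(G^𝓔)} / 𝓛_𝓔`. -/
abbrev KapSpace (x : PseudoDivisor G) : Type := (x.sub.E → ℝ) ⧸ excSpace G x.exc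

/-- The closed cone `κ = 𝓣(λ)`. -/
def kap (x : PseudoDivisor G) : Set x.KapSpace := (excSpace G x.exc).mkQ '' x.lam

/-- The open cone `κ° = 𝓣(λ°)`. -/
def kapOpen (x : PseudoDivisor G) : Set x.KapSpace := (excSpace G x.exc).mkQ '' x.lamOpen

end PseudoDivisor


/-! ### The maps between the cones -/

namespace WGraph.Specialization

variable {G H : WGraph n} (f : Specialization G H)

theorem ext_mem {e : G.E} (h : e ∈ f.S) (p : H.E → ℝ) : f.ext p e = 0 := by
  simp [ext, h]

theorem ext_incl (a : H.E) (p : H.E → ℝ) : f.ext p (f.incl a) = p a := by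
  have h : (f.iso.edge.symm a).1 ∉ f.S := (f.iso.edge.symm a).2
  have h2 : f.iso.edge ⟨(f.iso.edge.symm a).1, h⟩ = a := f.iso.edge.apply_symm_apply a
  have h3 : f.ext p (f.incl a) = p (f.iso.edge ⟨(f.iso.edge.symm a).1, h⟩) := dif_neg h
  rw [h3, h2]

theorem incl_notMem (a : H.E) : f.incl a ∉ f.S := (f.iso.edge.symm a).2

theorem incl_injective : Function.Injective f.incl := fun _ _ h =>
  f.iso.edge.symm.injective (Subtype.ext h)

theorem exists_incl {e : G.E} (h : e ∉ f.S) : ∃ a, f.incl a = e :=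
  ⟨f.iso.edge ⟨e, h⟩, by
    have := f.iso.edge.symm_apply_apply ⟨e, h⟩
    exact congrArg Subtype.val this⟩

theorem vMap_eq_of_mem {e : G.E} (h : e ∈ f.S) (b c : Bool) :
    f.vMap (G.ends e b) = f.vMap (G.ends e c) := by
  have key : f.vMap (G.ends e false) = f.vMap (G.ends e true) := by
    unfold vMap
    congr 1
    exact Quotient.sound (Relation.EqvGen.rel _ _ ⟨e, h, rfl, rfl⟩)
  cases b <;> cases c <;> simp [key]

/-- The ends of an edge of `H` are the images of the ends of the corresponding edge of `G`. -/
theorem vMap_ends (a : H.E) : ∃ t : Bool, ∀ b,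
    f.vMap (G.ends (f.incl a) b) = H.ends a (xor b t) := by
  refine ⟨f.iso.flip (f.iso.edge.symm a), fun b => ?_⟩
  have := f.iso.ends_eq (f.iso.edge.symm a) b
  rw [f.iso.edge.apply_symm_apply] at this
  exact this

end WGraph.Specialization

namespace PDSpec

variable {G H : WGraph n} {x : PseudoDivisor G} {y : PseudoDivisor H} (f : PDSpec x y)

theorem mem_cut_incl (W : Finset H.V) (W' : Finset G.V)
    (hW : ∀ v, v ∈ W' ↔ f.base.vMap v ∈ W) (e : H.E) :
    f.base.incl e ∈ G.cut W' ↔ e ∈ H.cut W := by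
  obtain ⟨t, ht⟩ := f.base.vMap_ends e
  simp only [cut, Set.mem_ofPred_eq, hW, ht]
  cases t <;> simp [iff_comm]

theorem exists_incl_of_mem_cut (W : Finset H.V) (W' : Finset G.V)
    (hW : ∀ v, v ∈ W' ↔ f.base.vMap v ∈ W) {e : G.E} (he : e ∈ G.cut W') :
    ∃ e', f.base.incl e' = e ∧ e' ∈ H.cut W := by
  have h : e ∉ f.base.S := fun h => he (by
    rw [hW, hW, f.base.vMap_eq_of_mem h false true])
  obtain ⟨e', rfl⟩ := f.base.exists_incl h
  exact ⟨e', rfl, (f.mem_cut_incl W W' hW e').1 he⟩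

/-- The two edges of `G^𝓔` over an edge of `𝓔'` are not contracted. -/
theorem exists_incl_half (e' : {e : H.E // e ∈ y.exc}) (he : f.base.incl e'.1 ∈ x.exc)
    (b : Bool) : ∃ c, f.hat.incl (Sum.inr (e', c)) = Sum.inr (⟨f.base.incl e'.1, he⟩, b) := by
  have key : ∀ c, ∃ d, f.hat.incl (Sum.inr (e', c)) =
      Sum.inr (⟨f.base.incl e'.1, he⟩, d) := by
    intro c
    have h := f.edge_comm (Sum.inr (e', c))
    rcases h1 : f.hat.incl (Sum.inr (e', c)) with ⟨e, h2⟩ | ⟨⟨e, h2⟩, d⟩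
    · rw [h1] at h
      have h3 : e = f.base.incl e'.1 := h
      exact absurd (h3 ▸ he) h2
    · rw [h1] at h
      have h3 : e = f.base.incl e'.1 := h
      subst h3
      exact ⟨d, rfl⟩
  obtain ⟨d0, h0⟩ := key false
  obtain ⟨d1, h1⟩ := key true
  have hne : d0 ≠ d1 := by
    rintro rfl
    have h2 := Sum.inr_injective (f.hat.incl_injective (h0.trans h1.symm))
    exact Bool.false_ne_true (congrArg Prod.snd h2)
  by_cases hb : b = d0
  · exact ⟨false, hb ▸ h0⟩
  · refine ⟨true, ?_⟩
    have : b = d1 := by cases b <;> cases d0 <;> cases d1 <;> simp_all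
    exact this ▸ h1

/-- The edge of `G^𝓔` at a vertex `v` of `G` that corresponds to an exceptional edge of
`H^𝓔'` at a vertex `u` of `H`: then `v` is mapped to `u`. -/
theorem vMap_half (e' : {e : H.E // e ∈ y.exc}) (c : Bool) (e : {e : G.E // e ∈ x.exc})
    (b : Bool) (h : f.hat.incl (Sum.inr (e', c)) = Sum.inr (e, b)) :
    f.base.vMap (G.ends e.1 b) = H.ends e'.1 c := by
  obtain ⟨t, ht⟩ := f.hat.vMap_ends (Sum.inr (e', c))
  have h1 := ht false
  rw [h] at h1
  have h2 : f.hat.vMap (Sum.inl (G.ends e.1 b)) =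
      y.sub.ends (Sum.inr (e', c)) (xor false t) := h1
  rw [f.vert_comm] at h2
  cases t
  · exact Sum.inl_injective h2
  · exact absurd h2 (by simp [PseudoDivisor.sub, subdivide])

theorem ext_uVec (W : Finset H.V) (W' : Finset G.V) (hW : H.cut W ⊆ y.exc)
    (hW' : ∀ v, v ∈ W' ↔ f.base.vMap v ∈ W) :
    f.hat.ext (uVec H y.exc W) = uVec G x.exc W' := by
  funext a
  rcases a with ⟨e, he⟩ | ⟨⟨e, he⟩, b⟩
  · by_cases h : (Sum.inl ⟨e, he⟩ : x.sub.E) ∈ f.hat.S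
    · rw [f.hat.ext_mem h]; rfl
    · obtain ⟨a', ha'⟩ := f.hat.exists_incl h
      rw [← ha', f.hat.ext_incl, ha']
      rcases a' with e' | ⟨e', c⟩
      · rfl
      · have h1 := f.edge_comm (Sum.inr (e', c))
        rw [ha'] at h1
        have h2 : e = f.base.incl e'.1 := h1
        exact absurd (h2 ▸ f.exc_sub _ e'.2) he
  · by_cases hc : e ∈ G.cut W'
    · obtain ⟨e', h1, h2⟩ := f.exists_incl_of_mem_cut W W' hW' hc
      subst h1
      obtain ⟨c, h3⟩ := f.exists_incl_half ⟨e', hW h2⟩ he b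
      have h4 := f.vMap_half _ _ _ _ h3
      refine ((congrArg (f.hat.ext _) h3.symm).trans (f.hat.ext_incl _ _)).trans ?_
      have h5 : H.ends e' c ∈ W ↔ G.ends (f.base.incl e') b ∈ W' := by
        rw [hW']
        exact iff_of_eq (congrArg (· ∈ W) h4.symm)
      simp only [uVec, hc, h2, if_true]
      by_cases h6 : H.ends e' c ∈ W
      · rw [if_pos h6, if_pos (h5.1 h6)]
      · rw [if_neg h6, if_neg fun h7 => h6 (h5.2 h7)]
    · have h0 : uVec G x.exc W' (Sum.inr (⟨e, he⟩, b)) = 0 := by simp [uVec, hc]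
      rw [h0]
      by_cases h : (Sum.inr (⟨e, he⟩, b) : x.sub.E) ∈ f.hat.S
      · exact f.hat.ext_mem h _
      · obtain ⟨a', ha'⟩ := f.hat.exists_incl h
        rw [← ha', f.hat.ext_incl]
        rcases a' with e' | ⟨e', c⟩
        · rfl
        · have h1 := f.edge_comm (Sum.inr (e', c))
          rw [ha'] at h1
          have h2 : e = f.base.incl e'.1 := h1
          subst h2
          have h3 : e'.1 ∉ H.cut W := fun h4 => hc ((f.mem_cut_incl W W' hW' _).2 h4)
          simp [uVec, h3]

theorem excSpace_le :
    excSpace H y.exc ≤ (excSpace G x.exc).comap f.hat.ext := by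
  classical
  refine Submodule.span_le.2 ?_
  rintro u ⟨W, hW, rfl⟩
  have hW' : ∀ v, v ∈ Finset.univ.filter (fun v => f.base.vMap v ∈ W) ↔
      f.base.vMap v ∈ W := by simp
  refine Submodule.subset_span
    ⟨Finset.univ.filter fun v => f.base.vMap v ∈ W, ?_, f.ext_uVec W _ hW hW'⟩
  intro e he
  obtain ⟨e', rfl, h⟩ := f.exists_incl_of_mem_cut W _ hW' he
  exact f.exc_sub _ (hW h)

/-- The linear map `ℝ^{E(H^𝓔')} / 𝓛_𝓔' → ℝ^{E(G^𝓔)} / 𝓛_𝓔`. -/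
def kapMap : y.KapSpace →ₗ[ℝ] x.KapSpace :=
  (excSpace H y.exc).mapQ (excSpace G x.exc) f.hat.ext f.excSpace_le

/-- The linear map `ℝ^{E(H^𝓔')} → ℝ^{E(G^𝓔)} / 𝓛_𝓔`. -/
def lamToKap : (y.sub.E → ℝ) →ₗ[ℝ] x.KapSpace := (excSpace G x.exc).mkQ ∘ₗ f.hat.ext

end PDSpec

/-! ### Generalized cone complexes -/

/-- A subset of a real vector space with a lattice. -/
structure LatticeCone where
  W : Type
  [group : AddCommGroup W]
  [module : Module ℝ W]
  [top : TopologicalSpace W]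
  lattice : AddSubgroup W
  carrier : Set W

attribute [instance] LatticeCone.group LatticeCone.module LatticeCone.top

namespace LatticeCone

/-- The set is a rational polyhedral cone. -/
def IsRationalPolyhedral (A : LatticeCone) : Prop :=
  ∃ s : Finset A.W, (∀ v ∈ s, v ∈ A.lattice) ∧
    A.carrier = {p | ∃ c : A.W → ℝ, (∀ v ∈ s, 0 ≤ c v) ∧ p = ∑ v ∈ s, c v • v}

/-- An integral linear map that takes one set into the other, i.e. a morphism of cones. -/
def IsConeMorphism {A B : LatticeCone} (S : Set A.W) (T : Set B.W) (f : A.W →ₗ[ℝ] B.W) : Prop :=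
  (∀ v ∈ A.lattice, f v ∈ B.lattice) ∧ Set.MapsTo f S T

/-- `F` is a (not necessarily proper) face of the cone: it is cut out by a linear form which is
nonnegative on the cone. -/
def IsFace (A : LatticeCone) (F : Set A.W) : Prop :=
  ∃ l : A.W →ₗ[ℝ] ℝ, (∀ p ∈ A.carrier, 0 ≤ l p) ∧ F = {p | p ∈ A.carrier ∧ l p = 0}

/-- A face morphism: an isomorphism of cones onto a face. -/
def IsFaceMorphism {A B : LatticeCone} (f : A.W →ₗ[ℝ] B.W) : Prop :=
  ∃ F : Set B.W, B.IsFace F ∧ IsConeMorphism A.carrier F f ∧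
    ∃ h : B.W →ₗ[ℝ] A.W, IsConeMorphism F A.carrier h ∧
      (∀ p ∈ A.carrier, h (f p) = p) ∧ ∀ q ∈ F, f (h q) = q

end LatticeCone

/-- A diagram of cones, contravariant in the arrows. -/
structure ConeDiagram where
  Obj : Type 1
  Hom : Obj → Obj → Type
  cone : Obj → LatticeCone
  map : ∀ {a b : Obj}, Hom a b → ((cone b).W →ₗ[ℝ] (cone a).W)

namespace ConeDiagram

/-- The disjoint union of the cones. -/
abbrev Total (A : ConeDiagram) : Type 1 := Σ a : A.Obj, {p : (A.cone a).W // p ∈ (A.cone a).carrier}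

/-- A point of a cone is glued with its images under the maps of the diagram. -/
def Glue (A : ConeDiagram) (p q : A.Total) : Prop := ∃ f : A.Hom q.1 p.1, A.map f p.2.1 = q.2.1

/-- The colimit of the diagram, with the quotient topology. -/
def Space (A : ConeDiagram) : Type 1 := Quot A.Glue

instance (A : ConeDiagram) : TopologicalSpace A.Space :=
  inferInstanceAs (TopologicalSpace (Quot A.Glue))

/-- The class in the colimit of a point of a cone. -/
def pt (A : ConeDiagram) (a : A.Obj) (p : (A.cone a).W) (hp : p ∈ (A.cone a).carrier) : A.Space :=
  Quot.mk _ ⟨a, p, hp⟩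

/-- The colimit is a generalized cone complex: the cones are rational polyhedral, the maps are
face morphisms, and up to isomorphism the diagram is finite. -/
structure IsGeneralizedConeComplex (A : ConeDiagram) : Prop where
  polyhedral : ∀ a, (A.cone a).IsRationalPolyhedral
  face : ∀ {a b : A.Obj} (f : A.Hom a b), LatticeCone.IsFaceMorphism (A.map f)
  finite_obj : ∃ F : Set A.Obj, F.Finite ∧ ∀ a, ∃ b ∈ F, ∃ (f : A.Hom a b) (h : A.Hom b a),
    A.map f ∘ₗ A.map h = LinearMap.id ∧ A.map h ∘ₗ A.map f = LinearMap.id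
  finite_hom : ∀ a b, Finite (A.Hom a b)

/-- A morphism of generalized cone complexes. -/
def IsMorphism {A B : ConeDiagram} (f : A.Space → B.Space) : Prop :=
  Continuous f ∧ ∀ a : A.Obj, ∃ (b : B.Obj) (T : (A.cone a).W →ₗ[ℝ] (B.cone b).W),
    LatticeCone.IsConeMorphism (A.cone a).carrier (B.cone b).carrier T ∧
    ∀ p hp, ∃ hq, f (A.pt a p hp) = B.pt b (T p) hq

/-- A refinement: a bijective morphism of generalized cone complexes. -/
def IsRefinement {A B : ConeDiagram} (f : A.Space → B.Space) : Prop :=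
  IsMorphism f ∧ Function.Bijective f

end ConeDiagram

/-! ### The spaces `Q` and `S` and the map between them -/

/-- The spin `v₀`-quasistable root-graphs of genus `g` with `n` legs; the vertex `v₀` is the
one to which the first leg is incident. -/
structure SPQ (g n : ℕ) [NeZero n] where
  graph : WGraph n
  stable : graph.IsStable g
  root : SpinRoot graph
  quasistable : root.pd.Quasistable (graph.leg 0)

/-- The spin polystable root-graphs of genus `g` with `n` legs. -/
structure SP (g n : ℕ) where
  graph : WGraph n
  stable : graph.IsStable g
  root : SpinRoot graph
  polystable : root.pd.Polystable

/-- The diagram of the cones `λ` over the category of spin quasistable root-graphs. -/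
def Qtrop (g n : ℕ) [NeZero n] : ConeDiagram where
  Obj := SPQ g n
  Hom a b := SpinSpec a.root b.root
  cone a := { W := a.root.pd.sub.E → ℝ, lattice := intLattice _, carrier := a.root.pd.lam }
  map f := f.hat.ext

/-- The diagram of the cones `κ` over the category of spin polystable root-graphs. The lattice
of `ℝ^{E(G^𝓔)} / 𝓛_𝓔` is the image of the vectors with integral coordinates. -/
def Strop (g n : ℕ) : ConeDiagram where
  Obj := SP g n
  Hom a b := SpinSpec a.root b.root
  cone a :=
    { W := a.root.pd.KapSpace
      lattice := (intLattice _).map (excSpace a.graph a.root.pd.exc).mkQ.toAddMonoidHom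
      carrier := a.root.pd.kap }
  map f := f.kapMap

/-- `ρ : Q → S` is the map that is given on the cone `λ` of a spin quasistable root-graph `a` by
the inclusion `λ → κ` into the cone of `pol(a)`. -/
def IsRhoS {g n : ℕ} [NeZero n] (ρ : (Qtrop g n).Space → (Strop g n).Space) : Prop :=
  ∀ (a : SPQ g n) (y : SpinRoot a.graph) (hy : IsSpinPol y a.root) (f : SpinSpec y a.root),
    f.base.IsId → ∀ (p : a.root.pd.sub.E → ℝ) (hp : p ∈ a.root.pd.lam),
      ∃ hq : f.lamToKap p ∈ y.pd.kap,
        ρ ((Qtrop g n).pt a p hp) =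
          (Strop g n).pt ⟨a.graph, a.stable, y, hy.1.1⟩ (f.lamToKap p) hq

/-! ### Decompositions -/

/-- The subset `A` of the space of the cone `κ` of `y` is the disjoint union of the open cones
`λ°` of a family of spin root-graphs `(H i, x i)`. The cones are embedded by means of the
specializations `y → x i` that satisfy `adm i`: such specializations exist, and they all give
the same map on `λ`, which is injective. -/
structure IsDecomposition {G : WGraph n} (y : SpinRoot G) (A : Set y.pd.KapSpace)
    {I : Type} (H : I → WGraph n) (x : ∀ i, SpinRoot (H i))
    (adm : ∀ i, SpinSpec y (x i) → Prop) : Prop where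
  exists_spec : ∀ i, ∃ f, adm i f
  indep : ∀ i f h, adm i f → adm i h → Set.EqOn f.lamToKap h.lamToKap (x i).pd.lam
  inj : ∀ i f, adm i f → Set.InjOn f.lamToKap (x i).pd.lam
  cover : ∀ q, q ∈ A ↔ ∃ i f, adm i f ∧ q ∈ f.lamToKap '' (x i).pd.lamOpen
  disjoint : ∀ i j f h, i ≠ j → adm i f → adm j h →
    Disjoint (f.lamToKap '' (x i).pd.lamOpen) (h.lamToKap '' (x j).pd.lamOpen)

/-- The spin quasistable pseudo-roots `x` on `G` with `pol(x) = y`. -/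
def PolFibre [NeZero n] {G : WGraph n} (y : SpinRoot G) : Type :=
  {x : SpinRoot G // x.pd.Quasistable (G.leg 0) ∧ IsSpinPol y x}

/-- The spin quasistable root-graphs `(G / S, x)` to which `(G, y)` specializes, where `S` is a
set of edges of `G`. -/
def QuasiSpecs [NeZero n] {G : WGraph n} (y : SpinRoot G) : Type :=
  {i : Σ S : Set G.E, SpinRoot (G.contract S) //
    i.2.pd.Quasistable ((G.contract i.1).leg 0) ∧ ∃ f : SpinSpec y i.2, f.base.IsCanonical}

end SpinTrop

end

open SpinTrop

noncomputable section

namespace SpinTrop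

open scoped Classical

namespace WGraph

variable {n : ℕ} {G H K : WGraph n}

/-! ### Contractions and specializations -/

/-! Everything is controlled by the vector of edge lengths of the graph `G`. For a flow with `2D +
Div(φ) = K`, twice `β(W)` is the sum of `1 - φ` over the oriented edges entering `W` (`two_beta`).
Hence the flow of a semistable pseudo-root takes the values `-1, 0, 1`, is unique, and is `1` into
every exceptional vertex. A point of `λ` is then a nonnegative vector together with a potential on
`V(G)` whose slopes are given by the flow (`mem_lam_iff`). The map `len` adds the two halves of
every subdivided edge; it kills the subspace divided out in `κ`, so points of `κ` have lengths as
well.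

For a polystable pseudo-root the flow is zero off the exceptional edges, so the root is determined
by its set `P` of zero edges, and the exceptional edges are the complement of `P`
(`Polystable.zeroEdges_eq`). Two points of its `λ` with equal lengths differ by an element of that
subspace (`sub_mem_excSpace`). Thus the lengths identify `κ` with the full nonnegative orthant on
`E(G)`, and `κ°` with the positive one.

For a quasistable pseudo-root every vertex is reached from `v₀` along oriented edges with `φ ≥ 0`
(`Quasistable.closed`). The potential rises by the full length where `φ = 1`, is constant where `φ =
0`, and has Lipschitz constant one everywhere: it is the distance from `v₀` once the edges of `P`
are shrunk to length zero. So `P` and the lengths determine the potential, the point, and, for a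
point of `λ°`, the root (`potential_eq`, `len_injOn`, `eq_of_len`). Conversely, for positive lengths
and any `P` of the right parity, the distance function produces a quasistable root
(`exists_quasistable`); an edge outside `P` is exceptional exactly when the slope along it is less
than one in absolute value.

Zero edges and signs push forward along specializations and are unchanged by `pol` (`Compat`,
`isSpinPol_iff`). For fixed `P` and signs, the cones `λ°` therefore partition the positive orthant;
contracting the edges of length zero extends this to the closed cone. The same recipe, contract the
edges of length zero and take the quasistable root of the remaining lengths, is the inverse of `ρ`.
For the axioms of a cone complex, `λ` is generated by the 0/1-vectors that it contains, faces are
given by the vanishing of contracted lengths, and stable graphs of bounded type carry finitely many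
spin roots up to isomorphism. -/

theorem contractMk_eq_iff {S : Set G.E} {u v : G.V} :
    G.contractMk S u = G.contractMk S v ↔ G.connSetoid S u v := Quotient.eq

theorem connSetoid_of_mem {S : Set G.E} {e : G.E} (he : e ∈ S) (b c : Bool) :
    G.connSetoid S (G.ends e b) (G.ends e c) := by
  have h : G.connSetoid S (G.ends e false) (G.ends e true) :=
    Relation.EqvGen.rel _ _ ⟨e, he, rfl, rfl⟩
  cases b <;> cases c
  · exact Setoid.refl' _ _
  · exact h
  · exact Setoid.symm' _ h
  · exact Setoid.refl' _ _

/-- Functions that agree at the ends of the edges of `S` are constant on the components. -/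
theorem eq_of_connSetoid {S : Set G.E} {α : Sort*} {f : G.V → α}
    (hf : ∀ e ∈ S, f (G.ends e false) = f (G.ends e true)) {u v : G.V}
    (h : G.connSetoid S u v) : f u = f v := by
  change Relation.EqvGen _ u v at h
  induction h with
  | rel u v h => obtain ⟨e, he, rfl, rfl⟩ := h; exact hf e he
  | refl => rfl
  | symm _ _ _ ih => exact ih.symm
  | trans _ _ _ _ _ ih1 ih2 => exact ih1.trans ih2

/-- A relation-valued version of `eq_of_connSetoid`. -/
theorem connSetoid_le {S : Set G.E} (r : Setoid G.V)
    (hr : ∀ e ∈ S, r (G.ends e false) (G.ends e true)) {u v : G.V}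
    (h : G.connSetoid S u v) : r u v := by
  change Relation.EqvGen _ u v at h
  induction h with
  | rel u v h => obtain ⟨e, he, rfl, rfl⟩ := h; exact hr e he
  | refl => exact r.refl _
  | symm _ _ _ ih => exact r.symm ih
  | trans _ _ _ _ _ ih1 ih2 => exact r.trans ih1 ih2

theorem connSetoid_mono {S T : Set G.E} (h : S ⊆ T) {u v : G.V}
    (huv : G.connSetoid S u v) : G.connSetoid T u v :=
  connSetoid_le _ (fun _ he => connSetoid_of_mem (h he) _ _) huv

/-- A connected graph with `m` edges has at most `m + 1` vertices. -/
theorem ncard_class_le (S : Set G.E) (c : Quotient (G.connSetoid S)) :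
    {v : G.V | Quotient.mk (G.connSetoid S) v = c}.ncard ≤
      {e : G.E | e ∈ S ∧ Quotient.mk (G.connSetoid S) (G.ends e false) = c}.ncard + 1 := by
  -- In the simple graph `A`, parallel edges are merged and loops dropped, which only lowers the
  -- number of edges.
  let X := {v : G.V // Quotient.mk (G.connSetoid S) v = c}
  let A : SimpleGraph X := SimpleGraph.fromRel fun u v =>
    ∃ e ∈ S, G.ends e false = u.1 ∧ G.ends e true = v.1
  have hconn : A.Connected := by
    obtain ⟨v₀, hv₀⟩ := Quotient.exists_rep c
    refine (SimpleGraph.connected_iff _).2 ⟨?_, ⟨⟨v₀, hv₀⟩⟩⟩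
    have key : ∀ u v, Relation.EqvGen
        (fun u v => ∃ e ∈ S, G.ends e false = u ∧ G.ends e true = v) u v →
        ∀ (hu : Quotient.mk (G.connSetoid S) u = c) (hv : Quotient.mk (G.connSetoid S) v = c),
          A.Reachable ⟨u, hu⟩ ⟨v, hv⟩ := by
      intro u v h
      induction h with
      | rel u v h =>
        intro hu hv
        by_cases huv : u = v
        · subst huv; exact SimpleGraph.Reachable.refl _
        · refine SimpleGraph.Adj.reachable ?_
          rw [SimpleGraph.fromRel_adj]
          exact ⟨fun h' => huv (congrArg Subtype.val h'), Or.inl h⟩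
      | refl => intro _ _; exact SimpleGraph.Reachable.refl _
      | symm _ _ _ ih => intro hu hv; exact (ih hv hu).symm
      | trans u v w h1 h2 ih1 ih2 =>
        intro hu hw
        have hv : Quotient.mk (G.connSetoid S) v = c := by
          rw [← hu]; exact (Quotient.sound h1).symm
        exact (ih1 hu hv).trans (ih2 hv hw)
    intro u v
    exact key u.1 v.1 (Quotient.exact (u.2.trans v.2.symm)) u.2 v.2
  have h1 := hconn.card_vert_le_card_edgeSet_add_one
  have h2 : Nat.card A.edgeSet ≤ Nat.card
      {e : G.E | e ∈ S ∧ Quotient.mk (G.connSetoid S) (G.ends e false) = c} := by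
    have ex : ∀ a : A.edgeSet, ∃ e : {e : G.E | e ∈ S ∧
        Quotient.mk (G.connSetoid S) (G.ends e false) = c},
        s(G.ends e.1 false, G.ends e.1 true) = Sym2.map Subtype.val a.1 := by
      rintro ⟨a, ha⟩
      induction a using Sym2.ind with
      | _ u v =>
        rw [SimpleGraph.mem_edgeSet, SimpleGraph.fromRel_adj] at ha
        rcases ha.2 with ⟨e, he, h1, h2⟩ | ⟨e, he, h1, h2⟩
        · exact ⟨⟨e, he, by rw [h1]; exact u.2⟩, by simp [h1, h2]⟩
        · exact ⟨⟨e, he, by rw [h1]; exact v.2⟩, by simp [h1, h2, Sym2.eq_swap]⟩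
    choose f hf using ex
    refine Nat.card_le_card_of_injective f fun a b hab => ?_
    have := hf a
    rw [hab, hf b] at this
    exact Subtype.ext (Sym2.map.injective Subtype.val_injective this.symm)
  have h3 : Nat.card X = {v : G.V | Quotient.mk (G.connSetoid S) v = c}.ncard := rfl
  rw [← h3]
  exact h1.trans (Nat.add_le_add_right h2 1)

theorem contract_weight (S : Set G.E) (c : (G.contract S).V) : (G.contract S).weight c =
    (∑ v, if G.contractMk S v = c then G.weight v else 0) +
    ({e : G.E | e ∈ S ∧ G.contractMk S (G.ends e false) = c}.ncard + 1 -
      {v : G.V | G.contractMk S v = c}.ncard) := by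
  unfold contract contractMk
  dsimp only
  congr!

namespace Specialization

variable (f : Specialization G H)

theorem vMap_surjective : Function.Surjective f.vMap :=
  f.iso.vert.surjective.comp Quotient.mk_surjective

theorem vMap_eq_iff {u v : G.V} : f.vMap u = f.vMap v ↔ G.connSetoid f.S u v := by
  rw [vMap, vMap, f.iso.vert.injective.eq_iff, contractMk_eq_iff]

/-- Whether the reference direction of an edge of the target is reversed. -/
def tw (a : H.E) : Bool := f.iso.flip (f.iso.edge.symm a)

theorem vMap_ends_tw (a : H.E) (b : Bool) :
    f.vMap (G.ends (f.incl a) b) = H.ends a (xor b (f.tw a)) := by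
  have := f.iso.ends_eq (f.iso.edge.symm a) b
  rw [f.iso.edge.apply_symm_apply] at this
  exact this

theorem dartIncl_eq (d : H.Dart) : f.dartIncl d = (f.incl d.1, xor d.2 (f.tw d.1)) := rfl

theorem vMap_src (d : H.Dart) : f.vMap (G.src (f.dartIncl d)) = H.src d := by
  rw [src, dartIncl_eq, vMap_ends_tw]; simp [src]

theorem vMap_tgt (d : H.Dart) : f.vMap (G.tgt (f.dartIncl d)) = H.tgt d := by
  rw [tgt, dartIncl_eq, vMap_ends_tw]
  cases h : d.2 <;> cases h' : f.tw d.1 <;> simp [tgt, h]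

theorem mem_S_iff {e : G.E} : e ∈ f.S ↔ e ∉ Set.range f.incl := by
  constructor
  · rintro h ⟨a, rfl⟩; exact f.incl_notMem a h
  · intro h; by_contra h'; exact h (f.exists_incl h')

theorem leg_eq (i : Fin n) : f.vMap (G.leg i) = H.leg i := f.iso.leg_eq i

theorem exists_dartIncl {d : G.Dart} (h : d.1 ∉ f.S) : ∃ d', f.dartIncl d' = d := by
  obtain ⟨a, ha⟩ := f.exists_incl h
  refine ⟨(a, xor d.2 (f.tw a)), ?_⟩
  rw [dartIncl_eq]
  refine Prod.ext ha ?_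
  simp

theorem sum_edge {M : Type*} [AddCommMonoid M] (F : G.E → M) :
    ∑ e, F e = ∑ a, F (f.incl a) + ∑ e, if e ∈ f.S then F e else 0 := by
  rw [← Finset.sum_filter_not_add_sum_filter (s := Finset.univ) (p := fun e => e ∈ f.S),
    Finset.sum_filter (p := fun e => e ∈ f.S)]
  congr 1
  refine (Finset.sum_bij (fun a _ => f.incl a) ?_ ?_ ?_ ?_).symm
  · intro a _; simp [f.incl_notMem a]
  · intro a _ b _ h; exact f.incl_injective h
  · intro e he
    obtain ⟨a, ha⟩ := f.exists_incl (by simpa using he)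
    exact ⟨a, by simp, ha⟩
  · intro a _; rfl

theorem sum_dart {M : Type*} [AddCommMonoid M] (F : G.Dart → M) :
    ∑ d, F d = ∑ d, F (f.dartIncl d) +
      ∑ e, if e ∈ f.S then F (e, false) + F (e, true) else 0 := by
  rw [Fintype.sum_prod_type, Fintype.sum_prod_type, f.sum_edge]
  congr 1
  · refine Finset.sum_congr rfl fun a _ => ?_
    simp only [Fintype.sum_bool, dartIncl_eq]
    cases f.tw a <;> simp [add_comm]
  · refine Finset.sum_congr rfl fun e _ => ?_
    simp [add_comm]

end Specialization

theorem degIn_eq_sum (S : Set G.E) (v : G.V) :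
    G.degIn S v = ∑ d : G.Dart, if d.1 ∈ S ∧ G.src d = v then 1 else 0 := by
  rw [degIn, Set.ncard_eq_toFinset_card', Finset.card_eq_sum_ones, ← Finset.sum_filter]
  refine Finset.sum_congr ?_ fun _ _ => rfl
  ext d; simp

namespace Specialization

variable (f : Specialization G H)

/-- A contracted edge has both ends in one fibre, hence the factor `2`. -/
theorem sum_degIn (A : Set G.E) (u : H.V) :
    (∑ v, if f.vMap v = u then G.degIn A v else 0) = H.degIn (f.incl ⁻¹' A) u +
      2 * {e | e ∈ f.S ∧ e ∈ A ∧ f.vMap (G.ends e false) = u}.ncard := by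
  have h1 : (∑ v, if f.vMap v = u then G.degIn A v else 0) =
      ∑ d : G.Dart, if d.1 ∈ A ∧ f.vMap (G.src d) = u then 1 else 0 := by
    simp only [degIn_eq_sum]
    have : ∀ v, (if f.vMap v = u then
        ∑ d : G.Dart, (if d.1 ∈ A ∧ G.src d = v then 1 else 0) else 0) =
        ∑ d : G.Dart, if d.1 ∈ A ∧ G.src d = v ∧ f.vMap v = u then 1 else 0 := by
      intro v
      split_ifs with h
      · simp [h]
      · simp [h]
    simp only [this]
    rw [Finset.sum_comm]
    refine Finset.sum_congr rfl fun d _ => ?_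
    by_cases hd : d.1 ∈ A
    · by_cases hu : f.vMap (G.src d) = u
      · rw [Finset.sum_eq_single (G.src d)] <;> simp +contextual [hd, hu, eq_comm]
      · rw [Finset.sum_eq_zero]
        · simp [hu]
        · intro v _
          rw [if_neg]
          rintro ⟨_, h2, h3⟩
          exact hu (h2 ▸ h3)
    · simp [hd]
  rw [h1, f.sum_dart, degIn_eq_sum]
  congr 1
  · refine Finset.sum_congr rfl fun d _ => ?_
    rw [f.vMap_src]; rfl
  · rw [Set.ncard_eq_toFinset_card', Finset.card_eq_sum_ones, Finset.mul_sum,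
      Set.toFinset_ofPred, Finset.sum_filter]
    refine Finset.sum_congr rfl fun e _ => ?_
    by_cases he : e ∈ f.S
    · have := f.vMap_eq_of_mem he true false
      by_cases hA : e ∈ A <;> by_cases hu : f.vMap (G.ends e false) = u <;>
        simp [he, hA, src, this, hu]
    · simp [he]

/-- The additive form avoids the truncated subtraction in the weight of a contracted vertex; by
`ncard_class_le` nothing is truncated there. -/
theorem weight_eq (u : H.V) : (H.weight u : ℤ) + {v | f.vMap v = u}.ncard =
    (∑ v, if f.vMap v = u then (G.weight v : ℤ) else 0) +
      {e | e ∈ f.S ∧ f.vMap (G.ends e false) = u}.ncard + 1 := by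
  obtain ⟨c, rfl⟩ := f.iso.vert.surjective u
  rw [f.iso.weight_eq]
  have h1 : ∀ v, f.vMap v = f.iso.vert c ↔ G.contractMk f.S v = c := fun v =>
    f.iso.vert.injective.eq_iff
  simp only [h1]
  have h2 : {v : G.V | G.contractMk f.S v = c}.ncard ≤
    {e : G.E | e ∈ f.S ∧ G.contractMk f.S (G.ends e false) = c}.ncard + 1 :=
    ncard_class_le f.S c
  rw [contract_weight]
  push_cast [Nat.cast_sub h2]
  ring

/-- Contracting a connected piece with `k` vertices and `m` edges adds `m - k + 1` to the weight,
which makes up for the `2m` lost in the degrees and the `-2` per vertex. This equality replaces the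
condition on weights whenever a specialization is constructed. -/
theorem canonical_eq (u : H.V) :
    H.canonical u = ∑ v, if f.vMap v = u then G.canonical v else 0 := by
  have h1 := f.sum_degIn Set.univ u
  have h2 := f.weight_eq u
  have h3 : (∑ v, if f.vMap v = u then G.canonical v else 0) =
      2 * (∑ v, if f.vMap v = u then (G.weight v : ℤ) else 0) -
      2 * ({v | f.vMap v = u}.ncard : ℤ) +
      ((∑ v, if f.vMap v = u then G.degIn Set.univ v else 0 : ℕ) : ℤ) := by
    rw [Set.ncard_eq_toFinset_card', Finset.card_eq_sum_ones, Set.toFinset_ofPred,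
      Finset.sum_filter]
    push_cast
    rw [Finset.mul_sum, Finset.mul_sum, ← Finset.sum_sub_distrib, ← Finset.sum_add_distrib]
    refine Finset.sum_congr rfl fun v _ => ?_
    simp only [canonical, deg]
    split_ifs <;> ring
  rw [h3, h1]
  simp only [canonical, deg, Set.preimage_univ, Set.mem_univ, true_and]
  push_cast
  linarith

/-- Weights never drop under contraction; this is what lets a pushed-forward sign function vanish at
the vertices of weight zero. -/
theorem weight_le (v : G.V) : G.weight v ≤ H.weight (f.vMap v) := by
  have h1 : H.weight (f.vMap v) = (G.contract f.S).weight (G.contractMk f.S v) :=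
    f.iso.weight_eq _
  rw [h1, contract_weight]
  refine le_trans ?_ (Nat.le_add_right _ _)
  have := Finset.single_le_sum (f := fun w => if G.contractMk f.S w =
    G.contractMk f.S v then G.weight w else 0) (fun _ _ => Nat.zero_le _) (Finset.mem_univ v)
  refine le_trans ?_ this
  simp

end Specialization

/-- The natural specialization `G → G / S`. -/
def contractSpec (G : WGraph n) (S : Set G.E) : Specialization G (G.contract S) where
  S := S
  iso :=
    { vert := Equiv.refl _
      edge := Equiv.refl _
      flip := fun _ => false
      ends_eq := by intro e b; simp
      weight_eq := fun _ => rfl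
      leg_eq := fun _ => rfl }

theorem contractSpec_isCanonical (S : Set G.E) : (G.contractSpec S).IsCanonical :=
  ⟨fun _ => rfl, fun _ => rfl⟩

/-- A specialization is given by its maps on vertices and edges, if the fibres are connected and
the canonical divisor is preserved. -/
theorem exists_specialization (vm : G.V → H.V) (inc : H.E → G.E) (tw : H.E → Bool)
    (hsurj : Function.Surjective vm) (hinj : Function.Injective inc)
    (hends : ∀ a b, vm (G.ends (inc a) b) = H.ends a (xor b (tw a)))
    (hcontr : ∀ e, e ∉ Set.range inc → vm (G.ends e false) = vm (G.ends e true))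
    (hconn : ∀ u v, vm u = vm v → G.connSetoid (Set.range inc)ᶜ u v)
    (hK : ∀ u, H.canonical u = ∑ v, if vm v = u then G.canonical v else 0)
    (hleg : ∀ i, vm (G.leg i) = H.leg i) :
    ∃ f : Specialization G H, f.S = (Set.range inc)ᶜ ∧ (∀ v, f.vMap v = vm v) ∧
      (∀ a, f.incl a = inc a) ∧ ∀ a, f.tw a = tw a := by
  let S : Set G.E := (Set.range inc)ᶜ
  have hS : ∀ u v, G.connSetoid S u v → vm u = vm v := fun u v h =>
    eq_of_connSetoid (fun e he => hcontr e he) h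
  let q : (G.contract S).V → H.V := Quotient.lift vm hS
  have hq : Function.Bijective q := by
    constructor
    · intro a b
      refine Quotient.inductionOn₂ a b fun u v h => ?_
      exact Quotient.sound (hconn u v h)
    · intro u
      obtain ⟨v, rfl⟩ := hsurj u
      exact ⟨Quotient.mk _ v, rfl⟩
  let i : H.E → (G.contract S).E := fun a => ⟨inc a, fun h => h ⟨a, rfl⟩⟩
  have hi : Function.Bijective i := by
    constructor
    · intro a b h; exact hinj (congrArg Subtype.val h)
    · rintro ⟨e, he⟩
      obtain ⟨a, ha⟩ := not_not.1 he
      exact ⟨a, Subtype.ext ha⟩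
  let E := (Equiv.ofBijective i hi).symm
  have hE : ∀ e, inc (E e) = e.1 := fun e =>
    congrArg Subtype.val ((Equiv.ofBijective i hi).apply_symm_apply e)
  have hends' : ∀ (e : (G.contract S).E) (b : Bool),
      q ((G.contract S).ends e b) = H.ends (E e) (xor b (tw (E e))) := by
    intro e b
    rw [← hends, hE]; rfl
  let g := G.contractSpec S
  have hdeg : ∀ c, H.deg (q c) = (G.contract S).deg c := by
    intro c
    rw [deg, deg, degIn_eq_sum, degIn_eq_sum, Fintype.sum_prod_type, Fintype.sum_prod_type]
    refine (Fintype.sum_equiv E _ _ fun e => ?_).symm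
    simp only [Fintype.sum_bool, src, Set.mem_univ, true_and]
    have h1 : ∀ b, (G.contract S).ends e b = c ↔ H.ends (E e) (xor b (tw (E e))) = q c := by
      intro b
      rw [← hends', hq.1.eq_iff]
    rw [h1, h1]
    cases tw (E e) <;> simp [add_comm]
  -- Degrees are determined by the map on edges, so equality of canonical divisors is equality of
  -- weights.
  have hcan : ∀ c, H.canonical (q c) = (G.contract S).canonical c := by
    intro c
    rw [hK, g.canonical_eq]
    refine Finset.sum_congr rfl fun v _ => ?_
    have : vm v = q c ↔ g.vMap v = c := by
      rw [← hq.1.eq_iff]; rfl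
    simp only [this]
  refine ⟨⟨S, ⟨Equiv.ofBijective q hq, E, fun e => tw (E e), hends', ?_, fun i => hleg i⟩⟩,
    rfl, fun _ => rfl, fun a => ?_, fun a => ?_⟩
  · intro c
    have h1 := hcan c
    have h2 := hdeg c
    simp only [canonical, h2] at h1
    change H.weight (q c) = _
    omega
  · rfl
  · change tw (E (E.symm a)) = tw a
    rw [Equiv.apply_symm_apply]

theorem exists_id (G : WGraph n) : ∃ f : Specialization G G, f.IsId ∧ f.S = ∅ := by
  obtain ⟨f, hS, h1, h2, -⟩ := exists_specialization (G := G) (H := G) id id (fun _ => false)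
    Function.surjective_id Function.injective_id (by simp) (by simp)
    (by rintro u v rfl; exact Setoid.refl' _ _)
    (by intro u; simp) (by simp)
  exact ⟨f, ⟨h1, h2⟩, by simpa using hS⟩

theorem Specialization.IsCanonical.S_eq {S : Set G.E} {f : Specialization G (G.contract S)}
    (h : f.IsCanonical) : f.S = S := by
  ext e
  rw [f.mem_S_iff]
  constructor
  · intro h'
    by_contra he
    exact h' ⟨⟨e, he⟩, h.2 ⟨e, he⟩⟩
  · rintro he ⟨a, ha⟩
    have := h.2 a
    rw [ha] at this
    exact a.2 (this ▸ he)

/-- Only the maps on vertices and edges are recorded: zero edges, signs and `ext` depend on nothing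
else. -/
theorem Specialization.exists_comp (f : Specialization G H) (g : Specialization H K) :
    ∃ h : Specialization G K, (∀ v, h.vMap v = g.vMap (f.vMap v)) ∧
      ∀ a, h.incl a = f.incl (g.incl a) := by
  obtain ⟨h, -, h1, h2, -⟩ := exists_specialization (G := G) (H := K) (g.vMap ∘ f.vMap)
    (f.incl ∘ g.incl) (fun a => xor (f.tw (g.incl a)) (g.tw a))
    (g.vMap_surjective.comp f.vMap_surjective) (f.incl_injective.comp g.incl_injective)
    (by
      intro a b
      simp only [Function.comp, f.vMap_ends_tw, g.vMap_ends_tw, Bool.xor_assoc])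
    (by
      intro e he
      by_cases h : e ∈ f.S
      · simp only [Function.comp, f.vMap_eq_of_mem h false true]
      · obtain ⟨a, rfl⟩ := f.exists_incl h
        have ha : a ∈ g.S := by
          rw [g.mem_S_iff]
          rintro ⟨b, rfl⟩
          exact he ⟨b, rfl⟩
        simp only [Function.comp, f.vMap_ends_tw]
        exact g.vMap_eq_of_mem ha _ _)
    (by
      intro u v h
      have hle : f.S ⊆ (Set.range (f.incl ∘ g.incl))ᶜ := by
        rintro e he ⟨a, rfl⟩
        exact f.incl_notMem _ he
      -- A path contracted by `g` lifts to `G`: its edges come from edges of `G`, and between them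
      -- one moves inside the connected fibres of `f`.
      have key : ∀ a b, H.connSetoid g.S a b → ∀ u v, f.vMap u = a → f.vMap v = b →
          G.connSetoid (Set.range (f.incl ∘ g.incl))ᶜ u v := by
        intro a b hab
        refine connSetoid_le (r := ⟨fun a b => ∀ u v, f.vMap u = a → f.vMap v = b →
          G.connSetoid (Set.range (f.incl ∘ g.incl))ᶜ u v, ?_, ?_, ?_⟩) ?_ hab
        · rintro a u v hu hv
          exact connSetoid_mono hle (f.vMap_eq_iff.1 (hu.trans hv.symm))
        · intro a b h u v hu hv
          exact Setoid.symm' _ (h v u hv hu)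
        · intro a b c h1 h2 u w hu hw
          obtain ⟨v, hv⟩ := f.vMap_surjective b
          exact Setoid.trans' _ (h1 u v hu hv) (h2 v w hv hw)
        · intro e he u v hu hv
          have h1 : f.incl e ∈ (Set.range (f.incl ∘ g.incl))ᶜ := by
            rintro ⟨a, ha⟩
            exact (g.mem_S_iff.1 he) ⟨a, f.incl_injective ha⟩
          have h2 := fun b => f.vMap_ends_tw e b
          have h3 : ∀ b, ∃ c, f.vMap (G.ends (f.incl e) c) = H.ends e b := fun b =>
            ⟨xor b (f.tw e), by rw [h2]; simp⟩
          obtain ⟨b, hb⟩ := h3 false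
          obtain ⟨c, hc⟩ := h3 true
          have h4 := connSetoid_mono hle (f.vMap_eq_iff.1 (hu.trans hb.symm))
          have h5 := connSetoid_mono hle (f.vMap_eq_iff.1 (hc.trans hv.symm))
          exact Setoid.trans' _ (Setoid.trans' _ h4 (connSetoid_of_mem h1 _ _)) h5
      exact key _ _ (g.vMap_eq_iff.1 h) u v rfl rfl)
    (by
      intro u
      rw [g.canonical_eq]
      simp only [f.canonical_eq, Function.comp]
      have : ∀ w, (if g.vMap w = u then ∑ v, (if f.vMap v = w then G.canonical v else 0) else 0)
          = ∑ v, if f.vMap v = w then (if g.vMap w = u then G.canonical v else 0) else 0 := by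
        intro w
        split_ifs <;> simp
      simp only [this]
      rw [Finset.sum_comm]
      refine Finset.sum_congr rfl fun v _ => ?_
      simp)
    (by intro i; simp only [Function.comp, f.leg_eq, g.leg_eq])
  exact ⟨h, h1, h2⟩

/-- A specialization that contracts more edges factors through one that contracts fewer. -/
theorem Specialization.exists_factor (f : Specialization G H) (g : Specialization G K)
    (hS : f.S ⊆ g.S) : ∃ h : Specialization H K, (∀ v, h.vMap (f.vMap v) = g.vMap v) ∧
      ∀ a, f.incl (h.incl a) = g.incl a := by
  choose s hs using f.vMap_surjective
  have hg : ∀ a : K.E, g.incl a ∉ f.S := fun a h => g.incl_notMem a (hS h)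
  choose j hj using fun a => f.exists_incl (hg a)
  have hv : ∀ u v, f.vMap u = f.vMap v → g.vMap u = g.vMap v := fun u v h =>
    g.vMap_eq_iff.2 (connSetoid_mono hS (f.vMap_eq_iff.1 h))
  have hvs : ∀ v, g.vMap (s (f.vMap v)) = g.vMap v := fun v => hv _ _ (hs _)
  obtain ⟨h, -, h1, h2, -⟩ := exists_specialization (G := H) (H := K) (fun u => g.vMap (s u)) j
    (fun a => xor (f.tw (j a)) (g.tw a))
    (by
      intro u
      obtain ⟨v, rfl⟩ := g.vMap_surjective u
      exact ⟨f.vMap v, hvs v⟩)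
    (by
      intro a b h
      apply g.incl_injective
      rw [← hj, ← hj, h])
    (by
      intro a b
      have h1 := f.vMap_ends_tw (j a) (xor b (f.tw (j a)))
      rw [Bool.xor_assoc, Bool.xor_self, Bool.xor_false] at h1
      rw [← h1, hvs, hj, g.vMap_ends_tw, Bool.xor_assoc])
    (by
      intro e he
      have h0 : f.incl e ∈ g.S := by
        rw [g.mem_S_iff]
        rintro ⟨a, ha⟩
        rw [← hj] at ha
        exact he ⟨a, f.incl_injective ha⟩
      have h1 := fun b => f.vMap_ends_tw e (xor b (f.tw e))
      simp only [Bool.xor_assoc, Bool.xor_self, Bool.xor_false] at h1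
      rw [← h1, ← h1, hvs, hvs]
      exact g.vMap_eq_of_mem h0 _ _)
    (by
      have key : ∀ u v, G.connSetoid g.S u v →
          H.connSetoid (Set.range j)ᶜ (f.vMap u) (f.vMap v) := by
        intro u v huv
        refine connSetoid_le (Setoid.comap f.vMap (H.connSetoid (Set.range j)ᶜ)) ?_ huv
        intro e he
        change H.connSetoid _ _ _
        by_cases h : e ∈ f.S
        · rw [f.vMap_eq_of_mem h false true]
        · obtain ⟨a, rfl⟩ := f.exists_incl h
          have ha : a ∈ (Set.range j)ᶜ := by
            rintro ⟨b, rfl⟩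
            rw [hj] at he
            exact g.incl_notMem _ he
          rw [f.vMap_ends_tw, f.vMap_ends_tw]
          exact connSetoid_of_mem ha _ _
      intro u v h
      have := key _ _ (g.vMap_eq_iff.1 h)
      rwa [hs, hs] at this)
    (by
      intro u
      rw [g.canonical_eq]
      simp only [f.canonical_eq]
      have : ∀ w, (if g.vMap (s w) = u then ∑ v, (if f.vMap v = w then G.canonical v else 0)
          else 0) = ∑ v, if f.vMap v = w then (if g.vMap (s w) = u then G.canonical v else 0)
          else 0 := by
        intro w
        split_ifs <;> simp
      simp only [this]
      rw [Finset.sum_comm]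
      refine Finset.sum_congr rfl fun v _ => ?_
      simp [hvs])
    (by intro i; rw [← f.leg_eq, hvs, g.leg_eq])
  refine ⟨h, fun v => by rw [h1, hvs], fun a => by rw [h2, hj]⟩

end WGraph

end SpinTrop

end

noncomputable section

namespace SpinTrop

open scoped Classical

namespace WGraph

variable {n : ℕ} {G H K : WGraph n}

/-! ### Walks and cycles -/

/-- The oriented edge with the opposite direction. -/
def rev (d : G.Dart) : G.Dart := (d.1, !d.2)

@[simp] theorem src_rev (d : G.Dart) : G.src (rev d) = G.tgt d := rfl

@[simp] theorem tgt_rev (d : G.Dart) : G.tgt (rev d) = G.src d := by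
  simp [tgt, rev, src]

@[simp] theorem rev_rev (d : G.Dart) : rev (rev d) = d := by
  simp [rev]

theorem eq_or_eq_rev {d d' : G.Dart} (h : d.1 = d'.1) : d' = d ∨ d' = rev d := by
  obtain ⟨e, b⟩ := d
  obtain ⟨e', b'⟩ := d'
  obtain rfl : e = e' := h
  cases b <;> cases b' <;> simp [rev]

inductive IsWalk (G : WGraph n) : G.V → List G.Dart → G.V → Prop
  | nil (u : G.V) : IsWalk G u [] u
  | cons (d : G.Dart) {l : List G.Dart} {u v : G.V} (hu : G.src d = u)
      (h : IsWalk G (G.tgt d) l v) : IsWalk G u (d :: l) v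

theorem IsWalk.append {u v w : G.V} {l l' : List G.Dart} (h : G.IsWalk u l v)
    (h' : G.IsWalk v l' w) : G.IsWalk u (l ++ l') w := by
  induction h with
  | nil => exact h'
  | cons d hu _ ih => exact IsWalk.cons d hu (ih h')

theorem isWalk_singleton (d : G.Dart) : G.IsWalk (G.src d) [d] (G.tgt d) :=
  IsWalk.cons d rfl (IsWalk.nil _)

theorem IsWalk.reverse {u v : G.V} {l : List G.Dart} (h : G.IsWalk u l v) :
    G.IsWalk v (l.map rev).reverse u := by
  induction h with
  | nil => exact IsWalk.nil _
  | cons d hu _ ih =>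
    subst hu
    have := isWalk_singleton (rev d)
    simp only [src_rev, tgt_rev] at this
    simpa using ih.append this

theorem IsWalk.split {u v w : G.V} {l : List G.Dart} (h : G.IsWalk u l v)
    (hw : w ∈ l.map G.src ∨ w = v) :
    ∃ l₁ l₂, l = l₁ ++ l₂ ∧ G.IsWalk u l₁ w ∧ G.IsWalk w l₂ v := by
  induction h with
  | nil u =>
    obtain rfl : w = u := by simpa using hw
    exact ⟨[], [], rfl, IsWalk.nil _, IsWalk.nil _⟩
  | @cons d l u v hu h ih =>
    subst hu
    by_cases hd : w = G.src d
    · subst hd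
      exact ⟨[], d :: l, rfl, IsWalk.nil _, IsWalk.cons d rfl h⟩
    · have : w ∈ l.map G.src ∨ w = v := by simpa [hd] using hw
      obtain ⟨l₁, l₂, rfl, h1, h2⟩ := ih this
      exact ⟨d :: l₁, l₂, rfl, IsWalk.cons d rfl h1, h2⟩

theorem exists_walk_of_connSetoid {S : Set G.E} {u v : G.V} (h : G.connSetoid S u v) :
    ∃ l, G.IsWalk u l v := by
  refine connSetoid_le ⟨fun u v => ∃ l, G.IsWalk u l v, ?_, ?_, ?_⟩ ?_ h
  · exact fun u => ⟨[], IsWalk.nil _⟩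
  · rintro u v ⟨l, hl⟩; exact ⟨_, hl.reverse⟩
  · rintro u v w ⟨l, hl⟩ ⟨l', hl'⟩; exact ⟨_, hl.append hl'⟩
  · exact fun e _ => ⟨[(e, false)], isWalk_singleton (e, false)⟩

theorem IsWalk.getElem_src {u v : G.V} {l : List G.Dart} (h : G.IsWalk u l v) (i : ℕ)
    (hi : i + 1 < l.length) : G.tgt l[i] = G.src l[i + 1] := by
  induction h generalizing i with
  | nil => simp at hi
  | cons d hu h ih =>
    cases i with
    | zero => cases h with
      | nil => simp at hi
      | cons d' hu' h' => exact hu'.symm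
    | succ i => exact ih i (by simpa using hi)

theorem IsWalk.getElem_last {u v : G.V} {l : List G.Dart} (h : G.IsWalk u l v) (i : ℕ)
    (hi : i + 1 = l.length) : G.tgt l[i] = v := by
  induction h generalizing i with
  | nil => simp at hi
  | cons d hu h ih =>
    cases i with
    | zero => cases h with
      | nil => rfl
      | cons d' hu' h' => simp at hi
    | succ i => exact ih i (by simpa using hi)

/-- A closed walk without repeated vertices is an oriented cycle, or it goes forth and back along
an edge. -/
theorem sum_eq_zero_of_closed {ω : G.Dart → ℝ} (hω : ∀ d, ω (rev d) = -ω d)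
    {A : G.Dart → Prop}
    (hz : ∀ γ : G.OrientedCycle, (∀ i, A (γ.dart i)) → ∑ i, ω (γ.dart i) = 0)
    {d : G.Dart} {l : List G.Dart} (h : G.IsWalk (G.tgt d) l (G.src d))
    (hn : ((d :: l).map G.src).Nodup) (hA : ∀ d' ∈ d :: l, A d') :
    ((d :: l).map ω).sum = 0 := by
  have hw := IsWalk.cons d rfl h
  let D : Fin (l.length + 1) → G.Dart := fun i => (d :: l)[i.1]
  have hsum : ((d :: l).map ω).sum = ∑ i, ω (D i) := by
    rw [← Fin.sum_univ_fun_getElem]; rfl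
  have hclosed : ∀ i, G.tgt (D i) = G.src (D (i + 1)) := by
    intro i
    by_cases hi : i = Fin.last _
    · subst hi
      rw [Fin.last_add_one]
      exact hw.getElem_last l.length rfl
    · have h1 : (i + 1).val = i.val + 1 := Fin.val_add_one_of_lt (Fin.lt_last_iff_ne_last.2 hi)
      have h2 := hw.getElem_src i.1 (by
        have := Fin.lt_last_iff_ne_last.2 hi
        simpa [Fin.lt_def] using this)
      simp only [D, h1]
      exact h2
  have hsrc : Function.Injective fun i => G.src (D i) := by
    intro i j hij
    have h1 := (List.nodup_iff_injective_getElem.1 hn)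
    have h2 : ∀ k : Fin (l.length + 1), ((d :: l).map G.src)[k.1]'(by simpa using k.2) =
        G.src (D k) := fun k => List.getElem_map _
    have h3 := @h1 ⟨i.1, by simpa using i.2⟩ ⟨j.1, by simpa using j.2⟩
      ((h2 i).trans (hij.trans (h2 j).symm))
    exact Fin.ext (by simpa using h3)
  rw [hsum]
  by_cases hedge : Function.Injective fun i => (D i).1
  · exact hz ⟨_, D, hclosed, hsrc, hedge⟩ fun i => hA _ (List.getElem_mem _)
  -- The vertices are distinct, so a repeated edge is used in opposite directions and each of the
  -- two uses follows the other: the walk is one edge forth and back.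
  · simp only [Function.Injective, not_forall] at hedge
    obtain ⟨i, j, hij, hne⟩ := hedge
    rcases eq_or_eq_rev hij with h1 | h1
    · exact absurd (hsrc (congrArg G.src h1.symm)) hne
    · have hj : j = i + 1 := hsrc (by
        change G.src (D j) = _
        rw [h1, src_rev, hclosed])
      have hi : i = j + 1 := hsrc (by
        change G.src (D i) = G.src (D (j + 1))
        rw [← hclosed, h1, tgt_rev])
      have hlen : l.length = 1 := by
        have h2 : i = i + 1 + 1 := by rw [← hj, ← hi]
        have h3 : (1 + 1 : Fin (l.length + 1)) = 0 := by
          rw [add_assoc] at h2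
          exact left_eq_add.1 h2
        by_contra hl
        have h4 := congrArg Fin.val h3
        rcases Nat.lt_or_ge l.length 1 with h5 | h5
        · have : l.length = 0 := by omega
          apply hne
          apply Fin.ext
          omega
        · have h6 : (1 : Fin (l.length + 1)).val = 1 := by
            rw [Fin.val_one']; exact Nat.mod_eq_of_lt (by omega)
          rw [Fin.val_add, h6, Nat.mod_eq_of_lt (by omega)] at h4
          simp at h4
      have huniv : (Finset.univ : Finset (Fin (l.length + 1))) = {i, j} := by
        symm
        apply Finset.eq_univ_of_card
        rw [Finset.card_pair hne, Fintype.card_fin, hlen]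
      rw [huniv, Finset.sum_pair hne, h1, hω]
      ring

/-- Loop erasure. A return to an earlier vertex cuts off an oriented cycle or a step forth and back,
both with `ω`-sum zero. The predicate `A` is carried along so that only cycles inside `A` matter;
for an acyclic flow `A` is the condition `0 ≤ φ`. -/
theorem IsWalk.exists_simple {ω : G.Dart → ℝ} (hω : ∀ d, ω (rev d) = -ω d)
    {A : G.Dart → Prop}
    (hz : ∀ γ : G.OrientedCycle, (∀ i, A (γ.dart i)) → ∑ i, ω (γ.dart i) = 0)
    {u v : G.V} {l : List G.Dart} (h : G.IsWalk u l v) (hA : ∀ d' ∈ l, A d') :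
    ∃ l', G.IsWalk u l' v ∧ (l'.map G.src ++ [v]).Nodup ∧ (∀ d ∈ l', A d) ∧
      (l'.map ω).sum = (l.map ω).sum := by
  induction h with
  | nil u => exact ⟨[], IsWalk.nil _, by simp, by simp, rfl⟩
  | @cons d l u v hu h ih =>
    subst hu
    obtain ⟨l', h1, h2, h3, h4⟩ := ih fun d' hd' => hA d' (List.mem_cons_of_mem _ hd')
    have hd : A d := hA d List.mem_cons_self
    by_cases hmem : G.src d ∈ l'.map G.src ++ [v]
    · obtain ⟨l₁, l₂, rfl, h5, h6⟩ := h1.split (by simpa using hmem)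
      have hn : (l₂.map G.src ++ [v]).Nodup := by
        rw [List.map_append, List.append_assoc] at h2
        exact (List.nodup_append.1 h2).2.1
      have hn' : ((d :: l₁).map G.src).Nodup := by
        rw [List.map_append, List.append_assoc] at h2
        obtain ⟨h7, -, h8⟩ := List.nodup_append.1 h2
        rw [List.map_cons, List.nodup_cons]
        refine ⟨fun h9 => ?_, h7⟩
        refine h8 _ h9 (G.src d) ?_ rfl
        cases h6 with
        | nil => simp
        | cons d' hu' h10 => simp [hu']
      have h7 := sum_eq_zero_of_closed hω hz h5 hn' (by
        intro d' hd'
        rcases List.mem_cons.1 hd' with rfl | h8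
        · exact hd
        · exact h3 _ (List.mem_append_left _ h8))
      refine ⟨l₂, h6, hn, fun d' hd' => h3 _ (List.mem_append_right _ hd'), ?_⟩
      simp only [List.map_append, List.sum_append, List.map_cons, List.sum_cons] at h4 h7 ⊢
      linarith
    · refine ⟨d :: l', IsWalk.cons d rfl h1, ?_, ?_, ?_⟩
      · rw [List.map_cons, List.cons_append, List.nodup_cons]
        exact ⟨hmem, h2⟩
      · intro d' hd'
        rcases List.mem_cons.1 hd' with rfl | h8
        · exact hd
        · exact h3 _ h8
      · simp [h4]

theorem IsWalk.sum_eq_zero {ω : G.Dart → ℝ} (hω : ∀ d, ω (rev d) = -ω d)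
    {A : G.Dart → Prop}
    (hz : ∀ γ : G.OrientedCycle, (∀ i, A (γ.dart i)) → ∑ i, ω (γ.dart i) = 0)
    {u : G.V} {l : List G.Dart} (h : G.IsWalk u l u) (hA : ∀ d' ∈ l, A d') :
    (l.map ω).sum = 0 := by
  obtain ⟨l', h1, h2, -, h4⟩ := h.exists_simple hω hz hA
  cases h1 with
  | nil => simpa using h4.symm
  | cons d hu h => simp [hu] at h2

/-- A function on oriented edges with zero sums along cycles has a potential. -/
theorem exists_potential {ω : G.Dart → ℝ} (hω : ∀ d, ω (rev d) = -ω d)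
    (hz : ∀ γ : G.OrientedCycle, ∑ i, ω (γ.dart i) = 0) :
    ∃ f : G.V → ℝ, ∀ d, ω d = f (G.tgt d) - f (G.src d) := by
  let r : G.V → G.V := fun v => (Quotient.mk (G.connSetoid Set.univ) v).out
  have hr : ∀ v, ∃ l, G.IsWalk (r v) l v := fun v =>
    exists_walk_of_connSetoid (Quotient.mk_out (s := G.connSetoid Set.univ) v)
  choose l hl using hr
  -- The potential integrates `ω` along a chosen walk from a base point of the component; going out
  -- to the source of `d`, along `d` and back from its target is a closed walk.
  refine ⟨fun v => ((l v).map ω).sum, fun d => ?_⟩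
  have h1 : r (G.src d) = r (G.tgt d) := by
    have := connSetoid_of_mem (G := G) (Set.mem_univ d.1) d.2 (!d.2)
    exact congrArg Quotient.out (Quotient.sound this)
  have h2 := ((hl (G.src d)).append (isWalk_singleton d)).append (hl (G.tgt d)).reverse
  rw [h1] at h2
  have h3 := h2.sum_eq_zero hω (A := fun _ => True) (fun γ _ => hz γ) (by simp)
  have h4 : ∀ l : List G.Dart, ((l.map rev).map ω).sum = -(l.map ω).sum := by
    intro l
    induction l with
    | nil => simp
    | cons d l ih => simp only [List.map_cons, List.sum_cons, ih, hω]; ring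
  simp only [List.map_append, List.sum_append, List.map_reverse, List.sum_reverse, h4,
    List.map_cons, List.map_nil, List.sum_cons, List.sum_nil] at h3
  linarith

theorem OrientedCycle.sum_potential (γ : G.OrientedCycle) (f : G.V → ℝ) :
    ∑ i, (f (G.tgt (γ.dart i)) - f (G.src (γ.dart i))) = 0 := by
  rw [Finset.sum_sub_distrib, sub_eq_zero]
  simp only [γ.closed]
  exact Equiv.sum_comp (Equiv.addRight (1 : Fin (γ.len + 1))) fun i => f (G.src (γ.dart i))

/-! ### Flows and stability -/

theorem IsFlow.rev {φ : G.Dart → ℤ} (hφ : G.IsFlow φ) (d : G.Dart) : φ (rev d) = -φ d := by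
  obtain ⟨e, b⟩ := d
  cases b
  · exact hφ e
  · simp [WGraph.rev, hφ e]

/-- Along a cycle with `φ ≥ 0` the terms `φ p` are nonnegative and telescope to zero, so each
vanishes, and `p > 0`. -/
theorem isAcyclicFlow_of_potential {φ : G.Dart → ℤ} {p : G.E → ℝ} (hp : ∀ e, 0 < p e)
    {f : G.V → ℝ} (hf : ∀ d, (φ d : ℝ) * p d.1 = f (G.tgt d) - f (G.src d)) :
    G.IsAcyclicFlow φ := by
  intro γ hγ i
  have h1 := γ.sum_potential f
  simp only [← hf] at h1
  have h2 := (Finset.sum_eq_zero_iff_of_nonneg (fun i _ =>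
    mul_nonneg (Int.cast_nonneg (hγ i)) (hp _).le)).1 h1 i (Finset.mem_univ _)
  exact_mod_cast (mul_eq_zero.1 h2).resolve_right (hp _).ne'

/-- The set of vertices that can be reached from `v` without descending. -/
def upSet (G : WGraph n) (φ : G.Dart → ℤ) (v : G.V) : Finset G.V :=
  Finset.univ.filter fun u => ∃ l, G.IsWalk v l u ∧ ∀ d ∈ l, 0 ≤ φ d

theorem self_mem_upSet (φ : G.Dart → ℤ) (v : G.V) : v ∈ G.upSet φ v := by
  simp only [upSet, Finset.mem_filter, Finset.mem_univ, true_and]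
  exact ⟨[], IsWalk.nil _, by simp⟩

theorem tgt_mem_upSet {φ : G.Dart → ℤ} {v : G.V} {d : G.Dart} (hd : 0 ≤ φ d)
    (h : G.src d ∈ G.upSet φ v) : G.tgt d ∈ G.upSet φ v := by
  simp only [upSet, Finset.mem_filter, Finset.mem_univ, true_and] at h ⊢
  obtain ⟨l, h1, h2⟩ := h
  refine ⟨l ++ [d], h1.append (isWalk_singleton d), ?_⟩
  intro d' hd'
  rcases List.mem_append.1 hd' with h3 | h3
  · exact h2 _ h3
  · rw [List.mem_singleton.1 h3]; exact hd

/-- Otherwise `d` closes up to a closed walk with `φ ≥ 0`. Acyclicity makes all sums along such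
walks zero, but `d` contributes a positive term. -/
theorem src_notMem_upSet {φ : G.Dart → ℤ} (hφ : G.IsFlow φ) (hac : G.IsAcyclicFlow φ)
    {d : G.Dart} (hd : 0 < φ d) : G.src d ∉ G.upSet φ (G.tgt d) := by
  intro h
  simp only [upSet, Finset.mem_filter, Finset.mem_univ, true_and] at h
  obtain ⟨l, h1, h2⟩ := h
  have hA : ∀ d' ∈ d :: l, 0 ≤ φ d' := by
    intro d' hd'
    rcases List.mem_cons.1 hd' with rfl | h3
    · exact hd.le
    · exact h2 _ h3
  have h3 := (IsWalk.cons d rfl h1).sum_eq_zero (ω := fun d => (φ d : ℝ))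
    (by intro d; simp [hφ.rev]) (A := fun d => 0 ≤ φ d)
    (by
      intro γ hγ
      exact Finset.sum_eq_zero fun i _ => by rw [hac γ hγ i]; simp) hA
  have h4 : 0 ≤ (l.map fun d => (φ d : ℝ)).sum := by
    apply List.sum_nonneg
    intro t ht
    obtain ⟨d', hd', rfl⟩ := List.mem_map.1 ht
    exact Int.cast_nonneg (h2 _ hd')
  rw [List.map_cons, List.sum_cons] at h3
  have h5 : (0 : ℝ) < φ d := Int.cast_pos.2 hd
  linarith

theorem ncard_cut (W : Finset G.V) : ((G.cut W).ncard : ℝ) =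
    ∑ d : G.Dart, if G.src d ∉ W ∧ G.tgt d ∈ W then 1 else 0 := by
  rw [Set.ncard_eq_toFinset_card', Finset.card_eq_sum_ones, Fintype.sum_prod_type]
  push_cast
  rw [cut, Set.toFinset_ofPred, Finset.sum_filter]
  refine Finset.sum_congr rfl fun e _ => ?_
  simp only [Fintype.sum_bool, src, tgt, Bool.not_true, Bool.not_false]
  by_cases h1 : G.ends e false ∈ W <;> by_cases h2 : G.ends e true ∈ W <;> simp [h1, h2]

theorem sum_divFlow {φ : G.Dart → ℤ} (hφ : G.IsFlow φ) (W : Finset G.V) :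
    ∑ v ∈ W, (G.divFlow φ v : ℝ) =
      ∑ d : G.Dart, if G.src d ∉ W ∧ G.tgt d ∈ W then (φ d : ℝ) else 0 := by
  have h1 : ∑ v ∈ W, (G.divFlow φ v : ℝ) =
      ∑ d : G.Dart, if G.tgt d ∈ W then (φ d : ℝ) else 0 := by
    have : ∀ v, G.divFlow φ v = ∑ d : G.Dart, if G.tgt d = v then φ d else 0 := by
      intro v; unfold divFlow; congr!
    simp only [this]
    push_cast
    rw [Finset.sum_comm]
    refine Finset.sum_congr rfl fun d _ => ?_
    rw [Finset.sum_ite_eq]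
  rw [h1, Fintype.sum_prod_type, Fintype.sum_prod_type]
  refine Finset.sum_congr rfl fun e _ => ?_
  simp only [Fintype.sum_bool, src, tgt, Bool.not_true, Bool.not_false, hφ e]
  by_cases h1 : G.ends e false ∈ W <;> by_cases h2 : G.ends e true ∈ W <;> simp [h1, h2]

section

variable {m : G.V → ℝ} {D : G.V → ℤ} {φ : G.Dart → ℤ}

/-- This turns stability into a condition on the flow. Summing `2D + Div(φ) = 2m` over `W` leaves
the flow through the oriented edges entering `W`, and each cut edge enters `W` in exactly one
direction. -/
theorem two_beta (hφ : G.IsFlow φ) (h : ∀ v, (2 * D v + G.divFlow φ v : ℝ) = 2 * m v)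
    (W : Finset G.V) : 2 * G.beta m D W =
      ∑ d : G.Dart, if G.src d ∉ W ∧ G.tgt d ∈ W then (1 - φ d : ℝ) else 0 := by
  have h1 : ∑ v ∈ W, (2 * D v + G.divFlow φ v : ℝ) = ∑ v ∈ W, 2 * m v :=
    Finset.sum_congr rfl fun v _ => h v
  rw [Finset.sum_add_distrib, sum_divFlow hφ, ← Finset.mul_sum, ← Finset.mul_sum] at h1
  have h2 : (∑ d : G.Dart, if G.src d ∉ W ∧ G.tgt d ∈ W then (1 - φ d : ℝ) else 0) =
      (∑ d : G.Dart, if G.src d ∉ W ∧ G.tgt d ∈ W then (1 : ℝ) else 0) -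
      ∑ d : G.Dart, if G.src d ∉ W ∧ G.tgt d ∈ W then (φ d : ℝ) else 0 := by
    rw [← Finset.sum_sub_distrib]
    refine Finset.sum_congr rfl fun d _ => ?_
    split_ifs <;> simp
  rw [h2, beta, ncard_cut]
  linarith

theorem sum_eq_of_flow (hφ : G.IsFlow φ)
    (h : ∀ v, (2 * D v + G.divFlow φ v : ℝ) = 2 * m v) : ∑ v, (D v : ℝ) = ∑ v, m v := by
  have := two_beta hφ h Finset.univ
  simp [beta, cut] at this
  linarith

theorem semistable_of_flow (hφ : G.IsFlow φ)
    (h : ∀ v, (2 * D v + G.divFlow φ v : ℝ) = 2 * m v) (h1 : ∀ d, φ d ≤ 1) :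
    G.DivSemistable m D := by
  refine ⟨sum_eq_of_flow hφ h, fun W _ => ?_⟩
  have h2 := two_beta hφ h W
  have : 0 ≤ 2 * G.beta m D W := by
    rw [h2]
    refine Finset.sum_nonneg fun d _ => ?_
    split_ifs
    · have : (φ d : ℝ) ≤ 1 := by exact_mod_cast h1 d
      linarith
    · exact le_rfl
  linarith

/-- An upper set has `β = 0`, and the flow is `1` into it. -/
theorem upper_of_pos (hφ : G.IsFlow φ) (hac : G.IsAcyclicFlow φ)
    (h : ∀ v, (2 * D v + G.divFlow φ v : ℝ) = 2 * m v) (hs : G.DivSemistable m D)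
    {d : G.Dart} (hd : 0 < φ d) : ∃ W : Finset G.V, G.tgt d ∈ W ∧ G.src d ∉ W ∧
      G.beta m D W = 0 ∧ ∀ d', G.src d' ∉ W → G.tgt d' ∈ W → φ d' = 1 := by
  let W := G.upSet φ (G.tgt d)
  have h1 : G.src d ∉ W := src_notMem_upSet hφ hac hd
  have h2 : G.tgt d ∈ W := self_mem_upSet _ _
  -- If the flow into `W` were at most `0` on some oriented edge, its reverse would be nondescending
  -- and its source would lie in `W`. So all flows into `W` are at least `1`, whence `β(W) ≤ 0`, and
  -- semistability turns these inequalities into equalities.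
  have hpos : ∀ d', G.src d' ∉ W → G.tgt d' ∈ W → 1 ≤ φ d' := by
    intro d' h3 h4
    by_contra h5
    apply h3
    have := tgt_mem_upSet (φ := φ) (v := G.tgt d) (d := rev d')
      (by rw [hφ.rev]; omega) (by simpa using h4)
    simpa using this
  have h3 : 0 ≤ G.beta m D W := hs.2 W fun h => h1 (h ▸ Finset.mem_univ _)
  have h4 := two_beta hφ h W
  have hle : ∀ d' ∈ (Finset.univ : Finset G.Dart),
      (if G.src d' ∉ W ∧ G.tgt d' ∈ W then (1 - φ d' : ℝ) else 0) ≤ 0 := by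
    intro d' _
    split_ifs with h5
    · have : (1 : ℝ) ≤ φ d' := by exact_mod_cast hpos d' h5.1 h5.2
      linarith
    · exact le_rfl
  have h5 : 2 * G.beta m D W ≤ 0 := by
    rw [h4]; exact Finset.sum_nonpos hle
  have h6 : G.beta m D W = 0 := by linarith
  refine ⟨W, h2, h1, h6, fun d' h7 h8 => ?_⟩
  rw [h6, mul_zero] at h4
  have h9 := (Finset.sum_eq_zero_iff_of_nonpos hle).1 h4.symm d' (Finset.mem_univ _)
  rw [if_pos ⟨h7, h8⟩] at h9
  have : (φ d' : ℝ) = 1 := by linarith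
  exact_mod_cast this

theorem flow_le_one (hφ : G.IsFlow φ) (hac : G.IsAcyclicFlow φ)
    (h : ∀ v, (2 * D v + G.divFlow φ v : ℝ) = 2 * m v) (hs : G.DivSemistable m D)
    (d : G.Dart) : φ d ≤ 1 := by
  by_cases hd : 0 < φ d
  · obtain ⟨W, h1, h2, -, h3⟩ := upper_of_pos hφ hac h hs hd
    exact (h3 d h2 h1).le
  · omega

/-- If `β(W) = 0` then the flow is `1` into `W`. -/
theorem flow_eq_one_of_beta (hφ : G.IsFlow φ) (hac : G.IsAcyclicFlow φ)
    (h : ∀ v, (2 * D v + G.divFlow φ v : ℝ) = 2 * m v) (hs : G.DivSemistable m D)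
    {W : Finset G.V} (hW : G.beta m D W ≤ 0) {d : G.Dart} (h1 : G.src d ∉ W)
    (h2 : G.tgt d ∈ W) : φ d = 1 := by
  have h4 := two_beta hφ h W
  have hle : ∀ d' ∈ (Finset.univ : Finset G.Dart),
      0 ≤ (if G.src d' ∉ W ∧ G.tgt d' ∈ W then (1 - φ d' : ℝ) else 0) := by
    intro d' _
    split_ifs with h5
    · have : (φ d' : ℝ) ≤ 1 := by exact_mod_cast flow_le_one hφ hac h hs d'
      linarith
    · exact le_rfl
  have h5 := Finset.sum_nonneg hle
  have h6 : (∑ d' : G.Dart, (if G.src d' ∉ W ∧ G.tgt d' ∈ W then (1 - φ d' : ℝ) else 0)) = 0 := by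
    linarith
  have h9 := (Finset.sum_eq_zero_iff_of_nonneg hle).1 h6 d (Finset.mem_univ _)
  rw [if_pos ⟨h1, h2⟩] at h9
  have : (φ d : ℝ) = 1 := by linarith
  exact_mod_cast this

/-- `β` does not involve the flow. A positive oriented edge of `φ` enters a set with `β = 0`, and
every acyclic flow for the same divisor is `1` into such a set. Exchanging the two flows and
reversing edges gives all values. -/
theorem flow_unique (hφ : G.IsFlow φ) (hac : G.IsAcyclicFlow φ)
    (h : ∀ v, (2 * D v + G.divFlow φ v : ℝ) = 2 * m v) (hs : G.DivSemistable m D)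
    {ψ : G.Dart → ℤ} (hψ : G.IsFlow ψ) (hac' : G.IsAcyclicFlow ψ)
    (h' : ∀ v, (2 * D v + G.divFlow ψ v : ℝ) = 2 * m v) : φ = ψ := by
  have h1 : ∀ d, 0 < φ d → ψ d = 1 := by
    intro d hd
    obtain ⟨W, h1, h2, h3, -⟩ := upper_of_pos hφ hac h hs hd
    exact flow_eq_one_of_beta hψ hac' h' hs h3.le h2 h1
  have h2 : ∀ d, 0 < ψ d → φ d = 1 := by
    intro d hd
    obtain ⟨W, h1, h2, h3, -⟩ := upper_of_pos hψ hac' h' hs hd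
    exact flow_eq_one_of_beta hφ hac h hs h3.le h2 h1
  have h3 : ∀ d, 0 < φ d → φ d = ψ d := by
    intro d hd
    rw [h1 d hd, h2 d (by rw [h1 d hd]; exact one_pos)]
  have h4 : ∀ d, 0 < ψ d → φ d = ψ d := by
    intro d hd
    rw [h2 d hd, h1 d (by rw [h2 d hd]; exact one_pos)]
  funext d
  by_cases ha : 0 < φ d
  · exact h3 d ha
  by_cases hb : 0 < ψ d
  · exact h4 d hb
  by_cases hc : 0 < φ (rev d)
  · have := h3 _ hc
    rw [hφ.rev, hψ.rev] at this
    omega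
  by_cases he : 0 < ψ (rev d)
  · have := h4 _ he
    rw [hφ.rev, hψ.rev] at this
    omega
  rw [hφ.rev] at hc
  rw [hψ.rev] at he
  omega

/-- Every oriented edge entering a set closed under nondescending steps has flow at least `1`, so
the set has `β ≤ 0`; quasistability excludes this for proper sets containing `v₀`. -/
theorem quasistable_closed (hφ : G.IsFlow φ)
    (h : ∀ v, (2 * D v + G.divFlow φ v : ℝ) = 2 * m v) {v₀ : G.V}
    (hq : G.DivQuasistable v₀ m D) (T : Set G.V) (h0 : v₀ ∈ T)
    (hT : ∀ d, 0 ≤ φ d → G.src d ∈ T → G.tgt d ∈ T) (v : G.V) : v ∈ T := by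
  by_contra hv
  let W : Finset G.V := Finset.univ.filter (· ∈ T)
  have hW : ∀ u, u ∈ W ↔ u ∈ T := by simp [W]
  have h1 := hq.2 W (fun h => hv ((hW v).1 (h ▸ Finset.mem_univ _))) ((hW _).2 h0)
  have h2 := two_beta hφ h W
  have h3 : 2 * G.beta m D W ≤ 0 := by
    rw [h2]
    refine Finset.sum_nonpos fun d _ => ?_
    split_ifs with h4
    · rw [hW, hW] at h4
      have h5 : 1 ≤ φ d := by
        by_contra h6
        apply h4.1
        have := hT (rev d) (by rw [hφ.rev]; omega) (by simpa using h4.2)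
        simpa using this
      have : (1 : ℝ) ≤ φ d := by exact_mod_cast h5
      linarith
    · exact le_rfl
  linarith

end

/-! ### Subdivisions -/

/-- A vertex of `G`, as a vertex of `G^A`. -/
def vtx (A : Set G.E) (v : G.V) : (G.subdivide A).V := Sum.inl v

/-- The exceptional vertex on the edge `e`. -/
def exv {A : Set G.E} (e : G.E) (h : e ∈ A) : (G.subdivide A).V := Sum.inr ⟨e, h⟩

/-- An edge that is not subdivided. -/
def kept {A : Set G.E} (e : G.E) (h : e ∉ A) : (G.subdivide A).E := Sum.inl ⟨e, h⟩

/-- The half of the subdivided edge `e` at the end `b`. -/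
def half {A : Set G.E} (e : G.E) (h : e ∈ A) (b : Bool) : (G.subdivide A).E :=
  Sum.inr (⟨e, h⟩, b)

section

variable {A : Set G.E}

theorem vert_cases {p : (G.subdivide A).V → Prop} (h1 : ∀ v, p (vtx A v))
    (h2 : ∀ e h, p (exv e h)) (u : (G.subdivide A).V) : p u := by
  rcases u with v | ⟨e, h⟩
  · exact h1 v
  · exact h2 e h

theorem edge_cases {p : (G.subdivide A).E → Prop} (h1 : ∀ e h, p (kept e h))
    (h2 : ∀ e h b, p (half e h b)) (a : (G.subdivide A).E) : p a := by
  rcases a with ⟨e, h⟩ | ⟨⟨e, h⟩, b⟩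
  · exact h1 e h
  · exact h2 e h b

theorem vtx_injective : Function.Injective (vtx A) := Sum.inl_injective

@[simp] theorem vtx_inj {u v : G.V} : vtx A u = vtx A v ↔ u = v := vtx_injective.eq_iff

@[simp] theorem exv_inj {e e' : G.E} {h : e ∈ A} {h' : e' ∈ A} :
    exv e h = exv e' h' ↔ e = e' :=
  ⟨fun H => congrArg Subtype.val (Sum.inr_injective H), by rintro rfl; rfl⟩

@[simp] theorem vtx_ne_exv {v : G.V} {e : G.E} {h : e ∈ A} : vtx A v ≠ exv e h := Sum.inl_ne_inr

@[simp] theorem exv_ne_vtx {v : G.V} {e : G.E} {h : e ∈ A} : exv e h ≠ vtx A v := Sum.inr_ne_inl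

@[simp] theorem kept_inj {e e' : G.E} {h : e ∉ A} {h' : e' ∉ A} :
    kept e h = kept e' h' ↔ e = e' :=
  ⟨fun H => congrArg Subtype.val (Sum.inl_injective H), by rintro rfl; rfl⟩

@[simp] theorem half_inj {e e' : G.E} {h : e ∈ A} {h' : e' ∈ A} {b b' : Bool} :
    half e h b = half e' h' b' ↔ e = e' ∧ b = b' :=
  ⟨fun H => ⟨congrArg (fun x => x.1.1) (Sum.inr_injective H),
    congrArg Prod.snd (Sum.inr_injective H)⟩, by rintro ⟨rfl, rfl⟩; rfl⟩

@[simp] theorem kept_ne_half {e e' : G.E} {h : e ∉ A} {h' : e' ∈ A} {b : Bool} :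
    kept e h ≠ half e' h' b := Sum.inl_ne_inr

@[simp] theorem half_ne_kept {e e' : G.E} {h : e ∉ A} {h' : e' ∈ A} {b : Bool} :
    half e' h' b ≠ kept e h := Sum.inr_ne_inl

@[simp] theorem below_kept (e : G.E) (h : e ∉ A) : G.below A (kept e h) = e := rfl

@[simp] theorem below_half (e : G.E) (h : e ∈ A) (b : Bool) : G.below A (half e h b) = e := rfl

@[simp] theorem ends_kept (e : G.E) (h : e ∉ A) (b : Bool) :
    (G.subdivide A).ends (kept e h) b = vtx A (G.ends e b) := rfl

@[simp] theorem ends_half_false (e : G.E) (h : e ∈ A) (b : Bool) :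
    (G.subdivide A).ends (half e h b) false = vtx A (G.ends e b) := rfl

@[simp] theorem ends_half_true (e : G.E) (h : e ∈ A) (b : Bool) :
    (G.subdivide A).ends (half e h b) true = exv e h := rfl

@[simp] theorem src_kept (e : G.E) (h : e ∉ A) (b : Bool) :
    (G.subdivide A).src (kept e h, b) = vtx A (G.ends e b) := rfl

@[simp] theorem tgt_kept (e : G.E) (h : e ∉ A) (b : Bool) :
    (G.subdivide A).tgt (kept e h, b) = vtx A (G.ends e !b) := rfl

@[simp] theorem src_half_false (e : G.E) (h : e ∈ A) (b : Bool) :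
    (G.subdivide A).src (half e h b, false) = vtx A (G.ends e b) := rfl

@[simp] theorem tgt_half_false (e : G.E) (h : e ∈ A) (b : Bool) :
    (G.subdivide A).tgt (half e h b, false) = exv e h := rfl

@[simp] theorem src_half_true (e : G.E) (h : e ∈ A) (b : Bool) :
    (G.subdivide A).src (half e h b, true) = exv e h := rfl

@[simp] theorem tgt_half_true (e : G.E) (h : e ∈ A) (b : Bool) :
    (G.subdivide A).tgt (half e h b, true) = vtx A (G.ends e b) := rfl

theorem sum_edge_subdivide {M : Type*} [AddCommMonoid M] (F : (G.subdivide A).E → M) :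
    ∑ a, F a = ∑ e : G.E, if h : e ∈ A then F (half e h false) + F (half e h true)
      else F (kept e h) := by
  have key : ∀ F : {e : G.E // e ∉ A} ⊕ ({e : G.E // e ∈ A} × Bool) → M,
      ∑ a, F a = ∑ e : G.E, if h : e ∈ A then
        F (Sum.inr (⟨e, h⟩, false)) + F (Sum.inr (⟨e, h⟩, true)) else F (Sum.inl ⟨e, h⟩) := by
    intro F
    rw [Fintype.sum_sum_type, Fintype.sum_prod_type]
    rw [← Fintype.sum_subtype_add_sum_subtype (fun e => e ∈ A), add_comm]
    congr 1
    · refine Finset.sum_congr rfl fun e _ => ?_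
      rw [dif_pos e.2, Fintype.sum_bool, add_comm]
    · refine Finset.sum_congr rfl fun e _ => ?_
      rw [dif_neg e.2]
  exact key F

theorem sum_vert_subdivide {M : Type*} [AddCommMonoid M] (F : (G.subdivide A).V → M) :
    ∑ v, F v = ∑ v : G.V, F (vtx A v) + ∑ e : G.E, if h : e ∈ A then F (exv e h) else 0 := by
  have key : ∀ F : G.V ⊕ {e : G.E // e ∈ A} → M, ∑ v, F v = ∑ v : G.V, F (Sum.inl v) +
      ∑ e : G.E, if h : e ∈ A then F (Sum.inr ⟨e, h⟩) else 0 := by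
    intro F
    rw [Fintype.sum_sum_type]
    congr 1
    rw [← Fintype.sum_subtype_add_sum_subtype (fun e => e ∈ A)]
    have h2 : (∑ e : {e // e ∉ A}, if h : e.1 ∈ A then F (Sum.inr ⟨e.1, h⟩) else 0) = 0 :=
      Finset.sum_eq_zero fun e _ => dif_neg e.2
    rw [h2, add_zero]
    refine Finset.sum_congr rfl fun e _ => ?_
    rw [dif_pos e.2]
  exact key F

theorem sum_dart_subdivide {M : Type*} [AddCommMonoid M] (F : (G.subdivide A).Dart → M) :
    ∑ d, F d = ∑ d : G.Dart, if h : d.1 ∈ A then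
      F (half d.1 h d.2, false) + F (half d.1 h d.2, true) else F (kept d.1 h, d.2) := by
  rw [Fintype.sum_prod_type, sum_edge_subdivide, Fintype.sum_prod_type]
  refine Finset.sum_congr rfl fun e _ => ?_
  by_cases h : e ∈ A <;> simp [h]
  abel

theorem deg_vtx (v : G.V) : (G.subdivide A).deg (vtx A v) = G.deg v := by
  rw [deg, deg, degIn_eq_sum, degIn_eq_sum, sum_dart_subdivide]
  refine Finset.sum_congr rfl fun d _ => ?_
  split_ifs with h1 h2 <;> simp_all [src]

theorem deg_exv (e : G.E) (h : e ∈ A) : (G.subdivide A).deg (exv e h) = 2 := by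
  rw [deg, degIn_eq_sum, sum_dart_subdivide, Fintype.sum_prod_type, Finset.sum_eq_single e]
  · simp [h]
  · intro e' _ he
    by_cases h : e' ∈ A <;> simp [h, he]
  · simp

theorem canonical_vtx (v : G.V) : (G.subdivide A).canonical (vtx A v) = G.canonical v := by
  rw [canonical, canonical, deg_vtx]; rfl

theorem canonical_exv (e : G.E) (h : e ∈ A) : (G.subdivide A).canonical (exv e h) = 0 := by
  rw [canonical, deg_exv]
  have : (G.subdivide A).weight (exv e h) = 0 := rfl
  simp [this]

end

end WGraph

end SpinTrop

end

/-! ### Flows, potentials and edge lengths of semistable pseudo-roots -/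

noncomputable section

namespace SpinTrop

open scoped Classical

open WGraph

namespace WGraph

variable {n : ℕ} {G : WGraph n}

theorem divFlow_eq (φ : G.Dart → ℤ) (v : G.V) :
    G.divFlow φ v = ∑ d : G.Dart, if G.tgt d = v then φ d else 0 := by
  unfold divFlow; congr!

theorem sum_rev {M : Type*} [AddCommMonoid M] (F : G.Dart → M) :
    ∑ d, F (rev d) = ∑ d, F d :=
  Equiv.sum_comp (Function.Involutive.toPerm (rev (G := G)) rev_rev) F

theorem degIn_eq_sum_tgt (S : Set G.E) (v : G.V) :
    G.degIn S v = ∑ d : G.Dart, if d.1 ∈ S ∧ G.tgt d = v then 1 else 0 := by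
  rw [degIn_eq_sum, ← sum_rev]
  rfl

end WGraph

namespace PseudoDivisor

variable {n : ℕ} {G : WGraph n} {x y : PseudoDivisor G}

@[simp] theorem D_exv (x : PseudoDivisor G) (e : G.E) (h : e ∈ x.exc) : x.D (exv e h) = -1 :=
  x.D_exc ⟨e, h⟩

/-- The canonical divisor of the subdivided graph is zero at the exceptional vertices, so extension
by zero is again half of it and the results on flows apply with `m = muSub`. -/
theorem two_muSub (x : PseudoDivisor G) (v : x.sub.V) :
    2 * x.muSub v = x.sub.canonical v := by
  induction v using vert_cases with
  | h1 v =>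
    rw [canonical_vtx]
    change 2 * G.mu v = _
    simp [mu, canonical]
    ring
  | h2 e h =>
    rw [canonical_exv]
    change 2 * (0 : ℝ) = _
    simp

theorem IsRootFlow.eq_real {φ : x.sub.Dart → ℤ} (h : x.IsRootFlow φ) (v : x.sub.V) :
    (2 * x.D v + x.sub.divFlow φ v : ℝ) = 2 * x.muSub v := by
  rw [two_muSub]
  exact_mod_cast h.2.2 v

theorem IsPseudoRoot.flow (h : x.IsPseudoRoot) : x.IsRootFlow x.flow :=
  Classical.epsilon_spec h

/-- By uniqueness, the flow picked by `Classical.epsilon` can be computed from any explicit one. -/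
theorem IsRootFlow.flow_eq {φ : x.sub.Dart → ℤ} (h : x.IsRootFlow φ) (hs : x.Semistable) :
    x.flow = φ := by
  have h' := IsPseudoRoot.flow ⟨φ, h⟩
  exact flow_unique h'.1 h'.2.1 h'.eq_real hs h.1 h.2.1 h.eq_real

section

variable (hr : x.IsPseudoRoot) (hs : x.Semistable)

include hr

theorem IsPseudoRoot.flow_rev (d : x.sub.Dart) : x.flow (rev d) = -x.flow d :=
  hr.flow.1.rev d

include hs

theorem IsPseudoRoot.flow_le_one (d : x.sub.Dart) : x.flow d ≤ 1 :=
  WGraph.flow_le_one hr.flow.1 hr.flow.2.1 hr.flow.eq_real hs d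

theorem IsPseudoRoot.neg_one_le_flow (d : x.sub.Dart) : -1 ≤ x.flow d := by
  have := hr.flow_le_one hs (rev d)
  rw [hr.flow_rev] at this
  omega

/-- At an exceptional vertex `D = -1` and `K = 0`, so the two incoming flows add up to `2`; neither
exceeds `1`. -/
theorem IsPseudoRoot.flow_half (e : G.E) (h : e ∈ x.exc) (b : Bool) :
    x.flow (half e h b, false) = 1 := by
  have h1 := hr.flow.2.2 (exv e h)
  rw [canonical_exv, D_exv, divFlow_eq, sum_dart_subdivide, Fintype.sum_prod_type,
    Finset.sum_eq_single e] at h1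
  · simp only [Fintype.sum_bool, h, dif_pos] at h1
    simp at h1
    have h2 := hr.flow_le_one hs (half e h true, false)
    have h3 := hr.flow_le_one hs (half e h false, false)
    cases b <;> omega
  · intro e' _ he
    by_cases h : e' ∈ x.exc <;> simp [h, he]
  · simp

theorem IsPseudoRoot.flow_half' (e : G.E) (h : e ∈ x.exc) (b : Bool) :
    x.flow (half e h b, true) = -1 := by
  rw [hr.flow.1, hr.flow_half hs]

theorem IsPseudoRoot.mem_zeroEdges {e : G.E} :
    e ∈ x.zeroEdges ↔ ∃ h : e ∉ x.exc, x.flow (kept e h, false) = 0 := by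
  constructor
  · rintro ⟨a, ha, rfl⟩
    induction a using edge_cases with
    | h1 e h => exact ⟨h, ha⟩
    | h2 e h b =>
      have := hr.flow_half hs e h b
      have h' : x.flow (half e h b, false) = 0 := ha
      omega
  · rintro ⟨h, h'⟩
    exact ⟨kept e h, h', rfl⟩

theorem IsPseudoRoot.mem_zeroEdges' {e : G.E} (h : e ∉ x.exc) (b : Bool) :
    e ∈ x.zeroEdges ↔ x.flow (kept e h, b) = 0 := by
  rw [hr.mem_zeroEdges hs]
  have := hr.flow.1 (kept e h)
  constructor
  · rintro ⟨h', h2⟩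
    cases b
    · exact h2
    · rw [this, h2]; rfl
  · intro h2
    refine ⟨h, ?_⟩
    cases b
    · exact h2
    · omega

theorem IsPseudoRoot.notMem_zeroEdges {e : G.E} (h : e ∈ x.exc) : e ∉ x.zeroEdges := by
  rw [hr.mem_zeroEdges hs]
  rintro ⟨h', -⟩
  exact h' h

/-- Two semistable pseudo-roots with the same exceptional edges and the same flow are equal. -/
theorem IsPseudoRoot.ext (hr' : y.IsPseudoRoot) (hs' : y.Semistable)
    (he : x.exc = y.exc) (hf : ∀ e (h : e ∉ x.exc) (h' : e ∉ y.exc),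
      x.flow (kept e h, false) = y.flow (kept e h', false)) : x = y := by
  obtain ⟨A, D, hD⟩ := x
  obtain ⟨A', D', hD'⟩ := y
  obtain rfl : A = A' := he
  let x : PseudoDivisor G := ⟨A, D, hD⟩
  let y : PseudoDivisor G := ⟨A, D', hD'⟩
  change x = y
  have hxy : x.flow = y.flow := by
    have h0 : ∀ a : (G.subdivide A).E, x.flow (a, false) = y.flow (a, false) := by
      intro a
      induction a using edge_cases with
      | h1 e h => exact hf e h h
      | h2 e h b => exact (hr.flow_half hs e h b).trans (hr'.flow_half hs' e h b).symm
    funext ⟨a, b⟩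
    cases b
    · exact h0 a
    · exact (hr.flow.1 a).trans ((congrArg _ (h0 a)).trans (hr'.flow.1 a).symm)
  have : D = D' := by
    funext v
    have h1 := hr.flow.2.2 v
    have h2 := hr'.flow.2.2 v
    change 2 * D v + (G.subdivide A).divFlow x.flow v = _ at h1
    change 2 * D' v + (G.subdivide A).divFlow y.flow v = _ at h2
    rw [hxy] at h1
    have h3 : 2 * D v = 2 * D' v := by
      have := h1.trans h2.symm
      omega
    omega
  subst this
  rfl

end

/-- A potential of `p`: a function on the vertices of `G` the extension of which to `G^𝓔` has slope
`φ` with respect to the lengths `p`. -/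
def IsPotential (x : PseudoDivisor G) (p : x.sub.E → ℝ) (f : G.V → ℝ) : Prop :=
  (∀ e h, p (half e h false) - p (half e h true) = f (G.ends e true) - f (G.ends e false)) ∧
  ∀ e h, (x.flow (kept e h, false) : ℝ) * p (kept e h) =
    f (G.ends e true) - f (G.ends e false)

/-- The cycle equations say that `φ p` is the gradient of a potential on `G^𝓔`. As the flow into an
exceptional vertex is `1` from both sides, its potential can be eliminated, leaving the condition on
the difference of the two halves. -/
theorem IsPseudoRoot.mem_lam_iff (hr : x.IsPseudoRoot) (hs : x.Semistable) {p : x.sub.E → ℝ} :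
    p ∈ x.lam ↔ (∀ a, 0 ≤ p a) ∧ ∃ f, x.IsPotential p f := by
  refine and_congr_right fun hp => ?_
  constructor
  · intro h
    obtain ⟨f, hf⟩ := exists_potential (ω := fun d : x.sub.Dart => (x.flow d : ℝ) * p d.1)
      (by
        intro d
        rw [hr.flow_rev]
        simp [rev]) h
    refine ⟨fun v => f (vtx _ v), fun e h => ?_, fun e h => ?_⟩
    · have h1 := hf (half e h false, false)
      have h2 := hf (half e h true, false)
      simp only [hr.flow_half hs, src_half_false, tgt_half_false] at h1 h2
      push_cast at h1 h2
      linarith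
    · have h1 := hf (kept e h, false)
      simpa using h1
  · rintro ⟨f, hf1, hf2⟩ γ
    let F : x.sub.V → ℝ := fun v => Sum.elim f
      (fun e => f (G.ends e.1 false) + p (half e.1 e.2 false)) v
    have hFv : ∀ v, F (vtx _ v) = f v := fun v => rfl
    have hFe : ∀ e h, F (exv e h) = f (G.ends e false) + p (half e h false) := fun e h => rfl
    have key : ∀ a, (x.flow (a, false) : ℝ) * p a = F (x.sub.tgt (a, false)) -
        F (x.sub.src (a, false)) := by
      intro a
      induction a using edge_cases with
      | h1 e h => simpa [hFv] using hf2 e h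
      | h2 e h b =>
        rw [hr.flow_half hs]
        simp only [src_half_false, tgt_half_false, hFv, hFe]
        have := hf1 e h
        push_cast
        cases b <;> linarith
    have key' : ∀ d : x.sub.Dart, (x.flow d : ℝ) * p d.1 = F (x.sub.tgt d) - F (x.sub.src d) := by
      rintro ⟨a, b⟩
      cases b
      · exact key a
      · have h1 := key a
        rw [hr.flow.1 a]
        change _ = F (x.sub.src (a, false)) - F (x.sub.tgt (a, false))
        push_cast
        linarith
    simp only [key']
    exact γ.sum_potential F

/-- The lengths of the edges of `G`. -/
def len (A : Set G.E) : ((G.subdivide A).E → ℝ) →ₗ[ℝ] (G.E → ℝ) where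
  toFun p e := if h : e ∈ A then p (half e h false) + p (half e h true) else p (kept e h)
  map_add' p q := by
    funext e
    by_cases h : e ∈ A <;> simp [h]
    ring
  map_smul' c p := by
    funext e
    by_cases h : e ∈ A <;> simp [h]
    ring

theorem len_of_mem {A : Set G.E} (p : (G.subdivide A).E → ℝ) {e : G.E} (h : e ∈ A) :
    len A p e = p (half e h false) + p (half e h true) := dif_pos h

theorem len_of_notMem {A : Set G.E} (p : (G.subdivide A).E → ℝ) {e : G.E} (h : e ∉ A) :
    len A p e = p (kept e h) := dif_neg h

theorem len_nonneg {A : Set G.E} {p : (G.subdivide A).E → ℝ} (hp : ∀ a, 0 ≤ p a) (e : G.E) :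
    0 ≤ len A p e := by
  by_cases h : e ∈ A
  · rw [len_of_mem p h]; exact add_nonneg (hp _) (hp _)
  · rw [len_of_notMem p h]; exact hp _

theorem len_pos {A : Set G.E} {p : (G.subdivide A).E → ℝ} (hp : ∀ a, 0 < p a) (e : G.E) :
    0 < len A p e := by
  by_cases h : e ∈ A
  · rw [len_of_mem p h]; exact add_pos (hp _) (hp _)
  · rw [len_of_notMem p h]; exact hp _

/-- Written through `below`, the lengths can be compared along a specialization, where `hat` lies
over `base`. -/
theorem len_eq_sum {A : Set G.E} (p : (G.subdivide A).E → ℝ) (e : G.E) :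
    len A p e = ∑ a, if G.below A a = e then p a else 0 := by
  rw [sum_edge_subdivide, Finset.sum_eq_single e]
  · by_cases h : e ∈ A
    · simp [h, len_of_mem p h]
    · simp [h, len_of_notMem p h]
  · intro e' _ he
    by_cases h : e' ∈ A <;> simp [h, he]
  · simp

/-- On an exceptional edge the potential changes by the difference of the two halves, whose sum is
the length; on the others the slope is `-1`, `0` or `1`. -/
theorem IsPotential.abs_sub_le (hr : x.IsPseudoRoot) (hs : x.Semistable) {p : x.sub.E → ℝ}
    (hp : ∀ a, 0 ≤ p a) {f : G.V → ℝ} (hf : x.IsPotential p f) (e : G.E) :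
    |f (G.ends e true) - f (G.ends e false)| ≤ len x.exc p e := by
  by_cases h : e ∈ x.exc
  · rw [len_of_mem p h, ← hf.1 e h, abs_le]
    have h1 := hp (half e h false)
    have h2 := hp (half e h true)
    constructor <;> linarith
  · rw [len_of_notMem p h, ← hf.2 e h, abs_mul, abs_of_nonneg (hp _)]
    refine mul_le_of_le_one_left (hp _) ?_
    rw [← Int.cast_abs]
    have h1 := hr.flow_le_one hs (kept e h, false)
    have h2 := hr.neg_one_le_flow hs (kept e h, false)
    exact_mod_cast abs_le.2 ⟨h2, h1⟩

theorem IsPotential.eq_of_zero (hr : x.IsPseudoRoot) (hs : x.Semistable) {p : x.sub.E → ℝ}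
    {f : G.V → ℝ} (hf : x.IsPotential p f) {e : G.E} (he : e ∈ x.zeroEdges) :
    f (G.ends e false) = f (G.ends e true) := by
  obtain ⟨h, h'⟩ := (hr.mem_zeroEdges hs).1 he
  have := hf.2 e h
  rw [h'] at this
  push_cast at this
  linarith

/-- Oriented edges out of an exceptional vertex have flow `-1`, so a nondescending walk between
vertices of `G` never enters a subdivided edge. -/
theorem Quasistable.closed {v₀ : G.V} (hq : x.Quasistable v₀) (hr : x.IsPseudoRoot)
    {T : Set G.V} (h0 : v₀ ∈ T)
    (hT : ∀ e h b, 0 ≤ x.flow (kept e h, b) → G.ends e b ∈ T → G.ends e (!b) ∈ T) (v : G.V) :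
    v ∈ T := by
  have hs : x.Semistable := hq.1
  have h1 := quasistable_closed hr.flow.1 hr.flow.eq_real hq
    {u | ∀ v, u = vtx _ v → v ∈ T} (by
      intro v hv
      have : vtx x.exc v₀ = vtx x.exc v := hv
      rw [vtx_inj] at this
      exact this ▸ h0) (by
      rintro ⟨a, b⟩ hd h v hv
      induction a using edge_cases with
      | h1 e h' =>
        rw [tgt_kept, vtx_inj] at hv
        exact hv ▸ hT e h' b hd (h _ rfl)
      | h2 e h' c =>
        cases b
        · exact absurd hv (by simp)
        · rw [hr.flow_half' hs] at hd
          omega) (vtx _ v)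
  exact h1 v rfl

/-! ### Construction of pseudo-roots -/

/-- The pseudo-divisor with given values at the vertices of `G`. -/
abbrev ofFun (A : Set G.E) (D : G.V → ℤ) : PseudoDivisor G where
  exc := A
  D := Sum.elim D fun _ => -1
  D_exc _ := rfl

theorem ofFun_D_vtx (A : Set G.E) (D : G.V → ℤ) (v : G.V) : (ofFun A D).D (vtx A v) = D v := rfl

/-- The flow on `G^A` which is `1` into the exceptional vertices. -/
def extFlow (A : Set G.E) (φ : G.Dart → ℤ) (d : (G.subdivide A).Dart) : ℤ :=
  Sum.elim (fun e => φ (e.1, d.2)) (fun _ => if d.2 then -1 else 1) d.1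

theorem extFlow_kept {A : Set G.E} {φ : G.Dart → ℤ} (e : G.E) (h : e ∉ A) (b : Bool) :
    extFlow A φ (kept e h, b) = φ (e, b) := rfl

theorem extFlow_half_false {A : Set G.E} {φ : G.Dart → ℤ} (e : G.E) (h : e ∈ A) (b : Bool) :
    extFlow A φ (half e h b, false) = 1 := rfl

theorem extFlow_half_true {A : Set G.E} {φ : G.Dart → ℤ} (e : G.E) (h : e ∈ A) (b : Bool) :
    extFlow A φ (half e h b, true) = -1 := rfl

theorem divFlow_extFlow_vtx (A : Set G.E) (φ : G.Dart → ℤ) (v : G.V) :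
    (G.subdivide A).divFlow (extFlow A φ) (vtx A v) =
      ∑ d : G.Dart, if G.tgt d = v then (if d.1 ∈ A then -1 else φ d) else 0 := by
  rw [divFlow_eq, sum_dart_subdivide, Fintype.sum_prod_type, Fintype.sum_prod_type]
  refine Finset.sum_congr rfl fun e _ => ?_
  by_cases h : e ∈ A
  · simp [h, extFlow_half_true, tgt, add_comm]
  · simp [h, extFlow_kept, tgt]

theorem divFlow_extFlow_exv (A : Set G.E) (φ : G.Dart → ℤ) (e : G.E) (h : e ∈ A) :
    (G.subdivide A).divFlow (extFlow A φ) (exv e h) = 2 := by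
  rw [divFlow_eq, sum_dart_subdivide, Fintype.sum_prod_type, Finset.sum_eq_single e]
  · simp [h, extFlow_half_false]
  · intro e' _ he
    by_cases h : e' ∈ A <;> simp [h, he]
  · simp

/-- Pseudo-roots from flows on `G` that have a potential for some positive lengths. -/
theorem root_ofFun {A : Set G.E} {D : G.V → ℤ} {φ : G.Dart → ℤ} (hφ : G.IsFlow φ)
    (hφ1 : ∀ d, φ d ≤ 1)
    (hD : ∀ v, 2 * D v + (∑ d : G.Dart, if G.tgt d = v then (if d.1 ∈ A then -1 else φ d) else 0) =
      G.canonical v)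
    {p : (G.subdivide A).E → ℝ} (hp : ∀ a, 0 < p a) {f : G.V → ℝ}
    (hf1 : ∀ e h, p (half e h false) - p (half e h true) =
      f (G.ends e true) - f (G.ends e false))
    (hf2 : ∀ e h, (φ (e, false) : ℝ) * p (kept e h) = f (G.ends e true) - f (G.ends e false)) :
    (ofFun A D).IsPseudoRoot ∧ (ofFun A D).Semistable ∧
      (ofFun A D).flow = extFlow A φ ∧ p ∈ (ofFun A D).lamOpen := by
  have hflow : (ofFun A D).sub.IsFlow (extFlow A φ) := by
    intro a
    change extFlow A φ (a, true) = -extFlow A φ (a, false)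
    induction a using edge_cases with
    | h1 e h => exact hφ e
    | h2 e h b => rfl
  have hle : ∀ d, extFlow A φ d ≤ 1 := by
    rintro ⟨a, b⟩
    induction a using edge_cases with
    | h1 e h => exact hφ1 _
    | h2 e h c =>
      cases b
      · rw [extFlow_half_false]
      · rw [extFlow_half_true]; omega
  have hpot : ∃ F : (G.subdivide A).V → ℝ, ∀ d : (G.subdivide A).Dart,
      (extFlow A φ d : ℝ) * p d.1 = F ((G.subdivide A).tgt d) - F ((G.subdivide A).src d) := by
    -- The value at an exceptional vertex is prescribed along the half at the end `false`; `hf1`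
    -- says that the other half gives the same value.
    let F : (G.subdivide A).V → ℝ := fun v => Sum.elim f
      (fun e => f (G.ends e.1 false) + p (half e.1 e.2 false)) v
    have hFv : ∀ v, F (vtx _ v) = f v := fun v => rfl
    have hFe : ∀ e h, F (exv e h) = f (G.ends e false) + p (half e h false) := fun e h => rfl
    have key : ∀ a, (extFlow A φ (a, false) : ℝ) * p a = F ((G.subdivide A).tgt (a, false)) -
        F ((G.subdivide A).src (a, false)) := by
      intro a
      induction a using edge_cases with
      | h1 e h => simpa [hFv, extFlow_kept] using hf2 e h
      | h2 e h b =>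
        rw [extFlow_half_false]
        simp only [src_half_false, tgt_half_false, hFv, hFe]
        have := hf1 e h
        push_cast
        cases b <;> linarith
    refine ⟨F, ?_⟩
    rintro ⟨a, b⟩
    cases b
    · exact key a
    · have h1 := key a
      have h2 : extFlow A φ (a, true) = -extFlow A φ (a, false) := hflow a
      rw [h2]
      change _ = F ((G.subdivide A).src (a, false)) - F ((G.subdivide A).tgt (a, false))
      push_cast
      linarith
  have hroot : (ofFun A D).IsRootFlow (extFlow A φ) := by
    refine ⟨hflow, ?_, ?_⟩
    · obtain ⟨F, hF⟩ := hpot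
      exact isAcyclicFlow_of_potential (G := G.subdivide A) hp hF
    · intro v
      change 2 * (ofFun A D).D v + (G.subdivide A).divFlow (extFlow A φ) v =
        (G.subdivide A).canonical v
      induction v using vert_cases with
      | h1 v => rw [divFlow_extFlow_vtx, canonical_vtx, ofFun_D_vtx, hD]
      | h2 e h =>
        rw [divFlow_extFlow_exv, canonical_exv]
        change 2 * (-1) + 2 = (0 : ℤ)
        rfl
  have hs : (ofFun A D).Semistable := semistable_of_flow hroot.1 hroot.eq_real hle
  have hfl := hroot.flow_eq hs
  have hr : (ofFun A D).IsPseudoRoot := ⟨_, hroot⟩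
  refine ⟨hr, hs, hfl, ?_, hp⟩
  rw [hr.mem_lam_iff hs]
  refine ⟨fun a => (hp a).le, f, hf1, fun e h => ?_⟩
  rw [hfl]
  exact hf2 e h

/-- The divisor with given flow exists if the parity is right. -/
theorem exists_divisor {t : G.Dart → ℤ} (ht : ∀ d, t d = -1 ∨ t d = 0 ∨ t d = 1) {Q : Set G.E}
    (hQ : ∀ d, t d ≠ 0 ↔ d.1 ∈ Q) (hpar : ∀ v, Even (G.canonical v + G.degIn Q v)) :
    ∃ D : G.V → ℤ, ∀ v, 2 * D v + (∑ d : G.Dart, if G.tgt d = v then t d else 0) =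
      G.canonical v := by
  have key : ∀ v, Even (G.canonical v - ∑ d : G.Dart, if G.tgt d = v then t d else 0) := by
    intro v
    -- `t` is odd exactly at the edges of `Q`, so the sum of `t` has the parity of the degree in
    -- `Q`.
    have h1 : Even ((G.degIn Q v : ℤ) + ∑ d : G.Dart, if G.tgt d = v then t d else 0) := by
      rw [degIn_eq_sum_tgt]
      push_cast
      rw [← Finset.sum_add_distrib]
      refine Finset.even_sum _ fun d _ => ?_
      have h2 := hQ d
      rcases ht d with h | h | h <;> simp only [h] at h2 ⊢ <;> by_cases hv : G.tgt d = v <;>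
        simp_all
    have := (hpar v).sub h1
    have h3 : G.canonical v + (G.degIn Q v : ℤ) - ((G.degIn Q v : ℤ) +
      ∑ d : G.Dart, if G.tgt d = v then t d else 0) =
      G.canonical v - ∑ d : G.Dart, if G.tgt d = v then t d else 0 := by ring
    rwa [h3] at this
  choose D hD using key
  exact ⟨D, fun v => by have := hD v; omega⟩

/-- The parity condition for the existence of roots. -/
theorem IsPseudoRoot.even (hr : x.IsPseudoRoot) (hs : x.Semistable) (v : G.V) :
    Even (G.canonical v + G.degIn x.zeroEdgesᶜ v) := by
  have h1 := hr.flow.2.2 (vtx _ v)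
  rw [canonical_vtx, divFlow_eq, sum_dart_subdivide] at h1
  have h2 : Even ((G.degIn x.zeroEdgesᶜ v : ℤ) + ∑ d : G.Dart, if h : d.1 ∈ x.exc then
      (if x.sub.tgt (half d.1 h d.2, false) = vtx _ v then x.flow (half d.1 h d.2, false) else 0) +
      (if x.sub.tgt (half d.1 h d.2, true) = vtx _ v then x.flow (half d.1 h d.2, true) else 0)
      else if x.sub.tgt (kept d.1 h, d.2) = vtx _ v then x.flow (kept d.1 h, d.2) else 0) := by
    rw [degIn_eq_sum_tgt]
    push_cast
    rw [Fintype.sum_prod_type, Fintype.sum_prod_type, ← Finset.sum_add_distrib]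
    refine Finset.even_sum _ fun e _ => ?_
    have ht : ∀ b, G.tgt (e, b) = G.ends e !b := fun _ => rfl
    by_cases h : e ∈ x.exc
    · have h3 := hr.notMem_zeroEdges hs h
      simp only [Fintype.sum_bool, h, dif_pos, h3, Set.mem_compl_iff, not_false_iff, true_and,
        tgt_half_false, tgt_half_true, hr.flow_half' hs, ht, vtx_inj, exv_ne_vtx, if_false]
      by_cases h4 : G.ends e true = v <;> by_cases h5 : G.ends e false = v <;> simp [h4, h5]
    · have h3 := hr.mem_zeroEdges' hs h
      have h4 := hr.flow.1 (kept e h)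
      have h5 := hr.flow_le_one hs (kept e h, false)
      have h6 := hr.neg_one_le_flow hs (kept e h, false)
      simp only [Fintype.sum_bool, h, tgt_kept, vtx_inj, ht, Set.mem_compl_iff, h3 false, h4,
        not_false_iff, dif_neg]
      obtain h7 | h7 | h7 : x.flow (kept e h, false) = -1 ∨ x.flow (kept e h, false) = 0 ∨
        x.flow (kept e h, false) = 1 := by omega
      all_goals
        by_cases h8 : G.ends e true = v <;> by_cases h9 : G.ends e false = v <;>
          simp [h7, h8, h9]
  have h3 : Even (2 * x.D (vtx _ v)) := even_two_mul _
  have := h3.add h2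
  rwa [add_left_comm, h1, add_comm] at this

end PseudoDivisor

end SpinTrop

end

/-! ### Specializations of subdivided graphs -/

noncomputable section

namespace SpinTrop

open scoped Classical

open WGraph PseudoDivisor

variable {n : ℕ} {G H : WGraph n}

namespace WGraph.Specialization

variable (F : Specialization G H)

/-- The edge of the target that corresponds to an edge that is not contracted. -/
def proj (e : G.E) (h : e ∉ F.S) : H.E := (F.exists_incl h).choose

@[simp] theorem incl_proj (e : G.E) (h : e ∉ F.S) : F.incl (F.proj e h) = e :=
  (F.exists_incl h).choose_spec

@[simp] theorem proj_incl (a : H.E) (h : F.incl a ∉ F.S) : F.proj (F.incl a) h = a :=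
  F.incl_injective (F.incl_proj _ h)

/-- The pushforward of the divisor of a flow. -/
theorem divFlow_eq {φ : G.Dart → ℤ} (hφ : G.IsFlow φ) {ψ : H.Dart → ℤ}
    (h : ∀ d, ψ d = φ (F.dartIncl d)) (u : H.V) :
    H.divFlow ψ u = ∑ v, if F.vMap v = u then G.divFlow φ v else 0 := by
  have h1 : (∑ v, if F.vMap v = u then G.divFlow φ v else 0) =
      ∑ d : G.Dart, if F.vMap (G.tgt d) = u then φ d else 0 := by
    simp only [WGraph.divFlow_eq]
    have : ∀ v, (if F.vMap v = u then ∑ d : G.Dart, (if G.tgt d = v then φ d else 0) else 0) =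
        ∑ d : G.Dart, if G.tgt d = v then (if F.vMap v = u then φ d else 0) else 0 := by
      intro v
      split_ifs with h <;> simp
    simp only [this]
    rw [Finset.sum_comm]
    refine Finset.sum_congr rfl fun d _ => ?_
    simp
  rw [h1, F.sum_dart, WGraph.divFlow_eq]
  have h2 : (∑ e, if e ∈ F.S then
      (if F.vMap (G.tgt (e, false)) = u then φ (e, false) else 0) +
      (if F.vMap (G.tgt (e, true)) = u then φ (e, true) else 0) else 0) = 0 := by
    refine Finset.sum_eq_zero fun e _ => ?_
    by_cases he : e ∈ F.S
    · have h3 : F.vMap (G.tgt (e, false)) = F.vMap (G.tgt (e, true)) :=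
        F.vMap_eq_of_mem he _ _
      rw [if_pos he, h3, hφ e]
      split_ifs <;> simp
    · rw [if_neg he]
  rw [h2, add_zero]
  refine Finset.sum_congr rfl fun d _ => ?_
  rw [F.vMap_tgt, h]

/-- The specialization of subdivisions that contracts the half at the end `c e` of every
subdivided edge `e` that is not subdivided in the target. -/
theorem exists_hat {A : Set G.E} {B : Set H.E} (hAB : ∀ e ∈ B, F.incl e ∈ A) (c : H.E → Bool) :
    ∃ h : Specialization (G.subdivide A) (H.subdivide B),
      (∀ v, h.vMap (vtx A v) = vtx B (F.vMap v)) ∧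
      (∀ e (hA : e ∈ A), e ∈ F.S → h.vMap (exv e hA) = vtx B (F.vMap (G.ends e false))) ∧
      (∀ e (hB : e ∈ B) (hA : F.incl e ∈ A), h.vMap (exv (F.incl e) hA) = exv e hB) ∧
      (∀ e (_ : e ∉ B) (hA : F.incl e ∈ A), h.vMap (exv (F.incl e) hA) =
        vtx B (F.vMap (G.ends (F.incl e) (c e)))) ∧
      (∀ e (hB : e ∉ B) (hA : F.incl e ∉ A), h.incl (kept e hB) = kept (F.incl e) hA ∧
        h.tw (kept e hB) = F.tw e) ∧
      (∀ e (hB : e ∉ B) (hA : F.incl e ∈ A), h.incl (kept e hB) = half (F.incl e) hA (!c e) ∧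
        h.tw (kept e hB) = xor (!c e) (F.tw e)) ∧
      (∀ e (hB : e ∈ B) (hA : F.incl e ∈ A) b,
        h.incl (half e hB b) = half (F.incl e) hA (xor b (F.tw e)) ∧
        h.tw (half e hB b) = false) := by
  -- An exceptional vertex disappears with its contracted edge, stays exceptional, or merges with
  -- the end `c e` of its edge.
  let vm : (G.subdivide A).V → (H.subdivide B).V := fun u => Sum.elim (fun v => vtx B (F.vMap v))
    (fun e => if hS : e.1 ∈ F.S then vtx B (F.vMap (G.ends e.1 false)) else
      if hB : F.proj e.1 hS ∈ B then exv _ hB else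
        vtx B (F.vMap (G.ends e.1 (c (F.proj e.1 hS))))) u
  have vm_vtx : ∀ v, vm (vtx A v) = vtx B (F.vMap v) := fun _ => rfl
  have vm_S : ∀ e (hA : e ∈ A), e ∈ F.S → vm (exv e hA) = vtx B (F.vMap (G.ends e false)) :=
    fun e hA hS => dif_pos hS
  have vm_B : ∀ e (hB : e ∈ B) (hA : F.incl e ∈ A), vm (exv (F.incl e) hA) = exv e hB := by
    intro e hB hA
    have h0 : vm (exv (F.incl e) hA) = if hS : F.incl e ∈ F.S then _ else _ := rfl
    rw [h0, dif_neg (F.incl_notMem e)]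
    have h1 := F.proj_incl e (F.incl_notMem e)
    rw [dif_pos (h1.symm ▸ hB)]
    simp [h1]
  have vm_C : ∀ e (_ : e ∉ B) (hA : F.incl e ∈ A), vm (exv (F.incl e) hA) =
      vtx B (F.vMap (G.ends (F.incl e) (c e))) := by
    intro e hB hA
    have h0 : vm (exv (F.incl e) hA) = if hS : F.incl e ∈ F.S then _ else _ := rfl
    rw [h0, dif_neg (F.incl_notMem e)]
    have h1 := F.proj_incl e (F.incl_notMem e)
    rw [dif_neg (h1.symm ▸ hB)]
    simp [h1]
  let inc : (H.subdivide B).E → (G.subdivide A).E := fun a => Sum.elim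
    (fun e => if hA : F.incl e.1 ∈ A then half _ hA (!c e.1) else kept _ hA)
    (fun p => half _ (hAB _ p.1.2) (xor p.2 (F.tw p.1.1))) a
  have inc_kk : ∀ e (hB : e ∉ B) (hA : F.incl e ∉ A), inc (kept e hB) = kept (F.incl e) hA :=
    fun e hB hA => dif_neg hA
  have inc_kh : ∀ e (hB : e ∉ B) (hA : F.incl e ∈ A),
    inc (kept e hB) = half (F.incl e) hA (!c e) := fun e hB hA => dif_pos hA
  have inc_hh : ∀ e (hB : e ∈ B) (hA : F.incl e ∈ A) b,
    inc (half e hB b) = half (F.incl e) hA (xor b (F.tw e)) := fun _ _ _ _ => rfl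
  let tw : (H.subdivide B).E → Bool := fun a => Sum.elim
    (fun e => if F.incl e.1 ∈ A then xor (!c e.1) (F.tw e.1) else F.tw e.1) (fun _ => false) a
  have tw_kk : ∀ e (hB : e ∉ B) (_ : F.incl e ∉ A), tw (kept e hB) = F.tw e :=
    fun e hB hA => if_neg hA
  have tw_kh : ∀ e (hB : e ∉ B) (_ : F.incl e ∈ A), tw (kept e hB) = xor (!c e) (F.tw e) :=
    fun e hB hA => if_pos hA
  have tw_hh : ∀ e (hB : e ∈ B) b, tw (half e hB b) = false := fun _ _ _ => rfl
  obtain ⟨h, -, h1, h2, h3⟩ := exists_specialization vm inc tw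
    (by
      intro u
      induction u using vert_cases with
      | h1 v => obtain ⟨w, rfl⟩ := F.vMap_surjective v; exact ⟨vtx A w, rfl⟩
      | h2 e hB => exact ⟨exv _ (hAB e hB), vm_B e hB _⟩)
    (by
      intro a a' haa
      induction a using edge_cases with
      | h1 e hB =>
        induction a' using edge_cases with
        | h1 e' hB' =>
          rw [kept_inj]
          apply F.incl_injective
          by_cases hA : F.incl e ∈ A <;> by_cases hA' : F.incl e' ∈ A
          · rw [inc_kh e hB hA, inc_kh e' hB' hA', half_inj] at haa; exact haa.1
          · rw [inc_kh e hB hA, inc_kk e' hB' hA'] at haa; simp at haa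
          · rw [inc_kk e hB hA, inc_kh e' hB' hA'] at haa; simp at haa
          · rw [inc_kk e hB hA, inc_kk e' hB' hA', kept_inj] at haa; exact haa
        | h2 e' hB' b' =>
          rw [inc_hh e' hB' (hAB e' hB')] at haa
          by_cases hA : F.incl e ∈ A
          · rw [inc_kh e hB hA, half_inj] at haa
            exact absurd (F.incl_injective haa.1 ▸ hB') hB
          · rw [inc_kk e hB hA] at haa; simp at haa
      | h2 e hB b =>
        rw [inc_hh e hB (hAB e hB)] at haa
        induction a' using edge_cases with
        | h1 e' hB' =>
          by_cases hA : F.incl e' ∈ A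
          · rw [inc_kh e' hB' hA, half_inj] at haa
            exact absurd (F.incl_injective haa.1 ▸ hB) hB'
          · rw [inc_kk e' hB' hA] at haa; simp at haa
        | h2 e' hB' b' =>
          rw [inc_hh e' hB' (hAB e' hB'), half_inj] at haa
          have := F.incl_injective haa.1
          subst this
          simpa using haa.2)
    (by
      intro a b
      induction a using edge_cases with
      | h1 e hB =>
        by_cases hA : F.incl e ∈ A
        · rw [inc_kh e hB hA, tw_kh e hB hA, ends_kept]
          cases b
          · rw [ends_half_false, vm_vtx, F.vMap_ends_tw]; simp
          · rw [ends_half_true, vm_C e hB hA, F.vMap_ends_tw]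
            cases c e <;> cases F.tw e <;> rfl
        · rw [inc_kk e hB hA, tw_kk e hB hA, ends_kept, ends_kept, vm_vtx, F.vMap_ends_tw]
      | h2 e hB c' =>
        rw [inc_hh e hB (hAB e hB), tw_hh]
        cases b
        · simp [vm_vtx, F.vMap_ends_tw]
        · simp [vm_B e hB])
    (by
      intro a ha
      induction a using edge_cases with
      | h1 e hA =>
        have hS : e ∈ F.S := by
          by_contra hS
          obtain ⟨e', rfl⟩ := F.exists_incl hS
          have hB : e' ∉ B := fun hB => hA (hAB e' hB)
          exact ha ⟨kept e' hB, inc_kk e' hB hA⟩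
        rw [ends_kept, ends_kept, vm_vtx, vm_vtx, F.vMap_eq_of_mem hS false true]
      | h2 e hA b =>
        rw [ends_half_false, ends_half_true, vm_vtx]
        by_cases hS : e ∈ F.S
        · rw [vm_S e hA hS, F.vMap_eq_of_mem hS b false]
        · obtain ⟨e', rfl⟩ := F.exists_incl hS
          by_cases hB : e' ∈ B
          · refine absurd ⟨half e' hB (xor b (F.tw e')), ?_⟩ ha
            rw [inc_hh e' hB hA]
            simp
          · rw [vm_C e' hB hA]
            have : b = c e' := by
              by_contra hb
              refine ha ⟨kept e' hB, ?_⟩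
              rw [inc_kh e' hB hA, half_inj]
              refine ⟨rfl, ?_⟩
              cases b <;> cases h : c e' <;> simp_all
            rw [this])
    (by
      let R : Set (G.subdivide A).E := (Set.range inc)ᶜ
      have hkept : ∀ e (hA : e ∉ A), e ∈ F.S → kept e hA ∈ R := by
        rintro e hA hS ⟨a, ha⟩
        induction a using edge_cases with
        | h1 e' hB =>
          by_cases hA' : F.incl e' ∈ A
          · rw [inc_kh e' hB hA'] at ha; simp at ha
          · rw [inc_kk e' hB hA', kept_inj] at ha
            exact F.incl_notMem e' (ha ▸ hS)
        | h2 e' hB b =>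
          rw [inc_hh e' hB (hAB e' hB)] at ha
          simp at ha
      have hhalf : ∀ e (hA : e ∈ A) b, e ∈ F.S → half e hA b ∈ R := by
        rintro e hA b hS ⟨a, ha⟩
        induction a using edge_cases with
        | h1 e' hB =>
          by_cases hA' : F.incl e' ∈ A
          · rw [inc_kh e' hB hA', half_inj] at ha
            exact F.incl_notMem e' (ha.1 ▸ hS)
          · rw [inc_kk e' hB hA'] at ha; simp at ha
        | h2 e' hB b =>
          rw [inc_hh e' hB (hAB e' hB), half_inj] at ha
          exact F.incl_notMem e' (ha.1 ▸ hS)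
      have hconn : ∀ v w, F.vMap v = F.vMap w →
          (G.subdivide A).connSetoid R (vtx A v) (vtx A w) := by
        intro v w hvw
        refine connSetoid_le (Setoid.comap (vtx A) ((G.subdivide A).connSetoid R)) ?_
          (F.vMap_eq_iff.1 hvw)
        intro e hS
        change (G.subdivide A).connSetoid R _ _
        by_cases hA : e ∈ A
        · exact Setoid.trans' _ (connSetoid_of_mem (hhalf e hA false hS) false true)
            (connSetoid_of_mem (hhalf e hA true hS) true false)
        · exact connSetoid_of_mem (hkept e hA hS) false true
      have hred : ∀ u, (∃ w, vm u = vtx B (F.vMap w) ∧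
          (G.subdivide A).connSetoid R u (vtx A w)) ∨
          ∃ e hB hA, u = exv (F.incl e) hA ∧ vm u = exv e hB := by
        intro u
        induction u using vert_cases with
        | h1 v => exact Or.inl ⟨v, rfl, Setoid.refl' _ _⟩
        | h2 e hA =>
          by_cases hS : e ∈ F.S
          · exact Or.inl ⟨G.ends e false, vm_S e hA hS,
              connSetoid_of_mem (hhalf e hA false hS) true false⟩
          · obtain ⟨e', rfl⟩ := F.exists_incl hS
            by_cases hB : e' ∈ B
            · exact Or.inr ⟨e', hB, hA, rfl, vm_B e' hB hA⟩
            · refine Or.inl ⟨_, vm_C e' hB hA,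
                connSetoid_of_mem (e := half _ hA (c e')) ?_ true false⟩
              rintro ⟨a, ha⟩
              induction a using edge_cases with
              | h1 e hB' =>
                by_cases hA' : F.incl e ∈ A
                · rw [inc_kh e hB' hA', half_inj] at ha
                  have := F.incl_injective ha.1
                  subst this
                  simp at ha
                · rw [inc_kk e hB' hA'] at ha; simp at ha
              | h2 e hB' b =>
                rw [inc_hh e hB' (hAB e hB'), half_inj] at ha
                exact hB (F.incl_injective ha.1 ▸ hB')
      intro u v huv
      rcases hred u with ⟨w, h1, h2⟩ | ⟨e, hB, hA, h1, h2⟩ <;>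
        rcases hred v with ⟨w', h1', h2'⟩ | ⟨e', hB', hA', h1', h2'⟩
      · rw [h1, h1', vtx_inj] at huv
        exact Setoid.trans' _ (Setoid.trans' _ h2 (hconn _ _ huv)) (Setoid.symm' _ h2')
      · rw [h1, h2'] at huv; simp at huv
      · rw [h2, h1'] at huv; simp at huv
      · rw [h2, h2', exv_inj] at huv
        subst huv
        rw [h1, h1'])
    (by
      intro u
      rw [sum_vert_subdivide]
      simp only [canonical_vtx, canonical_exv, ite_self, dite_eq_ite, Finset.sum_const_zero,
        add_zero, vm_vtx]
      induction u using vert_cases with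
      | h1 v => simp only [canonical_vtx, vtx_inj]; exact F.canonical_eq v
      | h2 e hB => simp [canonical_exv])
    (by
      intro i
      exact (vm_vtx (G.leg i)).trans (congrArg (vtx B) (F.leg_eq i)))
  refine ⟨h, fun v => (h1 _).trans (vm_vtx v), fun e hA hS => (h1 _).trans (vm_S e hA hS),
    fun e hB hA => (h1 _).trans (vm_B e hB hA), fun e hB hA => (h1 _).trans (vm_C e hB hA),
    fun e hB hA => ⟨(h2 _).trans (inc_kk e hB hA), (h3 _).trans (tw_kk e hB hA)⟩,
    fun e hB hA => ⟨(h2 _).trans (inc_kh e hB hA), (h3 _).trans (tw_kh e hB hA)⟩,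
    fun e hB hA b => ⟨(h2 _).trans (inc_hh e hB hA b), (h3 _).trans (tw_hh e hB b)⟩⟩

end WGraph.Specialization

/-! ### Specializations of pseudo-divisors -/

namespace PDSpec

variable {x : PseudoDivisor G} {y : PseudoDivisor H} (f : PDSpec x y)

theorem hat_vtx (v : G.V) : f.hat.vMap (vtx x.exc v) = vtx y.exc (f.base.vMap v) :=
  f.vert_comm v

theorem mem_hat_S_of_below {a : x.sub.E} (h : G.below x.exc a ∈ f.base.S) : a ∈ f.hat.S := by
  by_contra ha
  obtain ⟨a', rfl⟩ := f.hat.exists_incl ha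
  rw [f.edge_comm] at h
  exact f.base.incl_notMem _ h

theorem len_ext (p : y.sub.E → ℝ) :
    len x.exc (f.hat.ext p) = f.base.ext (len y.exc p) := by
  funext e
  rw [len_eq_sum, f.hat.sum_edge]
  have h0 : (∑ a, if a ∈ f.hat.S then (if G.below x.exc a = e then f.hat.ext p a else 0)
      else 0) = 0 := by
    refine Finset.sum_eq_zero fun a _ => ?_
    split_ifs with h1 h2
    · exact f.hat.ext_mem h1 p
    · rfl
    · rfl
  rw [h0, add_zero]
  simp only [f.edge_comm, f.hat.ext_incl]
  by_cases he : e ∈ f.base.S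
  · rw [f.base.ext_mem he]
    refine Finset.sum_eq_zero fun a _ => if_neg ?_
    rintro rfl
    exact f.base.incl_notMem _ he
  · obtain ⟨e', rfl⟩ := f.base.exists_incl he
    rw [f.base.ext_incl, len_eq_sum]
    simp only [f.base.incl_injective.eq_iff]

theorem incl_kept (e : H.E) (h : e ∉ y.exc) (h' : f.base.incl e ∉ x.exc) :
    f.hat.incl (kept e h) = kept (f.base.incl e) h' := by
  have h1 := f.edge_comm (kept e h)
  rw [below_kept] at h1
  generalize f.hat.incl (kept e h) = a at h1 ⊢
  induction a using edge_cases with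
  | h1 e' he => rw [below_kept] at h1; subst h1; rfl
  | h2 e' he b => rw [below_half] at h1; subst h1; exact absurd he h'

end PDSpec

/-- The pushforward of divisors follows from that of flows. -/
theorem push_D_of_flow {x : PseudoDivisor G} {y : PseudoDivisor H}
    (hx : x.IsPseudoRoot) (hy : y.IsPseudoRoot) (h : Specialization x.sub y.sub)
    (hf : ∀ d, y.flow d = x.flow (h.dartIncl d)) (u : y.sub.V) :
    y.D u = ∑ v, if h.vMap v = u then x.D v else 0 := by
  have h1 := hy.flow.2.2 u
  rw [h.divFlow_eq hx.flow.1 hf, h.canonical_eq] at h1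
  have h2 : ∀ v, (if h.vMap v = u then x.sub.canonical v else 0) =
      2 * (if h.vMap v = u then x.D v else 0) +
      (if h.vMap v = u then x.sub.divFlow x.flow v else 0) := by
    intro v
    split_ifs
    · exact (hx.flow.2.2 v).symm
    · simp
  simp only [h2, Finset.sum_add_distrib, ← Finset.mul_sum] at h1
  omega

/-- Construction of specializations of pseudo-roots. -/
theorem exists_rootSpec {x : PseudoDivisor G} {y : PseudoDivisor H} (hx : x.IsPseudoRoot)
    (hxs : x.Semistable) (hy : y.IsPseudoRoot) (hys : y.Semistable) (F : Specialization G H)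
    (hexc : ∀ e ∈ y.exc, F.incl e ∈ x.exc)
    (hkept : ∀ e (h : e ∉ y.exc) (h' : F.incl e ∉ x.exc),
      y.flow (kept e h, false) = x.flow (kept (F.incl e) h', F.tw e))
    (hne : ∀ e (h : e ∉ y.exc), F.incl e ∈ x.exc → y.flow (kept e h, false) ≠ 0) :
    ∃ f : RootSpec x y, f.base = F ∧
      (∀ e (h : e ∉ y.exc) (h' : F.incl e ∉ x.exc),
        f.hat.incl (kept e h) = kept (F.incl e) h') ∧
      (∀ e (h : e ∈ y.exc) (h' : F.incl e ∈ x.exc) b,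
        f.hat.incl (half e h b) = half (F.incl e) h' (xor b (F.tw e))) := by
  -- The flow runs into exceptional vertices, so the half that survives must be the one at the end
  -- that the flow of `y` leaves; `c` selects the other half for contraction.
  let c : H.E → Bool := fun e => if h : e ∈ y.exc then false else
    if y.flow (kept e h, false) = 1 then !F.tw e else F.tw e
  obtain ⟨h, h1, -, -, -, h5, h6, h7⟩ := F.exists_hat hexc c
  have hflow : ∀ d, y.flow d = x.flow (h.dartIncl d) := by
    have key : ∀ a, y.flow (a, false) = x.flow (h.incl a, h.tw a) := by
      intro a
      induction a using edge_cases with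
      | h1 e he =>
        by_cases he' : F.incl e ∈ x.exc
        · rw [(h6 e he he').1, (h6 e he he').2]
          have h8 : c e = if y.flow (kept e he, false) = 1 then !F.tw e else F.tw e :=
            dif_neg he
          have h9 := hy.flow_le_one hys (kept e he, false)
          have h10 := hy.neg_one_le_flow hys (kept e he, false)
          have h11 := hne e he he'
          by_cases h12 : y.flow (kept e he, false) = 1
          · rw [h8, if_pos h12, h12]
            simp [hx.flow_half hxs]
          · rw [h8, if_neg h12]
            have : y.flow (kept e he, false) = -1 := by omega
            rw [this]
            cases F.tw e <;> simp [hx.flow_half' hxs]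
        · rw [(h5 e he he').1, (h5 e he he').2]
          exact hkept e he he'
      | h2 e he b =>
        rw [(h7 e he (hexc e he) b).1, (h7 e he (hexc e he) b).2, hy.flow_half hys,
          hx.flow_half hxs]
    rintro ⟨a, b⟩
    rw [Specialization.dartIncl_eq]
    cases b
    · simpa using key a
    · have h8 := hx.flow_rev (h.incl a, h.tw a)
      rw [← key] at h8
      rw [hy.flow.1 a, ← h8]
      simp [rev]
  refine ⟨⟨⟨F, h, hexc, h1, ?_, push_D_of_flow hx hy h hflow⟩, hflow⟩, rfl,
    fun e he he' => (h5 e he he').1, fun e he he' b => (h7 e he he' b).1⟩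
  intro a
  induction a using edge_cases with
  | h1 e he =>
    by_cases he' : F.incl e ∈ x.exc
    · rw [(h6 e he he').1]; rfl
    · rw [(h5 e he he').1]; rfl
  | h2 e he b => rw [(h7 e he (hexc e he) b).1]; rfl

namespace RootSpec

variable {x : PseudoDivisor G} {y : PseudoDivisor H} (f : RootSpec x y)

/-- Exceptional edges have flow `±1`, so a zero edge is subdivided on neither side and the
push-forward of the flow compares the two values directly. -/
theorem mem_zeroEdges (hx : x.IsPseudoRoot) (hxs : x.Semistable) (hy : y.IsPseudoRoot)
    (hys : y.Semistable) (e : H.E) : e ∈ y.zeroEdges ↔ f.base.incl e ∈ x.zeroEdges := by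
  constructor
  · rintro ⟨a, ha, rfl⟩
    rw [← f.edge_comm]
    refine ⟨f.hat.incl a, ?_, rfl⟩
    have h0 : y.flow (a, false) = 0 := ha
    have h1 := f.push_flow (a, false)
    rw [h0, Specialization.dartIncl_eq] at h1
    change x.flow (f.hat.incl a, false) = 0
    cases h2 : f.hat.tw a
    · simpa [h2] using h1.symm
    · have := hx.flow.1 (f.hat.incl a)
      simp only [h2] at h1
      change 0 = x.flow (f.hat.incl a, true) at h1
      omega
  · intro h
    obtain ⟨h1, h2⟩ := (hx.mem_zeroEdges hxs).1 h
    have h3 : e ∉ y.exc := fun h3 => h1 (f.exc_sub e h3)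
    rw [hy.mem_zeroEdges' hys h3 false, f.push_flow, Specialization.dartIncl_eq]
    simp only [f.incl_kept e h3 h1]
    exact (hx.mem_zeroEdges' hxs h1 _).1 h

/-- The potential pulls back along `hat`: a contracted edge has equal values at its ends and
coordinate zero. -/
theorem ext_mem_lam (hy : y.IsPseudoRoot) {p : y.sub.E → ℝ}
    (hp : p ∈ y.lam) : f.hat.ext p ∈ x.lam := by
  obtain ⟨F, hF⟩ := exists_potential (ω := fun d : y.sub.Dart => (y.flow d : ℝ) * p d.1)
    (by intro d; rw [hy.flow_rev]; simp [rev]) hp.2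
  constructor
  · intro a
    by_cases h : a ∈ f.hat.S
    · rw [f.hat.ext_mem h]
    · obtain ⟨a', rfl⟩ := f.hat.exists_incl h
      rw [f.hat.ext_incl]; exact hp.1 _
  · intro γ
    have key : ∀ d : x.sub.Dart, (x.flow d : ℝ) * f.hat.ext p d.1 =
        F (f.hat.vMap (x.sub.tgt d)) - F (f.hat.vMap (x.sub.src d)) := by
      intro d
      by_cases h : d.1 ∈ f.hat.S
      · rw [f.hat.ext_mem h]
        have : f.hat.vMap (x.sub.tgt d) = f.hat.vMap (x.sub.src d) :=
          f.hat.vMap_eq_of_mem h _ _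
        rw [this]; simp
      · obtain ⟨d', rfl⟩ := f.hat.exists_dartIncl h
        rw [f.hat.vMap_tgt, f.hat.vMap_src, ← hF, ← f.push_flow]
        congr 1
        exact f.hat.ext_incl _ _
    simp only [key]
    exact γ.sum_potential fun v => F (f.hat.vMap v)

/-- Vanishing of `p` on the contracted edges makes the potential constant on the fibres of `hat`, so
that it descends. -/
theorem restrict_mem_lam (hx : x.IsPseudoRoot) {p : x.sub.E → ℝ} (hp : p ∈ x.lam)
    (h0 : ∀ a ∈ f.hat.S, p a = 0) : (fun a => p (f.hat.incl a)) ∈ y.lam := by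
  obtain ⟨F, hF⟩ := exists_potential (ω := fun d : x.sub.Dart => (x.flow d : ℝ) * p d.1)
    (by intro d; rw [hx.flow_rev]; simp [rev]) hp.2
  refine ⟨fun a => hp.1 _, fun γ => ?_⟩
  choose s hs using f.hat.vMap_surjective
  have hFs : ∀ v, F (s (f.hat.vMap v)) = F v := by
    intro v
    refine eq_of_connSetoid (S := f.hat.S) ?_ (f.hat.vMap_eq_iff.1 (hs _))
    intro a ha
    have := hF (a, false)
    simp only [h0 a ha, mul_zero] at this
    change 0 = F (x.sub.ends a true) - F (x.sub.ends a false) at this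
    linarith
  have key : ∀ d : y.sub.Dart, (y.flow d : ℝ) * p (f.hat.incl d.1) =
      F (s (y.sub.tgt d)) - F (s (y.sub.src d)) := by
    intro d
    rw [← f.hat.vMap_tgt, ← f.hat.vMap_src, hFs, hFs, f.push_flow]
    exact hF (f.hat.dartIncl d)
  simp only [key]
  exact γ.sum_potential fun v => F (s v)

end RootSpec

end SpinTrop

end

/-! ### Stability under specialization and polystable pseudo-roots -/

noncomputable section

namespace SpinTrop

open scoped Classical

open WGraph PseudoDivisor

variable {n : ℕ} {G H K : WGraph n}

namespace WGraph

/-- Both divisors push forward, and no contracted edge crosses the preimage of a set. -/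
theorem beta_pullback (h : Specialization G H) {m : G.V → ℝ} {m' : H.V → ℝ}
    (hm : ∀ v, 2 * m v = G.canonical v) (hm' : ∀ v, 2 * m' v = H.canonical v)
    {D : G.V → ℤ} {D' : H.V → ℤ} (hD : ∀ u, D' u = ∑ v, if h.vMap v = u then D v else 0)
    (W : Finset H.V) (W' : Finset G.V) (hW : ∀ v, v ∈ W' ↔ h.vMap v ∈ W) :
    G.beta m D W' = H.beta m' D' W := by
  have key : ∀ (a : G.V → ℝ) (a' : H.V → ℝ), (∀ u, a' u = ∑ v, if h.vMap v = u then a v else 0) →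
      ∑ v ∈ W', a v = ∑ u ∈ W, a' u := by
    intro a a' ha
    simp only [ha]
    rw [Finset.sum_comm]
    have : ∀ v, (∑ u ∈ W, if h.vMap v = u then a v else 0) = if v ∈ W' then a v else 0 := by
      intro v
      rw [Finset.sum_ite_eq]; simp only [hW]
    simp only [this]
    rw [← Finset.sum_filter]
    exact Finset.sum_congr (by ext; simp) fun _ _ => rfl
  have h1 := key (fun v => (D v : ℝ)) (fun u => (D' u : ℝ)) (by
    intro u; rw [hD]; push_cast; rfl)
  have h2 := key m m' (by
    intro u
    have h3 : 2 * m' u = ∑ v, if h.vMap v = u then 2 * m v else 0 := by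
      rw [hm', h.canonical_eq]
      push_cast
      simp only [hm]
    have h4 : (∑ v, if h.vMap v = u then 2 * m v else 0) =
        2 * ∑ v, if h.vMap v = u then m v else 0 := by
      rw [Finset.mul_sum]
      exact Finset.sum_congr rfl fun v _ => by split_ifs <;> simp
    linarith)
  have h3 : ((G.cut W').ncard : ℝ) = (H.cut W).ncard := by
    rw [ncard_cut, ncard_cut, h.sum_dart]
    have h0 : (∑ e, if e ∈ h.S then
        ((if G.src (e, false) ∉ W' ∧ G.tgt (e, false) ∈ W' then (1 : ℝ) else 0) +
        if G.src (e, true) ∉ W' ∧ G.tgt (e, true) ∈ W' then (1 : ℝ) else 0) else 0) = 0 := by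
      refine Finset.sum_eq_zero fun e _ => ?_
      by_cases he : e ∈ h.S
      · have h1 := h.vMap_eq_of_mem he true false
        by_cases h2 : h.vMap (G.ends e false) ∈ W <;>
          simp [he, hW, src, tgt, h1, h2]
      · rw [if_neg he]
    rw [h0, add_zero]
    simp only [hW, h.vMap_src, h.vMap_tgt]
  rw [beta, beta, h1, h2, h3]

end WGraph

namespace PseudoDivisor

variable {x y z : PseudoDivisor G}

/-- The correction counts the exceptional edges from `W₀` to exceptional vertices outside `W`. It
vanishes once `W` contains all exceptional neighbours of `W₀`, so `betaExc W₀` is the least value of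
`β` on sets with trace `W₀`. -/
theorem beta_eq_betaExc (x : PseudoDivisor G) (W : Finset x.sub.V) (W₀ : Finset G.V)
    (hW : ∀ v, v ∈ W₀ ↔ vtx _ v ∈ W) :
    x.sub.beta x.muSub x.D W = x.betaExc W₀ + ∑ d : G.Dart,
      if h : d.1 ∈ x.exc then (if exv d.1 h ∉ W ∧ G.src d ∈ W₀ then 1 else 0) else 0 := by
  have hsum : ∀ a : x.sub.V → ℝ, ∑ v ∈ W, a v = ∑ v ∈ W₀, a (vtx _ v) +
      ∑ e : G.E, if h : e ∈ x.exc then (if exv e h ∈ W then a (exv e h) else 0) else 0 := by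
    intro a
    have h1 : ∑ v ∈ W, a v = ∑ v, if v ∈ W then a v else 0 := by
      rw [← Finset.sum_filter]
      exact Finset.sum_congr (by ext; simp) fun _ _ => rfl
    rw [h1, sum_vert_subdivide]
    congr 1
    simp only [← hW]
    rw [← Finset.sum_filter]
    exact Finset.sum_congr (by ext; simp) fun _ _ => rfl
  have hdeg : ∑ v ∈ W₀, (G.degIn x.exc v : ℝ) =
      ∑ d : G.Dart, if d.1 ∈ x.exc ∧ G.src d ∈ W₀ then 1 else 0 := by
    simp only [degIn_eq_sum]
    push_cast
    rw [Finset.sum_comm]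
    refine Finset.sum_congr rfl fun d _ => ?_
    by_cases h : d.1 ∈ x.exc <;> simp [h]
  have hcut : ((G.cut W₀ \ x.exc).ncard : ℝ) =
      ∑ d : G.Dart, if d.1 ∉ x.exc ∧ G.src d ∉ W₀ ∧ G.tgt d ∈ W₀ then 1 else 0 := by
    rw [Set.ncard_eq_toFinset_card', Finset.card_eq_sum_ones, Fintype.sum_prod_type]
    push_cast
    have : (G.cut W₀ \ x.exc).toFinset = Finset.univ.filter fun e =>
        ¬ (G.ends e false ∈ W₀ ↔ G.ends e true ∈ W₀) ∧ e ∉ x.exc := by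
      ext e; rw [Set.mem_toFinset]; simp [cut]
    rw [this, Finset.sum_filter]
    refine Finset.sum_congr rfl fun e _ => ?_
    simp only [Fintype.sum_bool, src, tgt, Bool.not_true, Bool.not_false]
    by_cases h1 : G.ends e false ∈ W₀ <;> by_cases h2 : G.ends e true ∈ W₀ <;>
      by_cases h3 : e ∈ x.exc <;> simp [h1, h2, h3]
  have hmu : ∀ v, x.muSub (vtx _ v) = G.mu v := fun v => rfl
  have hmu' : ∀ e h, x.muSub (exv e h) = 0 := fun e h => rfl
  rw [beta, betaExc, hsum, hsum, ncard_cut, sum_dart_subdivide, hcut,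
    Finset.sum_add_distrib, ← Finset.sum_div, hdeg]
  simp only [hmu, hmu', D_exv, ite_self, dite_eq_ite, Finset.sum_const_zero, add_zero]
  have key : (∑ e : G.E, if h : e ∈ x.exc then (if exv e h ∈ W then ((-1 : ℤ) : ℝ) else 0)
      else 0) +
      (∑ d : G.Dart, if h : d.1 ∈ x.exc then
        (if x.sub.src (half d.1 h d.2, false) ∉ W ∧ x.sub.tgt (half d.1 h d.2, false) ∈ W
          then (1 : ℝ) else 0) +
        (if x.sub.src (half d.1 h d.2, true) ∉ W ∧ x.sub.tgt (half d.1 h d.2, true) ∈ W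
          then (1 : ℝ) else 0)
        else if x.sub.src (kept d.1 h, d.2) ∉ W ∧ x.sub.tgt (kept d.1 h, d.2) ∈ W then 1
          else 0) / 2 =
      -(∑ d : G.Dart, if d.1 ∈ x.exc ∧ G.src d ∈ W₀ then 1 else 0) / 2 +
      (∑ d : G.Dart, if d.1 ∉ x.exc ∧ G.src d ∉ W₀ ∧ G.tgt d ∈ W₀ then 1 else 0) / 2 +
      ∑ d : G.Dart,
        if h : d.1 ∈ x.exc then (if exv d.1 h ∉ W ∧ G.src d ∈ W₀ then 1 else 0) else 0 := by
    simp only [Fintype.sum_prod_type, neg_div, Finset.sum_div]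
    rw [← Finset.sum_neg_distrib, ← Finset.sum_add_distrib, ← Finset.sum_add_distrib,
      ← Finset.sum_add_distrib]
    refine Finset.sum_congr rfl fun e _ => ?_
    have hs : ∀ b, G.src (e, b) = G.ends e b := fun _ => rfl
    have ht : ∀ b, G.tgt (e, b) = G.ends e !b := fun _ => rfl
    by_cases h : e ∈ x.exc
    · simp only [Fintype.sum_bool, h, dif_pos, src_half_false, tgt_half_false, src_half_true,
        tgt_half_true, hs, ht, ← hW, not_true, false_and, if_false]
      by_cases h1 : G.ends e false ∈ W₀ <;> by_cases h2 : G.ends e true ∈ W₀ <;>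
        by_cases h3 : exv e h ∈ W <;> simp [h1, h2, h3] <;> norm_num
    · simp only [Fintype.sum_bool, h, src_kept, tgt_kept, hs, ht, ← hW, dif_neg, not_false_iff]
      simp
  rw [← hdeg] at key
  have hD : ∑ v ∈ W₀, (x.D (Sum.inl v) : ℝ) = ∑ v ∈ W₀, (x.D (vtx _ v) : ℝ) := rfl
  rw [hD]
  linarith

theorem sum_dart_exc_nonneg (x : PseudoDivisor G) (W : Finset x.sub.V) (W₀ : Finset G.V) :
    0 ≤ ∑ d : G.Dart, if h : d.1 ∈ x.exc then
      (if exv d.1 h ∉ W ∧ G.src d ∈ W₀ then (1 : ℝ) else 0) else 0 :=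
  Finset.sum_nonneg fun d _ => by split_ifs <;> norm_num

theorem Polystable.semistable (h : x.Polystable) : x.Semistable := by
  refine ⟨h.1, fun W _ => ?_⟩
  rw [x.beta_eq_betaExc W (Finset.univ.filter fun v => vtx _ v ∈ W) (by simp)]
  exact add_nonneg (h.2 _).1 (sum_dart_exc_nonneg _ _ _)

/-- A set with `β = 0` for a polystable pseudo-divisor. -/
theorem Polystable.of_beta (h : x.Polystable) {W : Finset x.sub.V}
    (hW : x.sub.beta x.muSub x.D W = 0) :
    (∀ e, vtx _ (G.ends e false) ∈ W ∧ vtx _ (G.ends e true) ∉ W ∨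
      vtx _ (G.ends e true) ∈ W ∧ vtx _ (G.ends e false) ∉ W → e ∈ x.exc) ∧
    ∀ e h b, vtx _ (G.ends e b) ∈ W → exv (A := x.exc) e h ∈ W := by
  set W₀ := Finset.univ.filter fun v => vtx x.exc v ∈ W with hW₀
  have hmem : ∀ v, v ∈ W₀ ↔ vtx _ v ∈ W := by simp [hW₀]
  rw [x.beta_eq_betaExc W W₀ hmem] at hW
  have h1 := (h.2 W₀).1
  have h2 := sum_dart_exc_nonneg x W W₀
  constructor
  · intro e he
    by_contra hexc
    have h3 := (h.2 W₀).2 (fun hc => hexc (hc (by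
      change ¬ (_ ↔ _)
      rw [hmem, hmem]
      tauto)))
    linarith
  · intro e he b hb
    by_contra hexc
    have h3 : (∑ d : G.Dart, if h : d.1 ∈ x.exc then
      (if exv d.1 h ∉ W ∧ G.src d ∈ W₀ then (1 : ℝ) else 0) else 0) = 0 := by linarith
    have h4 := (Finset.sum_eq_zero_iff_of_nonneg
      (fun d _ => by split_ifs <;> norm_num)).1 h3 (e, b) (Finset.mem_univ _)
    rw [dif_pos he, if_pos ⟨hexc, (hmem _).2 hb⟩] at h4
    exact one_ne_zero h4

theorem exists_upper (hr : x.IsPseudoRoot) (hs : x.Semistable) {e : G.E} (h : e ∉ x.exc)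
    {b : Bool} (hb : 0 < x.flow (kept e h, b)) : ∃ W : Finset x.sub.V,
      vtx _ (G.ends e !b) ∈ W ∧ vtx _ (G.ends e b) ∉ W ∧
      x.sub.beta x.muSub x.D W = 0 := by
  obtain ⟨W, h1, h2, h3, -⟩ := upper_of_pos hr.flow.1 hr.flow.2.1 hr.flow.eq_real hs hb
  exact ⟨W, h1, h2, h3⟩

theorem exists_pos_of_notMem (hr : x.IsPseudoRoot) (hs : x.Semistable) {e : G.E}
    (h : e ∉ x.exc) (h0 : e ∉ x.zeroEdges) : ∃ b, 0 < x.flow (kept e h, b) := by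
  rw [hr.mem_zeroEdges' hs h false] at h0
  have := hr.flow.1 (kept e h)
  by_cases h1 : 0 < x.flow (kept e h, false)
  · exact ⟨false, h1⟩
  · exact ⟨true, by omega⟩

/-- A nonexceptional edge with nonzero flow would cross a set with `β = 0`, and for a polystable
pseudo-divisor only exceptional edges cross such a set. -/
theorem Polystable.zeroEdges_eq (h : x.Polystable) (hr : x.IsPseudoRoot) :
    x.zeroEdges = x.excᶜ := by
  ext e
  constructor
  · intro he hexc
    exact hr.notMem_zeroEdges h.semistable hexc he
  · intro he
    by_contra h0
    obtain ⟨b, hb⟩ := exists_pos_of_notMem hr h.semistable he h0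
    obtain ⟨W, h1, h2, h3⟩ := exists_upper hr h.semistable he hb
    refine he ((h.of_beta h3).1 e ?_)
    cases b
    · exact Or.inr ⟨h1, h2⟩
    · exact Or.inl ⟨h1, h2⟩

theorem Polystable.exc_eq (h : x.Polystable) (hr : x.IsPseudoRoot) :
    x.exc = x.zeroEdgesᶜ := by rw [h.zeroEdges_eq hr, compl_compl]

theorem Polystable.flow_kept (h : x.Polystable) (hr : x.IsPseudoRoot) {e : G.E}
    (he : e ∉ x.exc) (b : Bool) : x.flow (kept e he, b) = 0 := by
  rw [← hr.mem_zeroEdges' h.semistable, h.zeroEdges_eq hr]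
  exact he

theorem Polystable.ext (hx : x.Polystable) (hrx : x.IsPseudoRoot) (hy : y.Polystable)
    (hry : y.IsPseudoRoot) (h : x.exc = y.exc) : x = y :=
  hrx.ext hx.semistable hry hy.semistable h fun e h1 h2 => by
    rw [hx.flow_kept hrx, hy.flow_kept hry]

/-- Polystable pseudo-roots are given by sets of edges with a parity condition. -/
theorem exists_polystable {A : Set G.E} (hpar : ∀ v, Even (G.canonical v + G.degIn A v)) :
    ∃ x : PseudoDivisor G, x.exc = A ∧ x.IsPseudoRoot ∧ x.Polystable := by
  obtain ⟨D, hD⟩ := exists_divisor (t := fun d => if d.1 ∈ A then -1 else 0) (Q := A)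
    (fun d => by by_cases h : d.1 ∈ A <;> simp [h]) (fun d => by by_cases h : d.1 ∈ A <;> simp [h])
    hpar
  -- With zero flow off `A`, a constant potential and unit lengths satisfy the equations. The
  -- resulting `betaExc W` is half the number of nonexceptional edges across `W`, which is
  -- polystability.
  obtain ⟨hr, hs, -, -⟩ := root_ofFun (A := A) (D := D) (φ := fun _ => 0) (fun _ => rfl)
    (fun _ => by norm_num) hD (p := fun _ => 1) (fun _ => one_pos) (f := fun _ => 0)
    (by simp) (by simp)
  refine ⟨_, rfl, hr, hs.1, fun W => ?_⟩
  have hD' : ∀ v, (2 * D v : ℝ) = 2 * G.mu v + G.degIn A v := by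
    intro v
    have h1 := hD v
    have h2 : (∑ d : G.Dart, if G.tgt d = v then (if d.1 ∈ A then (-1 : ℤ) else 0) else 0) =
        -(G.degIn A v : ℤ) := by
      rw [degIn_eq_sum_tgt]
      push_cast
      rw [← Finset.sum_neg_distrib]
      refine Finset.sum_congr rfl fun d _ => ?_
      by_cases h : d.1 ∈ A <;> by_cases h' : G.tgt d = v <;> simp [h, h']
    rw [h2] at h1
    have h3 : 2 * D v = G.canonical v + G.degIn A v := by omega
    have h4 : (2 * D v : ℝ) = G.canonical v + G.degIn A v := by exact_mod_cast h3
    rw [h4]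
    simp [mu, canonical]
    ring
  have hbeta : (ofFun A D).betaExc W = ((G.cut W \ A).ncard : ℝ) / 2 := by
    rw [betaExc]
    have : ∑ v ∈ W, ((ofFun A D).D (Sum.inl v) : ℝ) =
        ∑ v ∈ W, (G.mu v + (G.degIn A v : ℝ) / 2) := by
      refine Finset.sum_congr rfl fun v _ => ?_
      have := hD' v
      change (D v : ℝ) = _
      linarith
    rw [this]
    simp
  rw [hbeta]
  refine ⟨by positivity, fun h => ?_⟩
  have : 0 < (G.cut W \ A).ncard := by
    rw [Set.ncard_pos (Set.toFinite _)]
    obtain ⟨e, he, he'⟩ := Set.not_subset.1 h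
    exact ⟨e, he, he'⟩
  positivity

end PseudoDivisor

/-! ### Compatible spin structures -/

/-- The zero edges and the sign functions are compatible with a specialization of graphs. -/
structure Compat (F : Specialization G H) (x : SpinRoot G) (y : SpinRoot H) : Prop where
  zero : ∀ e, e ∈ y.pd.zeroEdges ↔ F.incl e ∈ x.pd.zeroEdges
  sign : ∀ u' : (H.contract y.pd.zeroEdges).V, y.sign u' =
    ∑ u : (G.contract x.pd.zeroEdges).V,
      if ∃ v : G.V, G.contractMk x.pd.zeroEdges v = u ∧
        H.contractMk y.pd.zeroEdges (F.vMap v) = u' then x.sign u else 0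

theorem WGraph.Specialization.exists_quot (F : Specialization G H) {P : Set G.E} {P' : Set H.E}
    (h : ∀ e, F.incl e ∈ P → e ∈ P') : ∃ q : (G.contract P).V → (H.contract P').V,
      ∀ v, q (G.contractMk P v) = H.contractMk P' (F.vMap v) := by
  refine ⟨Quotient.lift (fun v => H.contractMk P' (F.vMap v)) ?_, fun v => rfl⟩
  intro u v huv
  refine eq_of_connSetoid (f := fun v => H.contractMk P' (F.vMap v)) ?_ huv
  intro e he
  by_cases hS : e ∈ F.S
  · rw [F.vMap_eq_of_mem hS false true]
  · obtain ⟨a, rfl⟩ := F.exists_incl hS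
    rw [contractMk_eq_iff, F.vMap_ends_tw, F.vMap_ends_tw]
    exact connSetoid_of_mem (h a he) _ _

theorem contractMk_surjective (P : Set G.E) : Function.Surjective (G.contractMk P) :=
  Quotient.mk_surjective

namespace Compat

variable {F : Specialization G H} {F' : Specialization H K} {F'' : Specialization G K}
  {x : SpinRoot G} {y : SpinRoot H} {z : SpinRoot K}

/-- The relation in the push-forward of signs is the graph of a map `q`, since the zero edges of `x`
are contracted by `F` or go to zero edges of `y`. -/
theorem exists_quot (hzero : ∀ e, e ∈ y.pd.zeroEdges ↔ F.incl e ∈ x.pd.zeroEdges) :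
    ∃ q : (G.contract x.pd.zeroEdges).V → (H.contract y.pd.zeroEdges).V,
      (∀ v, q (G.contractMk _ v) = H.contractMk _ (F.vMap v)) ∧
      ∀ u u', (∃ v : G.V, G.contractMk x.pd.zeroEdges v = u ∧
        H.contractMk y.pd.zeroEdges (F.vMap v) = u') ↔ q u = u' := by
  obtain ⟨q, hq⟩ := F.exists_quot (P := x.pd.zeroEdges) (P' := y.pd.zeroEdges)
    fun e he => (hzero e).2 he
  refine ⟨q, hq, fun u u' => ⟨?_, ?_⟩⟩
  · rintro ⟨v, rfl, rfl⟩; exact hq v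
  · rintro rfl
    obtain ⟨v, rfl⟩ := contractMk_surjective _ u
    exact ⟨v, rfl, (hq v).symm⟩

theorem sum_sum {α β γ M : Type*} [Fintype α] [Fintype β] [AddCommMonoid M] (q : α → β)
    (r : β → γ) (s : α → M) (c : γ) :
    (∑ b, if r b = c then (∑ a, if q a = b then s a else 0) else 0) =
      ∑ a, if r (q a) = c then s a else 0 := by
  have : ∀ b, (if r b = c then (∑ a, if q a = b then s a else 0) else 0) =
      ∑ a, if q a = b then (if r b = c then s a else 0) else 0 := by
    intro b
    split_ifs <;> simp
  simp only [this]
  rw [Finset.sum_comm]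
  refine Finset.sum_congr rfl fun a _ => ?_
  simp

/-- This single identity gives both composition (`comp`) and cancellation of the first arrow
(`factor`). -/
theorem sign_comp (hF : Compat F x y) (hzero : ∀ e, e ∈ z.pd.zeroEdges ↔ F'.incl e ∈ y.pd.zeroEdges)
    (hv : ∀ v, F''.vMap v = F'.vMap (F.vMap v)) (hi : ∀ e, F''.incl e = F.incl (F'.incl e))
    (u'' : (K.contract z.pd.zeroEdges).V) :
    (∑ u : (H.contract y.pd.zeroEdges).V,
      if ∃ v : H.V, H.contractMk y.pd.zeroEdges v = u ∧
        K.contractMk z.pd.zeroEdges (F'.vMap v) = u'' then y.sign u else 0) =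
    ∑ u : (G.contract x.pd.zeroEdges).V,
      if ∃ v : G.V, G.contractMk x.pd.zeroEdges v = u ∧
        K.contractMk z.pd.zeroEdges (F''.vMap v) = u'' then x.sign u else 0 := by
  obtain ⟨q, hq, hq'⟩ := exists_quot hF.zero
  obtain ⟨r, hr, hr'⟩ := exists_quot hzero
  have hzero'' : ∀ e, e ∈ z.pd.zeroEdges ↔ F''.incl e ∈ x.pd.zeroEdges := fun e => by
    rw [hzero, hF.zero, hi]
  obtain ⟨t, ht, ht'⟩ := exists_quot hzero''
  simp only [hF.sign, hq', hr', ht']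
  rw [sum_sum]
  refine Finset.sum_congr rfl fun u _ => ?_
  obtain ⟨v, rfl⟩ := contractMk_surjective _ u
  rw [ht, hq, hr, hv]

theorem comp (hF : Compat F x y) (hF' : Compat F' y z)
    (hv : ∀ v, F''.vMap v = F'.vMap (F.vMap v)) (hi : ∀ e, F''.incl e = F.incl (F'.incl e)) :
    Compat F'' x z :=
  ⟨fun e => by rw [hF'.zero, hF.zero, hi], fun u => by
    rw [hF'.sign, hF.sign_comp hF'.zero hv hi]⟩

theorem factor (hF : Compat F x y) (hF'' : Compat F'' x z)
    (hv : ∀ v, F''.vMap v = F'.vMap (F.vMap v)) (hi : ∀ e, F''.incl e = F.incl (F'.incl e)) :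
    Compat F' y z := by
  have hz : ∀ e, e ∈ z.pd.zeroEdges ↔ F'.incl e ∈ y.pd.zeroEdges := fun e => by
    rw [hF''.zero, hF.zero, hi]
  exact ⟨hz, fun u => by rw [hF''.sign, hF.sign_comp hz hv hi]⟩

theorem id_iff {F : Specialization G G} (hF : F.IsId) {x y : SpinRoot G} :
    Compat F x y ↔ y.pd.zeroEdges = x.pd.zeroEdges ∧ ∀ v,
      y.sign (G.contractMk y.pd.zeroEdges v) = x.sign (G.contractMk x.pd.zeroEdges v) := by
  have h0 : (∀ e, e ∈ y.pd.zeroEdges ↔ F.incl e ∈ x.pd.zeroEdges) ↔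
      y.pd.zeroEdges = x.pd.zeroEdges := by
    simp only [hF.2]
    exact Set.ext_iff.symm
  have key : ∀ (_ : y.pd.zeroEdges = x.pd.zeroEdges) v,
      (∑ u : (G.contract x.pd.zeroEdges).V,
      if ∃ w : G.V, G.contractMk x.pd.zeroEdges w = u ∧
        G.contractMk y.pd.zeroEdges (F.vMap w) = G.contractMk y.pd.zeroEdges v
        then x.sign u else 0) = x.sign (G.contractMk x.pd.zeroEdges v) := by
    intro hz v
    rw [Finset.sum_eq_single (G.contractMk x.pd.zeroEdges v)]
    · rw [if_pos ⟨v, rfl, by rw [hF.1]⟩]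
    · intro u _ hu
      rw [if_neg]
      rintro ⟨w, rfl, hw⟩
      apply hu
      rw [hF.1, contractMk_eq_iff, hz] at hw
      exact contractMk_eq_iff.2 hw
    · simp
  constructor
  · intro h
    have hz := h0.1 h.zero
    exact ⟨hz, fun v => by rw [h.sign, key hz]⟩
  · rintro ⟨hz, hs⟩
    refine ⟨h0.2 hz, fun u => ?_⟩
    obtain ⟨v, rfl⟩ := contractMk_surjective _ u
    rw [key hz, hs]

theorem id_symm {F : Specialization G G} (hF : F.IsId) {x y : SpinRoot G} (h : Compat F x y) :
    Compat F y x := by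
  rw [id_iff hF] at h ⊢
  exact ⟨h.1.symm, fun v => (h.2 v).symm⟩

/-- The composite to the quotient of `H` by its zero edges contracts all zero edges of `x`, hence
factors through the quotient of `G` by them. -/
theorem weight_le (hzero : ∀ e, e ∈ y.pd.zeroEdges ↔ F.incl e ∈ x.pd.zeroEdges) (v : G.V) :
    (G.contract x.pd.zeroEdges).weight (G.contractMk x.pd.zeroEdges v) ≤
      (H.contract y.pd.zeroEdges).weight (H.contractMk y.pd.zeroEdges (F.vMap v)) := by
  obtain ⟨g, hg, hg'⟩ := F.exists_comp (H.contractSpec y.pd.zeroEdges)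
  have hS : x.pd.zeroEdges ⊆ g.S := by
    intro e he
    rw [g.mem_S_iff]
    rintro ⟨a, rfl⟩
    rw [hg'] at he
    exact a.2 ((hzero a.1).2 he)
  obtain ⟨h, hh, -⟩ := (G.contractSpec x.pd.zeroEdges).exists_factor g hS
  have := h.weight_le (G.contractMk x.pd.zeroEdges v)
  have h1 : h.vMap (G.contractMk x.pd.zeroEdges v) =
      H.contractMk y.pd.zeroEdges (F.vMap v) := (hh v).trans (hg v)
  rwa [h1] at this

end Compat

theorem SpinSpec.compat {x : SpinRoot G} {y : SpinRoot H} (f : SpinSpec x y) :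
    Compat f.base x y :=
  ⟨f.toRootSpec.mem_zeroEdges x.isRoot x.semistable y.isRoot y.semistable, f.push_sign⟩

theorem exists_spinSpec {x : SpinRoot G} {y : SpinRoot H} {F : Specialization G H}
    (hc : Compat F x y) {f : RootSpec x.pd y.pd} (hf : f.base = F) :
    ∃ g : SpinSpec x y, g.toRootSpec = f := by
  subst hf
  exact ⟨⟨f, hc.sign⟩, rfl⟩

/-- A polystable spin root specializes to every compatible spin root. -/
theorem Compat.exists_spinSpec {x : SpinRoot G} {y : SpinRoot H} {F : Specialization G H}
    (hc : Compat F x y) (hx : x.pd.Polystable) : ∃ g : SpinSpec x y, g.base = F := by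
  -- A polystable source is subdivided exactly along its nonzero edges. So every nonzero edge of `y`
  -- has a subdivided edge above it, and only zero flows remain to be matched.
  have hexc : ∀ e, F.incl e ∈ x.pd.exc ↔ e ∉ y.pd.zeroEdges := by
    intro e
    rw [hx.exc_eq x.isRoot, hc.zero]; rfl
  obtain ⟨f, hf, -⟩ := exists_rootSpec x.isRoot x.semistable y.isRoot y.semistable F
    (fun e he => (hexc e).2 (y.isRoot.notMem_zeroEdges y.semistable he))
    (fun e h h' => by
      rw [hexc, not_not, y.isRoot.mem_zeroEdges' y.semistable h false] at h'
      rw [h', hx.flow_kept x.isRoot])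
    (fun e h h' => by
      rw [hexc] at h'
      exact (not_congr (y.isRoot.mem_zeroEdges' y.semistable h false)).1 h')
  obtain ⟨g, rfl⟩ := SpinTrop.exists_spinSpec hc hf
  exact ⟨g, hf⟩

end SpinTrop

end

noncomputable section

namespace SpinTrop

open scoped Classical

open WGraph PseudoDivisor

variable {n : ℕ} {G H K : WGraph n}

/-! ### The polystable representative -/

namespace PDSpec

variable {x z : PseudoDivisor G} (f : PDSpec z x) (hf : f.base.IsId)

include hf

theorem exc_subset {e : G.E} (he : e ∈ x.exc) : e ∈ z.exc := by
  have := f.exc_sub e he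
  rwa [hf.2] at this

theorem below_incl (a : x.sub.E) : G.below z.exc (f.hat.incl a) = G.below x.exc a := by
  rw [f.edge_comm, hf.2]

theorem hat_vtx_id (v : G.V) : f.hat.vMap (vtx z.exc v) = vtx x.exc v := by
  rw [f.hat_vtx, hf.1]

theorem hat_exv {e : G.E} (he : e ∈ x.exc) (hz : e ∈ z.exc) :
    f.hat.vMap (exv e hz) = exv e he := by
  have h1 := f.below_incl hf (half e he false)
  rw [below_half] at h1
  have h2 := fun b => f.hat.vMap_ends_tw (half e he false) b
  generalize f.hat.incl (half e he false) = a at h1 h2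
  induction a using edge_cases with
  | h1 e' he' => rw [below_kept] at h1; subst h1; exact absurd hz he'
  | h2 e' he' b =>
    rw [below_half] at h1
    subst h1
    have h3 := h2 true
    have h4 := h2 false
    rw [ends_half_true] at h3
    rw [ends_half_false, f.hat_vtx_id hf] at h4
    cases h5 : f.hat.tw (half e' he false)
    · simpa [h5] using h3
    · rw [h5] at h4
      simp at h4

/-- Over `e` the target has a single edge, so one of the two halves is contracted and the
exceptional vertex merges with the end there. -/
theorem exists_hat_exv {e : G.E} (he : e ∉ x.exc) (hz : e ∈ z.exc) :
    ∃ b, f.hat.vMap (exv e hz) = vtx x.exc (G.ends e b) := by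
  have key : ∀ b, half e hz b ∈ f.hat.S →
      f.hat.vMap (exv e hz) = vtx x.exc (G.ends e b) := by
    intro b hb
    have := f.hat.vMap_eq_of_mem hb true false
    rwa [ends_half_true, ends_half_false, f.hat_vtx_id hf] at this
  by_cases h0 : half e hz false ∈ f.hat.S
  · exact ⟨_, key _ h0⟩
  by_cases h1 : half e hz true ∈ f.hat.S
  · exact ⟨_, key _ h1⟩
  exfalso
  obtain ⟨a, ha⟩ := f.hat.exists_incl h0
  obtain ⟨a', ha'⟩ := f.hat.exists_incl h1
  have hka : ∀ a : x.sub.E, G.below x.exc a = e → a = kept e he := by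
    intro a
    induction a using edge_cases with
    | h1 e' he' => rintro rfl; rfl
    | h2 e' he' b => rintro rfl; exact absurd he' he
  have h2 := hka a (by rw [← f.below_incl hf, ha]; rfl)
  have h3 := hka a' (by rw [← f.below_incl hf, ha']; rfl)
  rw [h2] at ha
  rw [h3, ha] at ha'
  simp at ha'

theorem D_vtx (v : G.V) : x.D (vtx _ v) = z.D (vtx _ v) + ∑ e : G.E,
    if h : e ∈ z.exc then (if f.hat.vMap (exv e h) = vtx _ v then -1 else 0) else 0 := by
  rw [f.push_D, sum_vert_subdivide]
  simp only [f.hat_vtx_id hf, vtx_inj, D_exv]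
  simp

end PDSpec

theorem beta_pullback_pd {x : PseudoDivisor G} {y : PseudoDivisor H} (f : PDSpec x y)
    (W : Finset y.sub.V) (W' : Finset x.sub.V) (hW : ∀ v, v ∈ W' ↔ f.hat.vMap v ∈ W) :
    x.sub.beta x.muSub x.D W' = y.sub.beta y.muSub y.D W :=
  beta_pullback f.hat x.two_muSub y.two_muSub f.push_D W W' hW

/-- A polystable pseudo-divisor that specializes to a semistable pseudo-root. -/
theorem Polystable_spec {x z : PseudoDivisor G} (f : PDSpec z x) (hf : f.base.IsId)
    (hz : z.Polystable) (hr : x.IsPseudoRoot) (hs : x.Semistable) {e : G.E} (he : e ∉ x.exc)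
    {b : Bool} (hb : 0 < x.flow (kept e he, b)) : ∃ h : e ∈ z.exc,
      f.hat.vMap (exv e h) = vtx _ (G.ends e !b) := by
  obtain ⟨W, h1, h2, h3⟩ := exists_upper hr hs he hb
  let W' : Finset z.sub.V := Finset.univ.filter fun u => f.hat.vMap u ∈ W
  have hW' : ∀ u, u ∈ W' ↔ f.hat.vMap u ∈ W := by simp [W']
  have hv : ∀ v, vtx _ v ∈ W' ↔ vtx _ v ∈ W := fun v => by rw [hW', f.hat_vtx_id hf]
  -- The preimage of the upper set has `β = 0` too. As `z` is polystable, edges across it are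
  -- exceptional and it contains the exceptional vertices next to its vertices; so the vertex on `e`
  -- merges with the upper end.
  rw [← beta_pullback_pd f W W' hW'] at h3
  obtain ⟨h4, h5⟩ := hz.of_beta h3
  have h6 : e ∈ z.exc := h4 e (by
    rw [hv, hv]
    cases b
    · exact Or.inr ⟨h1, h2⟩
    · exact Or.inl ⟨h1, h2⟩)
  refine ⟨h6, ?_⟩
  have h7 := h5 e h6 (!b) ((hv _).2 h1)
  obtain ⟨c, hc⟩ := f.exists_hat_exv hf he h6
  rw [hW', hc] at h7
  rw [hc]
  have : c = !b := by
    by_contra h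
    have : c = b := by cases b <;> cases c <;> simp_all
    exact h2 (this ▸ h7)
  rw [this]

/-- A polystable pseudo-root with the same zero edges that specializes to a semistable
pseudo-root is its polystable representative. -/
theorem isPol_of_polystable {x y : PseudoDivisor G} (hx : x.IsPseudoRoot) (hxs : x.Semistable)
    (hy : y.IsPseudoRoot) (hyp : y.Polystable) (hz : y.zeroEdges = x.zeroEdges)
    (hyx : y.SpecializesTo x) : y.IsPol x := by
  refine ⟨hyp, hyx, fun z hzp ⟨f, hf⟩ => ?_⟩
  obtain ⟨g, hg⟩ := hyx
  have hexc : ∀ e, e ∈ y.exc ↔ e ∉ x.zeroEdges := by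
    intro e; rw [hyp.exc_eq hy, hz]; rfl
  -- The flow of `x` decides with which end the vertex on `e` merges, so `z → x` and `y → x` agree
  -- on it.
  have hsame : ∀ e (_ : e ∈ y.exc) (_ : e ∉ x.exc), ∃ (h : e ∈ z.exc) (h' : e ∈ y.exc),
      f.hat.vMap (exv e h) = g.hat.vMap (exv e h') := by
    intro e he hex
    obtain ⟨b, hb⟩ := exists_pos_of_notMem hx hxs hex ((hexc e).1 he)
    obtain ⟨h, h1⟩ := Polystable_spec f hf hzp hx hxs hex hb
    obtain ⟨h', h2⟩ := Polystable_spec g hg hyp hx hxs hex hb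
    exact ⟨h, h', h1.trans h2.symm⟩
  have hsub : ∀ e ∈ y.exc, e ∈ z.exc := by
    intro e he
    by_cases hex : e ∈ x.exc
    · exact f.exc_subset hf hex
    · exact (hsame e he hex).1
  obtain ⟨F, hF, -⟩ := exists_id G
  -- The specialization `z → y` is to contract the same halves as `z → x`, over the edges that are
  -- not exceptional in `y`. Together with `hsame` this makes the divisor of `z` push forward to
  -- that of `y`.
  have hc : ∀ e, ∃ b, ∀ (_ : e ∉ x.exc) (h : e ∈ z.exc),
      f.hat.vMap (exv e h) = vtx x.exc (G.ends e b) := by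
    intro e
    by_cases hex : e ∈ x.exc
    · exact ⟨false, fun h => absurd hex h⟩
    by_cases hez : e ∈ z.exc
    · obtain ⟨b, hb⟩ := f.exists_hat_exv hf hex hez
      exact ⟨b, fun _ _ => hb⟩
    · exact ⟨false, fun _ h => absurd h hez⟩
  choose c hc using hc
  have hsub' : ∀ e ∈ y.exc, F.incl e ∈ z.exc := fun e he => by rw [hF.2]; exact hsub e he
  obtain ⟨h, h1, -, h3, h4, h5, h6, h7⟩ := F.exists_hat hsub' c
  simp only [hF.1, hF.2] at h1 h3 h4 h5 h6 h7
  have hD : ∀ u, y.D u = ∑ v, if h.vMap v = u then z.D v else 0 := by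
    intro u
    rw [sum_vert_subdivide]
    simp only [D_exv, h1]
    induction u using vert_cases with
    | h1 v =>
      have e1 := f.D_vtx hf v
      rw [g.D_vtx hg v] at e1
      have e2 : (∑ e : G.E,
          if h : e ∈ z.exc then (if f.hat.vMap (exv e h) = vtx _ v then (-1 : ℤ) else 0) else 0) =
        (∑ e : G.E,
          if h : e ∈ y.exc then (if g.hat.vMap (exv e h) = vtx _ v then -1 else 0) else 0) +
        ∑ e : G.E, if h' : e ∈ z.exc then (if h.vMap (exv e h') = vtx _ v then -1 else 0)
          else 0 := by
        rw [← Finset.sum_add_distrib]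
        refine Finset.sum_congr rfl fun e _ => ?_
        by_cases hey : e ∈ y.exc
        · have hez := hsub e hey
          simp only [hey, hez, dif_pos, h3 e hey hez, exv_ne_vtx, if_false, add_zero]
          by_cases hex : e ∈ x.exc
          · rw [f.hat_exv hf hex hez, g.hat_exv hg hex hey]
          · obtain ⟨_, _, h8⟩ := hsame e hey hex
            rw [h8]
        · have hex : e ∉ x.exc := fun hex => hey (g.exc_subset hg hex)
          by_cases hez : e ∈ z.exc
          · simp only [hey, hez, dif_pos, dif_neg, not_false_iff, h4 e hey hez,
              hc e hex hez, vtx_inj, zero_add]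
          · simp [hey, hez]
      have e3 : (∑ w, if vtx y.exc w = vtx y.exc v then z.D (vtx z.exc w) else 0) =
          z.D (vtx _ v) := by simp
      rw [e3]
      linarith
    | h2 e he =>
      have e1 : (∑ w, if vtx y.exc w = exv e he then z.D (vtx z.exc w) else 0) = 0 := by simp
      rw [e1, D_exv, Finset.sum_eq_single e]
      · rw [dif_pos (hsub e he), if_pos (h3 e he (hsub e he))]; simp
      · intro e' _ hne
        by_cases hez : e' ∈ z.exc
        · rw [dif_pos hez, if_neg]
          by_cases hey : e' ∈ y.exc
          · rw [h3 e' hey hez]; simpa using hne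
          · rw [h4 e' hey hez]; simp
        · rw [dif_neg hez]
      · simp
  refine ⟨⟨F, h, hsub', fun v => (h1 v).trans (by rw [hF.1]; rfl), fun a => ?_, hD⟩, hF⟩
  rw [hF.2]
  induction a using edge_cases with
  | h1 e he =>
    by_cases he' : e ∈ z.exc
    · rw [(h6 e he he').1]; rfl
    · rw [(h5 e he he').1]; rfl
  | h2 e he b => rw [(h7 e he (hsub e he) b).1]; rfl

theorem exists_sign {P P' : Set G.E} (h : P' = P) (s : (G.contract P).V → ZMod 2)
    (hs : ∀ u, (G.contract P).weight u = 0 → s u = 0) :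
    ∃ s' : (G.contract P').V → ZMod 2, (∀ u, (G.contract P').weight u = 0 → s' u = 0) ∧
      ∀ v, s' (G.contractMk P' v) = s (G.contractMk P v) := by
  subst h
  exact ⟨s, hs, fun _ => rfl⟩

namespace SpinRoot

/-- The zero edges and the sign functions agree. -/
def Same (y x : SpinRoot G) : Prop :=
  y.pd.zeroEdges = x.pd.zeroEdges ∧ ∀ v,
    y.sign (G.contractMk y.pd.zeroEdges v) = x.sign (G.contractMk x.pd.zeroEdges v)

theorem Same.compat {y x : SpinRoot G} (h : y.Same x) {F : Specialization G G} (hF : F.IsId) :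
    Compat F y x :=
  Compat.id_symm hF ((Compat.id_iff hF).2 h)

theorem Same.compat_left {y x : SpinRoot G} (h : y.Same x) {z : SpinRoot H}
    {F : Specialization G H} (hF : Compat F x z) : Compat F y z := by
  obtain ⟨I, hI, -⟩ := exists_id G
  exact (h.compat hI).comp hF (fun v => by rw [hI.1]) (fun e => by rw [hI.2])

theorem Same.symm {y x : SpinRoot G} (h : y.Same x) : x.Same y :=
  ⟨h.1.symm, fun v => (h.2 v).symm⟩

theorem Same.compat_right {z : SpinRoot G} {y x : SpinRoot H} (h : y.Same x)
    {F : Specialization G H} (hF : Compat F z x) : Compat F z y := by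
  obtain ⟨I, hI, -⟩ := exists_id H
  exact hF.comp (h.symm.compat hI) (fun v => by rw [hI.1]) (fun e => by rw [hI.2])

theorem ext_of_pd {x y : SpinRoot G} (h : x.pd = y.pd)
    (hs : ∀ v, x.sign (G.contractMk _ v) = y.sign (G.contractMk _ v)) : x = y := by
  obtain ⟨a, b, c, s, d⟩ := x
  obtain ⟨a', b', c', s', d'⟩ := y
  obtain rfl : a = a' := h
  have : s = s' := by
    funext u
    obtain ⟨v, rfl⟩ := contractMk_surjective _ u
    exact hs v
  subst this
  rfl

/-- The parity condition that `x` satisfies for the complement of its zero edges is all that a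
polystable root subdivided along this complement requires. -/
theorem exists_polystable (x : SpinRoot G) : ∃ y : SpinRoot G, y.pd.Polystable ∧ y.Same x := by
  obtain ⟨y, h1, h2, h3⟩ := PseudoDivisor.exists_polystable (x.isRoot.even x.semistable)
  have hz : y.zeroEdges = x.pd.zeroEdges := by rw [h3.zeroEdges_eq h2, h1, compl_compl]
  obtain ⟨s, hs, hs'⟩ := exists_sign hz x.sign x.sign_eq_zero
  exact ⟨⟨y, h2, h3.semistable, s, hs⟩, h3, hz, hs'⟩

theorem Same.exists_spinSpec {y x : SpinRoot G} (h : y.Same x) (hy : y.pd.Polystable) :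
    ∃ f : SpinSpec y x, f.base.IsId := by
  obtain ⟨I, hI, -⟩ := exists_id G
  obtain ⟨f, rfl⟩ := (h.compat hI).exists_spinSpec hy
  exact ⟨f, hI⟩

end SpinRoot

theorem IsSpinPol.of_same {y x : SpinRoot G} (hy : y.pd.Polystable) (h : y.Same x) :
    IsSpinPol y x := by
  obtain ⟨f, hf⟩ := h.exists_spinSpec hy
  exact ⟨isPol_of_polystable x.isRoot x.semistable y.isRoot hy h.1 ⟨f.toPDSpec, hf⟩, h.2⟩

/-- Two minimal polystable representatives specialize to each other, so they have the same
exceptional edges, and these determine a polystable root. -/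
theorem IsSpinPol.same {y x : SpinRoot G} (h : IsSpinPol y x) : y.Same x := by
  obtain ⟨y₀, h1, h2⟩ := x.exists_polystable
  have h3 := (IsSpinPol.of_same h1 h2).1
  have h4 : y.pd.exc = y₀.pd.exc := by
    obtain ⟨f, hf⟩ := h.1.2.2 _ h3.1 h3.2.1
    obtain ⟨g, hg⟩ := h3.2.2 _ h.1.1 h.1.2.1
    exact Set.Subset.antisymm (fun e he => f.exc_subset hf he) fun e he => g.exc_subset hg he
  have h5 : y.pd = y₀.pd := h.1.1.ext y.isRoot h1 y₀.isRoot h4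
  exact ⟨by rw [h5, h2.1], h.2⟩

theorem isSpinPol_iff {y x : SpinRoot G} : IsSpinPol y x ↔ y.pd.Polystable ∧ y.Same x :=
  ⟨fun h => ⟨h.1.1, h.same⟩, fun h => IsSpinPol.of_same h.1 h.2⟩

theorem existsUnique_spinPol (x : SpinRoot G) : ∃! y : SpinRoot G, IsSpinPol y x := by
  obtain ⟨y, h1, h2⟩ := x.exists_polystable
  refine ⟨y, IsSpinPol.of_same h1 h2, fun z hz => ?_⟩
  obtain ⟨h3, h4⟩ := isSpinPol_iff.1 hz
  refine SpinRoot.ext_of_pd (h3.ext z.isRoot h1 y.isRoot ?_) fun v => (h4.2 v).trans (h2.2 v).symm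
  rw [h3.exc_eq z.isRoot, h1.exc_eq y.isRoot, h4.1, h2.1]

end SpinTrop

end

noncomputable section

namespace SpinTrop

open scoped Classical

open WGraph PseudoDivisor

variable {n : ℕ} {G H K : WGraph n}

/-! ### Points of the cones and lengths of edges -/

namespace PseudoDivisor

variable {x : PseudoDivisor G}

/-- The slope of the potential along an edge that is not exceptional. -/
theorem IsPotential.sub_eq (hr : x.IsPseudoRoot) {p : x.sub.E → ℝ} {f : G.V → ℝ}
    (hf : x.IsPotential p f) (e : G.E) (h : e ∉ x.exc) (b : Bool) :
    f (G.ends e !b) - f (G.ends e b) = x.flow (kept e h, b) * len x.exc p e := by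
  rw [len_of_notMem p h]
  cases b
  · exact (hf.2 e h).symm
  · have := hf.2 e h
    rw [hr.flow.1 (kept e h)]
    push_cast
    change f (G.ends e false) - _ = _
    linarith

theorem abs_sub_le' {f : G.V → ℝ} {l : G.E → ℝ}
    (h : ∀ e, |f (G.ends e true) - f (G.ends e false)| ≤ l e) (e : G.E) (b : Bool) :
    f (G.ends e !b) - f (G.ends e b) ≤ l e := by
  have := abs_le.1 (h e)
  cases b
  · exact this.2
  · change f (G.ends e false) - _ ≤ _
    linarith

/-- The potentials of points of quasistable pseudo-roots are determined by the lengths of the edges: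
they are distances from the base point. The comparison is along a specialization. -/
theorem potential_eq {y : PseudoDivisor H} {F : Specialization G H} {v₀ : G.V}
    (hr : x.IsPseudoRoot) (hq : x.Quasistable v₀) (hr' : y.IsPseudoRoot)
    (hq' : y.Quasistable (F.vMap v₀)) (hz : ∀ e, e ∈ y.zeroEdges ↔ F.incl e ∈ x.zeroEdges)
    {p : x.sub.E → ℝ} {q : y.sub.E → ℝ} (hp : ∀ a, 0 ≤ p a) (hp' : ∀ a, 0 ≤ q a)
    {f : G.V → ℝ} {g : H.V → ℝ} (hf : x.IsPotential p f) (hg : y.IsPotential q g)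
    (hl : len x.exc p = F.ext (len y.exc q)) (v : G.V) :
    f v - f v₀ = g (F.vMap v) - g (F.vMap v₀) := by
  have hfS : ∀ e ∈ F.S, f (G.ends e false) = f (G.ends e true) := by
    intro e he
    have := hf.abs_sub_le hr hq.1 hp e
    rw [hl, F.ext_mem he] at this
    have := abs_nonpos_iff.1 this
    linarith
  have hlip : ∀ e b, f (G.ends e !b) - f (G.ends e b) ≤ len x.exc p e :=
    abs_sub_le' (hf.abs_sub_le hr hq.1 hp)
  have hlip' : ∀ e b, g (H.ends e !b) - g (H.ends e b) ≤ len y.exc q e :=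
    abs_sub_le' (hg.abs_sub_le hr' hq'.1 hp')
  apply le_antisymm
  -- Follow the flow of `y` from the base point. Where it is `1`, `g` rises by the full length and
  -- `f` by at most that; where it is `0`, both are constant because zero edges correspond.
  · have key := hq'.closed hr' (T := {u | ∀ v, F.vMap v = u →
      f v - f v₀ ≤ g u - g (F.vMap v₀)}) (by
        intro v hv
        have : f v = f v₀ := eq_of_connSetoid hfS (F.vMap_eq_iff.1 hv)
        simp [this]) (by
        intro e h b hb hu v hv
        have h1 : F.vMap (G.ends (F.incl e) (xor b (F.tw e))) = H.ends e b := by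
          rw [F.vMap_ends_tw]; simp
        have h2 : F.vMap (G.ends (F.incl e) !(xor b (F.tw e))) = H.ends e !b := by
          rw [F.vMap_ends_tw]
          cases b <;> cases F.tw e <;> rfl
        have h3 := hu _ h1
        have h4 : f v = f (G.ends (F.incl e) !(xor b (F.tw e))) :=
          eq_of_connSetoid hfS (F.vMap_eq_iff.1 (hv.trans h2.symm))
        have h5 := hg.sub_eq hr' e h b
        rw [h4]
        obtain h6 | h6 : y.flow (kept e h, b) = 0 ∨ y.flow (kept e h, b) = 1 := by
          have := hr'.flow_le_one hq'.1 (kept e h, b)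
          omega
        · have h7 : F.incl e ∈ x.zeroEdges := by
            rw [← hz, hr'.mem_zeroEdges' hq'.1 h b]; exact h6
          have h8 := hf.eq_of_zero hr hq.1 h7
          have h9 : f (G.ends (F.incl e) !(xor b (F.tw e))) =
              f (G.ends (F.incl e) (xor b (F.tw e))) := by
            cases xor b (F.tw e) <;> simp [h8]
          rw [h6] at h5
          push_cast at h5
          linarith
        · have h7 := hlip (F.incl e) (xor b (F.tw e))
          rw [hl, F.ext_incl] at h7
          rw [h6] at h5
          push_cast at h5
          linarith) (F.vMap v)
    exact key v rfl
  -- The same with the roles exchanged, following the flow of `x`; edges contracted by `F` have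
  -- length zero and change neither function.
  · exact hq.closed hr (T := {v | g (F.vMap v) - g (F.vMap v₀) ≤ f v - f v₀}) (by
      simp) (by
      intro e h b hb hu
      rw [Set.mem_ofPred_eq] at hu ⊢
      by_cases hS : e ∈ F.S
      · have h1 := F.vMap_eq_of_mem hS (!b) b
        have h2 : f (G.ends e !b) = f (G.ends e b) := by cases b <;> simp [hfS e hS]
        rwa [h1, h2]
      · obtain ⟨e', rfl⟩ := F.exists_incl hS
        have h5 := hf.sub_eq hr _ h b
        rw [F.vMap_ends_tw] at hu ⊢
        have hb' : xor (!b) (F.tw e') = !(xor b (F.tw e')) := by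
          cases b <;> cases F.tw e' <;> rfl
        rw [hb']
        obtain h6 | h6 : x.flow (kept (F.incl e') h, b) = 0 ∨
            x.flow (kept (F.incl e') h, b) = 1 := by
          have := hr.flow_le_one hq.1 (kept (F.incl e') h, b)
          omega
        · have h7 : e' ∈ y.zeroEdges := by
            rw [hz, hr.mem_zeroEdges' hq.1 h b]; exact h6
          have h8 := hg.eq_of_zero hr' hq'.1 h7
          have h9 : g (H.ends e' !(xor b (F.tw e'))) = g (H.ends e' (xor b (F.tw e'))) := by
            cases xor b (F.tw e') <;> simp [h8]
          rw [h6] at h5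
          push_cast at h5
          linarith
        · have h7 := hlip' e' (xor b (F.tw e'))
          rw [hl, F.ext_incl, h6] at h5
          push_cast at h5
          linarith) v

/-- Points of the cone of a quasistable pseudo-root are determined by the lengths. -/
theorem len_injOn {v₀ : G.V} (hr : x.IsPseudoRoot) (hq : x.Quasistable v₀) :
    Set.InjOn (len x.exc) x.lam := by
  intro p hp q hp' h
  obtain ⟨hp0, f, hf⟩ := (hr.mem_lam_iff hq.1).1 hp
  obtain ⟨hq0, g, hg⟩ := (hr.mem_lam_iff hq.1).1 hp'
  obtain ⟨I, hI, hIS⟩ := exists_id G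
  have hext : I.ext (len x.exc q) = len x.exc q := by
    funext e
    have := I.ext_incl e (len x.exc q)
    rwa [hI.2] at this
  have key : ∀ v, f v - f v₀ = g v - g v₀ := by
    intro v
    have := potential_eq (F := I) hr hq hr (by rwa [hI.1]) (fun e => by rw [hI.2]) hp0 hq0 hf hg
      (by rw [hext, h]) v
    rwa [hI.1, hI.1] at this
  funext a
  have hlen := fun e => congrFun h e
  induction a using edge_cases with
  | h1 e he =>
    have := hlen e
    rwa [len_of_notMem p he, len_of_notMem q he] at this
  | h2 e he b =>
    -- The sum of the two halves is the length and their difference is given by the potential.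
    have h1 := hlen e
    rw [len_of_mem p he, len_of_mem q he] at h1
    have h2 := hf.1 e he
    have h3 := hg.1 e he
    have h4 := key (G.ends e true)
    have h5 := key (G.ends e false)
    cases b <;> linarith

end PseudoDivisor

theorem WGraph.Specialization.IsId.ext_eq {I : Specialization G G} (hI : I.IsId) (l : G.E → ℝ) :
    I.ext l = l := by
  funext e
  have := I.ext_incl e l
  rwa [hI.2] at this

theorem WGraph.Specialization.ext_injective (F : Specialization G H) :
    Function.Injective F.ext := by
  intro p q h
  funext a
  rw [← F.ext_incl a p, h, F.ext_incl]

/-- The flows of two quasistable pseudo-roots with points with the same lengths, the second one in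
the open cone. -/
theorem flow_of_len {x : PseudoDivisor G} {y : PseudoDivisor H} {F : Specialization G H} {v₀ : G.V}
    (hr : x.IsPseudoRoot) (hq : x.Quasistable v₀) (hr' : y.IsPseudoRoot)
    (hq' : y.Quasistable (F.vMap v₀)) (hz : ∀ e, e ∈ y.zeroEdges ↔ F.incl e ∈ x.zeroEdges)
    {p : x.sub.E → ℝ} {q : y.sub.E → ℝ} (hp : p ∈ x.lam) (hp' : q ∈ y.lamOpen)
    (hl : len x.exc p = F.ext (len y.exc q)) :
    (∀ e ∈ y.exc, F.incl e ∈ x.exc) ∧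
    (∀ e (h : e ∉ y.exc) (h' : F.incl e ∉ x.exc),
      y.flow (kept e h, false) = x.flow (kept (F.incl e) h', F.tw e)) := by
  obtain ⟨hp0, f, hf⟩ := (hr.mem_lam_iff hq.1).1 hp
  obtain ⟨hq0, g, hg⟩ := (hr'.mem_lam_iff hq'.1).1 hp'.1
  have key := potential_eq hr hq hr' hq' hz hp0 hq0 hf hg hl
  have hdiff : ∀ e b, f (G.ends (F.incl e) !b) - f (G.ends (F.incl e) b) =
      g (H.ends e !(xor b (F.tw e))) - g (H.ends e (xor b (F.tw e))) := by
    intro e b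
    have h1 := key (G.ends (F.incl e) !b)
    have h2 := key (G.ends (F.incl e) b)
    rw [F.vMap_ends_tw] at h1 h2
    have hb' : xor (!b) (F.tw e) = !(xor b (F.tw e)) := by
      cases b <;> cases F.tw e <;> rfl
    rw [hb'] at h1
    linarith
  have hlen : ∀ e, len x.exc p (F.incl e) = len y.exc q e := fun e => by
    rw [hl, F.ext_incl]
  have hpos : ∀ e, 0 < len y.exc q e := len_pos hp'.2
  constructor
  · intro e he
    -- Unsubdivided in `x` and of nonzero flow, the edge would change the potential by its full
    -- length; two positive halves change it by strictly less.
    by_contra hx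
    have hne : F.incl e ∉ x.zeroEdges := fun h =>
      hr'.notMem_zeroEdges hq'.1 he ((hz e).2 h)
    obtain ⟨b, hb⟩ := exists_pos_of_notMem hr hq.1 hx hne
    have h1 : x.flow (kept _ hx, b) = 1 := by
      have := hr.flow_le_one hq.1 (kept _ hx, b)
      omega
    have h2 := hf.sub_eq hr _ hx b
    rw [h1, hdiff, hlen, len_of_mem q he] at h2
    have h3 := hg.1 e he
    have h4 := hp'.2 (half e he false)
    have h5 := hp'.2 (half e he true)
    push_cast at h2
    rcases hb' : xor b (F.tw e) with _ | _ <;> rw [hb'] at h2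
    · change g (H.ends e true) - g (H.ends e false) = _ at h2
      linarith
    · change g (H.ends e false) - g (H.ends e true) = _ at h2
      linarith
  · intro e h h'
    have h1 := hf.sub_eq hr _ h' (F.tw e)
    have h2 := hg.sub_eq hr' _ h false
    rw [hdiff, hlen] at h1
    rw [Bool.xor_self] at h1
    have h3 := h2.symm.trans h1
    have h4 := mul_right_cancel₀ (hpos e).ne' h3
    exact_mod_cast h4

/-- A point of the cone of a quasistable spin root comes from the open cone of a specialization, as
soon as the lengths of the edges do. -/
theorem Compat.exists_spinSpec_of_len {x : SpinRoot G} {y : SpinRoot H} {F : Specialization G H}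
    (hc : Compat F x y) {v₀ : G.V} (hq : x.pd.Quasistable v₀)
    (hq' : y.pd.Quasistable (F.vMap v₀)) {p : x.pd.sub.E → ℝ} {q : y.pd.sub.E → ℝ}
    (hp : p ∈ x.pd.lam) (hp' : q ∈ y.pd.lamOpen)
    (hl : len x.pd.exc p = F.ext (len y.pd.exc q)) :
    ∃ f : SpinSpec x y, f.hat.ext q = p := by
  obtain ⟨h1, h2⟩ := flow_of_len x.isRoot hq y.isRoot hq' hc.zero hp hp' hl
  obtain ⟨f, hf, -⟩ := exists_rootSpec x.isRoot x.semistable y.isRoot y.semistable F h1 h2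
    (fun e h h' => by
      intro h0
      have h3 := (y.isRoot.mem_zeroEdges' y.semistable h false).2 h0
      exact x.isRoot.notMem_zeroEdges x.semistable h' ((hc.zero e).1 h3))
  obtain ⟨g, rfl⟩ := SpinTrop.exists_spinSpec hc hf
  refine ⟨g, len_injOn x.isRoot hq (g.ext_mem_lam y.isRoot hp'.1) hp ?_⟩
  rw [g.len_ext, hl, hf]

/-- Quasistable pseudo-roots on a graph are determined by their zero edges and the lengths of
a point of the open cone. -/
theorem eq_of_len {x y : PseudoDivisor G} {v₀ : G.V} (hr : x.IsPseudoRoot) (hq : x.Quasistable v₀)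
    (hr' : y.IsPseudoRoot) (hq' : y.Quasistable v₀) (hz : y.zeroEdges = x.zeroEdges)
    {p : x.sub.E → ℝ} {q : y.sub.E → ℝ} (hp : p ∈ x.lamOpen) (hp' : q ∈ y.lamOpen)
    (hl : len x.exc p = len y.exc q) : x = y := by
  obtain ⟨I, hI, -⟩ := exists_id G
  obtain ⟨h1, -⟩ := flow_of_len (F := I) hr hq hr' (by rwa [hI.1])
    (fun e => by rw [hI.2, hz]) hp.1 hp' (by rw [hI.ext_eq, hl])
  obtain ⟨h3, -⟩ := flow_of_len (F := I) hr' hq' hr (by rwa [hI.1])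
    (fun e => by rw [hI.2, hz]) hp'.1 hp (by rw [hI.ext_eq, hl])
  simp only [hI.2] at h1 h3
  refine hr.ext hq.1 hr' hq'.1 (Set.Subset.antisymm h3 h1) fun e h h' => ?_
  obtain ⟨hp0, f, hf⟩ := (hr.mem_lam_iff hq.1).1 hp.1
  obtain ⟨hq0, g, hg⟩ := (hr'.mem_lam_iff hq'.1).1 hp'.1
  have key := potential_eq (F := I) hr hq hr' (by rwa [hI.1]) (fun e => by rw [hI.2, hz]) hp0 hq0
    hf hg (by rw [hI.ext_eq, hl])
  simp only [hI.1] at key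
  have h4 := hf.sub_eq hr e h false
  have h5 := hg.sub_eq hr' e h' false
  have h6 := key (G.ends e !false)
  have h7 := key (G.ends e false)
  have h8 : (x.flow (kept e h, false) : ℝ) * len x.exc p e =
      y.flow (kept e h', false) * len x.exc p e := by
    have := congrFun hl e
    rw [← h4, this, ← h5]
    linarith
  exact_mod_cast mul_right_cancel₀ (len_pos hp.2 e).ne' h8

/-! ### Existence of quasistable roots -/

/-- The distance function from `v₀`, as a maximal function of Lipschitz constant one. -/
theorem exists_distance (hG : G.b0 = 1) (l : G.E → ℝ) (hl : ∀ e, 0 ≤ l e) (v₀ : G.V) :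
    ∃ f : G.V → ℝ, (∀ e, |f (G.ends e true) - f (G.ends e false)| ≤ l e) ∧
      ∀ T : Set G.V, v₀ ∈ T → (∀ e b, f (G.ends e !b) - f (G.ends e b) = l e →
        G.ends e b ∈ T → G.ends e (!b) ∈ T) → ∀ v, v ∈ T := by
  let X : Set (G.V → ℝ) := {f | f v₀ = 0 ∧ ∀ e, |f (G.ends e true) - f (G.ends e false)| ≤ l e}
  have hconn : ∀ u v, G.connSetoid Set.univ u v := by
    intro u v
    have : Subsingleton (Quotient (G.connSetoid Set.univ)) := by
      have := Nat.card_eq_one_iff_unique.1 hG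
      exact this.1
    exact Quotient.exact (Subsingleton.elim (Quotient.mk _ u) (Quotient.mk _ v))
  have hbdd : ∀ v, ∃ C, ∀ f ∈ X, |f v| ≤ C := by
    intro v
    have key : ∀ u w, G.connSetoid Set.univ u w → ∃ C, ∀ f ∈ X, |f w - f u| ≤ C := by
      intro u w huw
      refine connSetoid_le ⟨fun u w => ∃ C, ∀ f ∈ X, |f w - f u| ≤ C, ?_, ?_, ?_⟩ ?_ huw
      · exact fun u => ⟨0, by simp⟩
      · rintro u w ⟨C, hC⟩
        exact ⟨C, fun f hf => by rw [abs_sub_comm]; exact hC f hf⟩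
      · rintro u v w ⟨C, hC⟩ ⟨C', hC'⟩
        refine ⟨C' + C, fun f hf => ?_⟩
        exact (abs_sub_le _ (f v) _).trans (add_le_add (hC' f hf) (hC f hf))
      · exact fun e _ => ⟨l e, fun f hf => hf.2 e⟩
    obtain ⟨C, hC⟩ := key v₀ v (hconn _ _)
    refine ⟨C, fun f hf => ?_⟩
    have := hC f hf
    rwa [hf.1, sub_zero] at this
  choose C hC using hbdd
  have hcl : IsClosed X := by
    have h1 : X = {f | f v₀ = 0} ∩ ⋂ e, {f | |f (G.ends e true) - f (G.ends e false)| ≤ l e} := by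
      ext f; simp [X]
    rw [h1]
    refine IsClosed.inter (isClosed_eq (by fun_prop) (by fun_prop)) (isClosed_iInter fun e => ?_)
    exact isClosed_le (by fun_prop) (by fun_prop)
  have hcpt : IsCompact X := by
    refine IsCompact.of_isClosed_subset (isCompact_univ_pi fun v => isCompact_Icc
      (a := -C v) (b := C v)) hcl ?_
    intro f hf v _
    exact abs_le.1 (hC v f hf)
  have hne : X.Nonempty := ⟨0, rfl, fun e => by simpa using hl e⟩
  -- Connectedness and the value `0` at `v₀` make the Lipschitz functions a compact set; the
  -- distance function is found as one with the largest sum of values.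
  obtain ⟨f, hf, hmax⟩ := hcpt.exists_isMaxOn hne
    (f := fun f => ∑ v, f v) (by fun_prop)
  refine ⟨f, hf.2, fun T h0 hT => ?_⟩
  by_contra hne
  push Not at hne
  obtain ⟨w, hw⟩ := hne
  have hle := abs_sub_le' hf.2
  -- If `T` is not everything, no edge leaving `T` is tight, and `f` can be raised by a uniform `ε`
  -- off `T`, against maximality.
  obtain ⟨ε, hε, hε'⟩ : ∃ ε : ℝ, 0 < ε ∧ ∀ d : G.Dart,
      G.ends d.1 d.2 ∈ T → G.ends d.1 (!d.2) ∉ T →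
        f (G.ends d.1 !d.2) - f (G.ends d.1 d.2) + ε ≤ l d.1 := by
    let s : G.Dart → ℝ := fun d => if G.ends d.1 d.2 ∈ T ∧ G.ends d.1 (!d.2) ∉ T then
      l d.1 - (f (G.ends d.1 !d.2) - f (G.ends d.1 d.2)) else 1
    have hs : ∀ d, 0 < s d := by
      intro d
      simp only [s]
      split_ifs with h
      · refine sub_pos.2 (lt_of_le_of_ne (hle d.1 d.2) fun h' => h.2 (hT _ _ h' h.1))
      · exact one_pos
    by_cases hd : Nonempty G.Dart
    · obtain ⟨d₀, hd₀⟩ := Finite.exists_min s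
      refine ⟨s d₀, hs d₀, fun d h1 h2 => ?_⟩
      have h3 := hd₀ d
      simp only [s, if_pos (And.intro h1 h2)] at h3 ⊢
      linarith
    · exact ⟨1, one_pos, fun d => absurd ⟨d⟩ hd⟩
  let f' : G.V → ℝ := fun v => if v ∈ T then f v else f v + ε
  have hf' : f' ∈ X := by
    refine ⟨by simp [f', h0, hf.1], fun e => ?_⟩
    have h1 := hε' (e, false)
    have h2 := hε' (e, true)
    have h3 := abs_le.1 (hf.2 e)
    simp only [Bool.not_false, Bool.not_true] at h1 h2
    rw [abs_le]
    by_cases ht : G.ends e true ∈ T <;> by_cases hf : G.ends e false ∈ T <;>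
      simp only [f', ht, hf, if_true, if_false] <;> simp only [ht, hf, not_true, not_false_iff,
        true_imp_iff, false_imp_iff] at h1 h2 <;> constructor <;> linarith
  have h1 := hmax hf'
  have h2 : ∑ v, f v < ∑ v, f' v := by
    refine Finset.sum_lt_sum (fun v _ => ?_) ⟨w, Finset.mem_univ _, ?_⟩
    · simp only [f']
      split_ifs <;> linarith
    · simp only [f', if_neg hw]
      linarith
  exact absurd h1 (not_le.2 h2)

/-- For given lengths there is a quasistable pseudo-root with given zero edges and a point of its
open cone with these lengths. -/
theorem exists_quasistable (hG : G.b0 = 1) {P : Set G.E}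
    (hpar : ∀ v, Even (G.canonical v + G.degIn Pᶜ v)) {l : G.E → ℝ} (hl : ∀ e, 0 < l e)
    (v₀ : G.V) : ∃ x : PseudoDivisor G, x.IsPseudoRoot ∧ x.Quasistable v₀ ∧ x.zeroEdges = P ∧
      ∃ p ∈ x.lamOpen, len x.exc p = l := by
  -- Shrinking the edges of `P` to length zero forces the distance function to be constant along
  -- them.
  let l' : G.E → ℝ := fun e => if e ∈ P then 0 else l e
  obtain ⟨f, hf, hT⟩ := exists_distance hG l'
    (fun e => by simp only [l']; split_ifs; exacts [le_rfl, (hl e).le]) v₀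
  -- Outside `P` a nonexceptional edge must have slope `±1`; all edges with smaller slope have to be
  -- subdivided.
  let A : Set G.E := {e | e ∉ P ∧ |f (G.ends e true) - f (G.ends e false)| < l e}
  let φ : G.Dart → ℤ := fun d => if d.1 ∈ P then 0 else
    if f (G.ends d.1 !d.2) - f (G.ends d.1 d.2) = l d.1 then 1 else
    if f (G.ends d.1 !d.2) - f (G.ends d.1 d.2) = -l d.1 then -1 else 0
  have hφ : G.IsFlow φ := by
    intro e
    simp only [φ, Bool.not_true, Bool.not_false]
    by_cases he : e ∈ P
    · simp [he]
    have h0 := hl e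
    simp only [he, if_false]
    by_cases h1 : f (G.ends e true) - f (G.ends e false) = l e
    · rw [if_pos h1, if_neg (by linarith), if_pos (by linarith)]
    · by_cases h2 : f (G.ends e true) - f (G.ends e false) = -l e
      · rw [if_neg h1, if_pos h2, if_pos (by linarith)]; rfl
      · rw [if_neg h1, if_neg h2, if_neg (fun h => h2 (by linarith)),
          if_neg (fun h => h1 (by linarith))]; rfl
  have hφ' : ∀ d, φ d = -1 ∨ φ d = 0 ∨ φ d = 1 := by
    intro d
    simp only [φ]
    split_ifs <;> simp
  have hAφ : ∀ e, e ∉ P → e ∉ A → ∀ b, φ (e, b) ≠ 0 := by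
    intro e he hA b
    have h1 : |f (G.ends e true) - f (G.ends e false)| = l e := by
      have h2 := hf e
      simp only [l', if_neg he] at h2
      by_contra h3
      exact hA ⟨he, lt_of_le_of_ne h2 h3⟩
    simp only [φ, if_neg he]
    have h0 := hl e
    have h4 : f (G.ends e !b) - f (G.ends e b) = l e ∨ f (G.ends e !b) - f (G.ends e b) = -l e := by
      rcases abs_eq h0.le |>.1 h1 with h2 | h2 <;> cases b
      · exact Or.inl h2
      · exact Or.inr (by change f (G.ends e false) - _ = _; linarith)
      · exact Or.inr h2
      · exact Or.inl (by change f (G.ends e false) - _ = _; linarith)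
    rcases h4 with h2 | h2
    · rw [if_pos h2]; norm_num
    · rw [if_neg (by linarith), if_pos h2]; norm_num
  obtain ⟨D, hD⟩ := exists_divisor (t := fun d => if d.1 ∈ A then -1 else φ d) (Q := Pᶜ)
    (fun d => by
      split_ifs
      · simp
      · exact hφ' d)
    (fun d => by
      by_cases hA : d.1 ∈ A
      · rw [if_pos hA]
        simp only [ne_eq, neg_eq_zero, one_ne_zero, not_false_iff, true_iff]
        exact hA.1
      · rw [if_neg hA]
        constructor
        · intro h hP
          apply h
          simp only [φ, if_pos hP]
        · intro h
          exact hAφ d.1 h hA d.2) hpar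
  -- The two halves of an edge of `A` solve: sum `l e`, difference the change of `f`. They are
  -- positive because the slope is less than one.
  let p : (G.subdivide A).E → ℝ := fun a => Sum.elim (fun e => l e.1) (fun q =>
    (l q.1.1 + f (G.ends q.1.1 !q.2) - f (G.ends q.1.1 q.2)) / 2) a
  have hp1 : ∀ e (h : e ∉ A), p (kept e h) = l e := fun _ _ => rfl
  have hp2 : ∀ e (h : e ∈ A) b, p (half e h b) =
    (l e + f (G.ends e !b) - f (G.ends e b)) / 2 := fun _ _ _ => rfl
  have hp : ∀ a, 0 < p a := by
    intro a
    induction a using edge_cases with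
    | h1 e h => exact hl e
    | h2 e h b =>
      rw [hp2]
      have := abs_lt.1 h.2
      cases b
      · change 0 < (l e + f (G.ends e true) - f (G.ends e false)) / 2
        linarith
      · change 0 < (l e + f (G.ends e false) - f (G.ends e true)) / 2
        linarith
  have hφl : ∀ e, e ∉ A → ∀ b, (φ (e, b) : ℝ) * l e = f (G.ends e !b) - f (G.ends e b) := by
    intro e he b
    simp only [φ]
    have h2 := hf e
    by_cases hP : e ∈ P
    · simp only [l', if_pos hP] at h2 ⊢
      have h3 := abs_nonpos_iff.1 h2
      have : f (G.ends e !b) - f (G.ends e b) = 0 := by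
        cases b
        · exact h3
        · change f (G.ends e false) - _ = _
          linarith
      rw [this]; simp
    · have h3 := hAφ e hP he b
      simp only [φ, if_neg hP] at h3 ⊢
      split_ifs at h3 ⊢ with h4 h5
      · rw [h4]; simp
      · rw [h5]; simp
      · exact absurd rfl h3
  obtain ⟨hr, hs, hfl, hpl⟩ := root_ofFun (A := A) (D := D) hφ
    (fun d => by rcases hφ' d with h | h | h <;> omega) (fun v => by convert hD v) hp (f := f)
    (fun e h => by
      rw [hp2, hp2]
      change (l e + f (G.ends e true) - f (G.ends e false)) / 2 -
        (l e + f (G.ends e false) - f (G.ends e true)) / 2 = _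
      ring)
    (fun e h => hφl e h false)
  have hz : (ofFun A D).zeroEdges = P := by
    ext e
    rw [hr.mem_zeroEdges hs]
    constructor
    · rintro ⟨h, h'⟩
      by_contra hP
      rw [hfl] at h'
      exact hAφ e hP h false h'
    · intro hP
      have h : e ∉ A := fun h => h.1 hP
      refine ⟨h, ?_⟩
      rw [hfl]
      change φ (e, false) = 0
      simp only [φ, if_pos hP]
  refine ⟨ofFun A D, hr, ⟨hs, fun W hW h0 => ?_⟩, hz, p, hpl, ?_⟩
  · by_contra hβ
    push Not at hβ
    -- A set with `β ≤ 0` has flow `1` into it, so it is left only along flow `-1`. Tight edges and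
    -- edges into exceptional vertices never leave it; starting from `v₀`, it is everything.
    have hin : ∀ d, (ofFun A D).flow d ≠ -1 → (ofFun A D).sub.src d ∈ W →
        (ofFun A D).sub.tgt d ∈ W := by
      intro d hd h1
      by_contra h2
      have := flow_eq_one_of_beta hr.flow.1 hr.flow.2.1 hr.flow.eq_real hs hβ (d := rev d)
        (by simpa using h2) (by simpa using h1)
      rw [hr.flow_rev] at this
      omega
    have hall : ∀ v, v ∈ {v | vtx A v ∈ W} := by
      refine hT _ h0 fun e b he hb => ?_
      rw [Set.mem_ofPred_eq] at hb ⊢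
      have hA : e ∉ A := by
        intro hA
        have h1 := abs_lt.1 hA.2
        simp only [l', if_neg hA.1] at he
        cases b
        · change f (G.ends e true) - _ = _ at he
          linarith
        · change f (G.ends e false) - _ = _ at he
          linarith
      refine hin (kept e hA, b) ?_ hb
      rw [hfl]
      change φ (e, b) ≠ -1
      intro h1
      have h2 := hφl e hA b
      rw [h1, he] at h2
      have h3 := hl e
      simp only [l'] at h2
      push_cast at h2
      split_ifs at h2 <;> linarith
    apply hW
    refine Finset.eq_univ_iff_forall.2 fun u => ?_
    induction u using vert_cases with
    | h1 v => exact hall v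
    | h2 e he =>
      refine hin (half e he false, false) ?_ (hall _)
      rw [hr.flow_half hs]
      norm_num
  · funext e
    by_cases h : e ∈ A
    · rw [len_of_mem p h, hp2, hp2]
      change (l e + f (G.ends e true) - f (G.ends e false)) / 2 +
        (l e + f (G.ends e false) - f (G.ends e true)) / 2 = _
      ring
    · rw [len_of_notMem p h, hp1]

/-- The canonical divisor pushes forward, and a contracted edge contributes an even number to the
degrees over a vertex. -/
theorem even_push {x : PseudoDivisor G} (hr : x.IsPseudoRoot) (hs : x.Semistable)
    (F : Specialization G H) {P : Set H.E} (hP : ∀ e, e ∈ P ↔ F.incl e ∈ x.zeroEdges) (u : H.V) :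
    Even (H.canonical u + H.degIn Pᶜ u) := by
  have h1 := F.sum_degIn x.zeroEdgesᶜ u
  have h2 : F.incl ⁻¹' x.zeroEdgesᶜ = Pᶜ := by
    ext e; simp [hP]
  rw [h2] at h1
  have h3 : Even (H.canonical u +
      ((∑ v, if F.vMap v = u then G.degIn x.zeroEdgesᶜ v else 0 : ℕ) : ℤ)) := by
    rw [F.canonical_eq]
    push_cast
    rw [← Finset.sum_add_distrib]
    refine Finset.even_sum _ fun v _ => ?_
    split_ifs
    · exact hr.even hs v
    · simp
  rw [h1] at h3
  push_cast at h3
  rw [← add_assoc] at h3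
  exact (Int.even_add.1 h3).2 (even_two_mul _)

/-- The quasistable spin root with given lengths that is compatible with a given spin root. -/
theorem exists_quasistable_compat (y : SpinRoot G) (F : Specialization G H) (hH : H.b0 = 1)
    {l : H.E → ℝ} (hl : ∀ e, 0 < l e) (v₀ : H.V) :
    ∃ x : SpinRoot H, x.pd.Quasistable v₀ ∧ Compat F y x ∧
      ∃ p ∈ x.pd.lamOpen, len x.pd.exc p = l := by
  obtain ⟨x, hr, hq, hz, p, hp, hpl⟩ := exists_quasistable hH (P := F.incl ⁻¹' y.pd.zeroEdges)
    (even_push y.isRoot y.semistable F fun _ => Iff.rfl) hl v₀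
  have hzero : ∀ e, e ∈ x.zeroEdges ↔ F.incl e ∈ y.pd.zeroEdges := fun e => by rw [hz]; rfl
  let s : (H.contract x.zeroEdges).V → ZMod 2 := fun u' =>
    ∑ u : (G.contract y.pd.zeroEdges).V,
      if ∃ v : G.V, G.contractMk y.pd.zeroEdges v = u ∧
        H.contractMk x.zeroEdges (F.vMap v) = u' then y.sign u else 0
  have hs : ∀ u, (H.contract x.zeroEdges).weight u = 0 → s u = 0 := by
    intro u hu
    refine Finset.sum_eq_zero fun w _ => ?_
    split_ifs with h
    · obtain ⟨v, rfl, rfl⟩ := h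
      have := Compat.weight_le (x := y) (y := ⟨x, hr, hq.1, fun _ => 0, fun _ _ => rfl⟩) hzero v
      exact y.sign_eq_zero _ (Nat.le_zero.1 (this.trans_eq hu))
    · rfl
  exact ⟨⟨x, hr, hq.1, s, hs⟩, hq, ⟨hzero, fun _ => rfl⟩, p, hp, hpl⟩

end SpinTrop

end

noncomputable section

namespace SpinTrop

open scoped Classical

open WGraph PseudoDivisor

variable {n : ℕ} {G H K : WGraph n}

/-! ### The cones of polystable pseudo-roots -/

namespace WGraph

/-- The vector with entry `c v - c w` at the exceptional edge at `v` over an edge from `v` to `w`. -/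
def delta (A : Set G.E) : (G.V → ℝ) →ₗ[ℝ] ((G.subdivide A).E → ℝ) where
  toFun c := Sum.elim (fun _ => 0) fun q => c (G.ends q.1.1 q.2) - c (G.ends q.1.1 !q.2)
  map_add' c d := by
    funext a
    rcases a with e | q
    · exact (add_zero 0).symm
    · exact add_sub_add_comm _ _ _ _
  map_smul' r c := by
    funext a
    rcases a with e | q
    · exact (mul_zero r).symm
    · exact (mul_sub _ _ _).symm

theorem delta_kept {A : Set G.E} (c : G.V → ℝ) (e : G.E) (h : e ∉ A) :
    delta A c (kept e h) = 0 := rfl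

theorem delta_half {A : Set G.E} (c : G.V → ℝ) (e : G.E) (h : e ∈ A) (b : Bool) :
    delta A c (half e h b) = c (G.ends e b) - c (G.ends e !b) := rfl

theorem uVec_eq (A : Set G.E) (W : Finset G.V) :
    uVec G A W = delta A fun v => if v ∈ W then 1 else 0 := by
  funext a
  induction a using edge_cases with
  | h1 e h => rfl
  | h2 e h b =>
    rw [delta_half]
    change (if e ∈ G.cut W then (if G.ends e b ∈ W then (1 : ℝ) else -1) else 0) = _
    simp only [cut, Set.mem_ofPred_eq]
    cases b <;> by_cases h1 : G.ends e true ∈ W <;> by_cases h2 : G.ends e false ∈ W <;>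
      simp [h1, h2]

/-- `c` is a combination of the indicator functions of its level sets, and an edge across a level
set changes `c`, hence lies in `A`. -/
theorem delta_mem_excSpace {A : Set G.E} {c : G.V → ℝ}
    (hc : ∀ e ∉ A, c (G.ends e false) = c (G.ends e true)) : delta A c ∈ excSpace G A := by
  have h : c = ∑ r ∈ Finset.univ.image c,
      r • fun v => if v ∈ Finset.univ.filter (fun v => c v = r) then (1 : ℝ) else 0 := by
    funext v
    simp only [Finset.sum_apply, Pi.smul_apply, Finset.mem_filter, Finset.mem_univ, true_and,
      smul_eq_mul, mul_ite, mul_one, mul_zero]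
    rw [Finset.sum_ite_eq, if_pos (Finset.mem_image_of_mem _ (Finset.mem_univ v))]
  rw [h, map_sum]
  refine Submodule.sum_mem _ fun r _ => ?_
  rw [map_smul, ← uVec_eq]
  refine Submodule.smul_mem _ _ (Submodule.subset_span ⟨_, fun e he => ?_, rfl⟩)
  by_contra h1
  refine he ?_
  simp [hc e h1]

end WGraph

theorem len_delta (A : Set G.E) (c : G.V → ℝ) : len A (delta A c) = 0 := by
  funext e
  by_cases h : e ∈ A
  · rw [len_of_mem _ h, delta_half, delta_half]
    change c (G.ends e false) - c (G.ends e true) + (c (G.ends e true) - c (G.ends e false)) = 0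
    ring
  · rw [len_of_notMem _ h, delta_kept]; rfl

theorem excSpace_le_ker (A : Set G.E) : excSpace G A ≤ LinearMap.ker (len A) := by
  refine Submodule.span_le.2 ?_
  rintro u ⟨W, -, rfl⟩
  rw [uVec_eq]
  exact len_delta A _

namespace PseudoDivisor

/-- The lengths of the edges of `G` of a point of `ℝ^{E(G^𝓔)} / 𝓛_𝓔`. -/
def kapLen (x : PseudoDivisor G) : x.KapSpace →ₗ[ℝ] (G.E → ℝ) :=
  (excSpace G x.exc).liftQ (len x.exc) (excSpace_le_ker x.exc)

variable {x y : PseudoDivisor G}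

theorem kapLen_mk (p : x.sub.E → ℝ) :
    x.kapLen ((excSpace G x.exc).mkQ p) = len x.exc p :=
  Submodule.liftQ_apply _ _ _

/-- The points with equal coordinates at the two exceptional edges over every edge. -/
def mid (A : Set G.E) (l : G.E → ℝ) : (G.subdivide A).E → ℝ :=
  Sum.elim (fun e => l e.1) fun q => l q.1.1 / 2

theorem mid_kept {A : Set G.E} (l : G.E → ℝ) (e : G.E) (h : e ∉ A) :
    mid A l (kept e h) = l e := rfl

theorem mid_half {A : Set G.E} (l : G.E → ℝ) (e : G.E) (h : e ∈ A) (b : Bool) :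
    mid A l (half e h b) = l e / 2 := rfl

theorem len_mid (A : Set G.E) (l : G.E → ℝ) : len A (mid A l) = l := by
  funext e
  by_cases h : e ∈ A
  · rw [len_of_mem _ h, mid_half, mid_half, add_halves]
  · rw [len_of_notMem _ h, mid_kept]

namespace Polystable

variable (hx : x.Polystable) (hr : x.IsPseudoRoot)
include hx hr

theorem mid_mem_lam {l : G.E → ℝ} (hl : ∀ e, 0 ≤ l e) : mid x.exc l ∈ x.lam := by
  refine (hr.mem_lam_iff hx.semistable).2 ⟨fun a => ?_, fun _ => 0, fun e h => ?_, fun e h => ?_⟩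
  · induction a using edge_cases with
    | h1 e h => exact hl e
    | h2 e h b => exact div_nonneg (hl e) two_pos.le
  · rw [mid_half, mid_half, sub_self, sub_self]
  · rw [hx.flow_kept hr h]; simp

theorem mid_mem_lamOpen {l : G.E → ℝ} (hl : ∀ e, 0 < l e) : mid x.exc l ∈ x.lamOpen := by
  refine ⟨hx.mid_mem_lam hr fun e => (hl e).le, fun a => ?_⟩
  induction a using edge_cases with
  | h1 e h => exact hl e
  | h2 e h b => exact (half_pos (hl e)).trans_eq rfl

/-- The sums of the halves agree and their differences come from the potentials, so the two points
differ by `delta` of half the difference of the potentials. That function is constant along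
nonexceptional edges, where the polystable flow is zero. -/
theorem sub_mem_excSpace {p q : x.sub.E → ℝ} (hp : p ∈ x.lam) (hq : q ∈ x.lam)
    (h : len x.exc p = len x.exc q) : p - q ∈ excSpace G x.exc := by
  obtain ⟨-, f, hf⟩ := (hr.mem_lam_iff hx.semistable).1 hp
  obtain ⟨-, g, hg⟩ := (hr.mem_lam_iff hx.semistable).1 hq
  have h1 : p - q = delta x.exc fun v => (g v - f v) / 2 := by
    funext a
    induction a using edge_cases with
    | h1 e he =>
      have h2 := congrFun h e
      rw [len_of_notMem _ he, len_of_notMem _ he] at h2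
      rw [delta_kept, Pi.sub_apply, h2, sub_self]
    | h2 e he b =>
      have h2 := congrFun h e
      rw [len_of_mem _ he, len_of_mem _ he] at h2
      have h3 := hf.1 e he
      have h4 := hg.1 e he
      rw [delta_half, Pi.sub_apply]
      cases b
      · change p (half e he false) - q (half e he false) =
          (g (G.ends e false) - f (G.ends e false)) / 2 - (g (G.ends e true) - f (G.ends e true)) / 2
        linarith
      · change p (half e he true) - q (half e he true) =
          (g (G.ends e true) - f (G.ends e true)) / 2 - (g (G.ends e false) - f (G.ends e false)) / 2
        linarith
  rw [h1]
  refine delta_mem_excSpace fun e he => ?_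
  have h2 := hf.2 e he
  have h3 := hg.2 e he
  rw [hx.flow_kept hr he, Int.cast_zero, zero_mul] at h2 h3
  linarith

theorem kapLen_injOn : Set.InjOn x.kapLen x.kap := by
  rintro _ ⟨p, hp, rfl⟩ _ ⟨q, hq, rfl⟩ h
  rw [kapLen_mk, kapLen_mk] at h
  exact (Submodule.Quotient.eq _).2 (hx.sub_mem_excSpace hr hp hq h)

theorem eq_mk_mid {q : x.KapSpace} (hq : q ∈ x.kap) :
    q = (excSpace G x.exc).mkQ (mid x.exc (x.kapLen q)) := by
  have h0 : ∀ e, 0 ≤ x.kapLen q e := by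
    obtain ⟨p, hp, rfl⟩ := hq
    rw [kapLen_mk]
    exact len_nonneg hp.1
  refine hx.kapLen_injOn hr hq ⟨_, hx.mid_mem_lam hr h0, rfl⟩ ?_
  rw [kapLen_mk, len_mid]

/-- A representative may have vanishing halves even when all lengths are positive; `mid` moves the
exceptional points to the middle without changing the class. -/
theorem mem_kapOpen_iff {q : x.KapSpace} :
    q ∈ x.kapOpen ↔ q ∈ x.kap ∧ ∀ e, 0 < x.kapLen q e := by
  constructor
  · rintro ⟨p, hp, rfl⟩
    refine ⟨⟨p, hp.1, rfl⟩, fun e => ?_⟩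
    rw [kapLen_mk]
    exact len_pos hp.2 e
  · rintro ⟨h1, h2⟩
    exact ⟨_, hx.mid_mem_lamOpen hr h2, (hx.eq_mk_mid hr h1).symm⟩

end Polystable

theorem kapLen_nonneg {q : x.KapSpace} (hq : q ∈ x.kap) (e : G.E) : 0 ≤ x.kapLen q e := by
  obtain ⟨p, hp, rfl⟩ := hq
  rw [kapLen_mk]
  exact len_nonneg hp.1 e

end PseudoDivisor

namespace PDSpec

variable {x : PseudoDivisor G} {y : PseudoDivisor H} (f : PDSpec x y)

theorem lamToKap_apply (p : y.sub.E → ℝ) :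
    f.lamToKap p = (excSpace G x.exc).mkQ (f.hat.ext p) := rfl

theorem kapMap_mk (p : y.sub.E → ℝ) :
    f.kapMap ((excSpace H y.exc).mkQ p) = (excSpace G x.exc).mkQ (f.hat.ext p) := rfl

theorem kapLen_lamToKap (p : y.sub.E → ℝ) :
    x.kapLen (f.lamToKap p) = f.base.ext (len y.exc p) := by
  rw [lamToKap_apply, kapLen_mk, len_ext]

theorem kapLen_kapMap (q : y.KapSpace) :
    x.kapLen (f.kapMap q) = f.base.ext (y.kapLen q) := by
  obtain ⟨p, rfl⟩ := (excSpace H y.exc).mkQ_surjective q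
  rw [kapMap_mk, kapLen_mk, kapLen_mk, len_ext]

end PDSpec

namespace SpinSpec

variable {x : SpinRoot G} {y : SpinRoot H} (f : SpinSpec x y)

theorem lamToKap_mem {p : y.pd.sub.E → ℝ} (hp : p ∈ y.pd.lam) : f.lamToKap p ∈ x.pd.kap :=
  ⟨_, f.ext_mem_lam y.isRoot hp, rfl⟩

theorem kapMap_mem {q : y.pd.KapSpace} (hq : q ∈ y.pd.kap) : f.kapMap q ∈ x.pd.kap := by
  obtain ⟨p, hp, rfl⟩ := hq
  exact f.lamToKap_mem hp

end SpinSpec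

/-! ### Contractions of stable graphs -/

namespace WGraph

theorem b0_eq_one_iff : G.b0 = 1 ↔ Nonempty G.V ∧ ∀ u v, G.connSetoid Set.univ u v := by
  rw [b0, Nat.card_eq_one_iff_unique]
  constructor
  · rintro ⟨h1, ⟨c⟩⟩
    refine ⟨⟨c.out⟩, fun u v => ?_⟩
    exact Quotient.exact (Subsingleton.elim (Quotient.mk _ u) (Quotient.mk _ v))
  · rintro ⟨⟨v⟩, h⟩
    refine ⟨⟨fun a b => ?_⟩, ⟨Quotient.mk _ v⟩⟩
    induction a using Quotient.inductionOn
    induction b using Quotient.inductionOn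
    exact Quotient.sound (h _ _)

theorem Specialization.b0_eq_one (F : Specialization G H) (hG : G.b0 = 1) : H.b0 = 1 := by
  rw [b0_eq_one_iff] at hG ⊢
  obtain ⟨⟨v⟩, h⟩ := hG
  refine ⟨⟨F.vMap v⟩, fun a b => ?_⟩
  obtain ⟨u, rfl⟩ := F.vMap_surjective a
  obtain ⟨w, rfl⟩ := F.vMap_surjective b
  refine connSetoid_le ((H.connSetoid Set.univ).comap F.vMap) (fun e _ => ?_) (h u w)
  change H.connSetoid Set.univ (F.vMap _) (F.vMap _)
  by_cases he : e ∈ F.S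
  · rw [F.vMap_eq_of_mem he false true]
  · obtain ⟨a, rfl⟩ := F.exists_incl he
    rw [F.vMap_ends_tw, F.vMap_ends_tw]
    exact connSetoid_of_mem (Set.mem_univ a) _ _

theorem sum_canonical : ∑ v, G.canonical v = 2 * G.genus - 2 * G.b0 := by
  have h : ∑ v, (G.deg v : ℤ) = 2 * Fintype.card G.E := by
    simp only [deg, degIn_eq_sum, Set.mem_univ, true_and]
    push_cast
    rw [Finset.sum_comm]
    simp [mul_comm]
  simp only [canonical, genus, b1, Finset.sum_add_distrib, Finset.sum_sub_distrib, h,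
    ← Finset.mul_sum, Finset.sum_const, Finset.card_univ]
  simp only [nsmul_eq_mul]
  ring

/-- The genus is read off from the degree of the canonical divisor, which is preserved; the quantity
in the stability condition adds up over the fibres. -/
theorem Specialization.isStable {g : ℕ} (F : Specialization G H) (hG : G.IsStable g) :
    H.IsStable g := by
  have hb := F.b0_eq_one hG.connected
  refine ⟨hb, ?_, fun u => ?_⟩
  · have h1 := sum_canonical (G := G)
    have h2 := sum_canonical (G := H)
    have h3 : ∑ u, H.canonical u = ∑ v, G.canonical v := by
      simp only [F.canonical_eq]
      rw [Finset.sum_comm]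
      simp
    rw [hG.connected, hG.genus_eq] at h1
    rw [hb] at h2
    linarith
  · have h1 : ({i | H.leg i = u}.ncard : ℤ) =
        ∑ v, if F.vMap v = u then ({i | G.leg i = v}.ncard : ℤ) else 0 := by
      have h0 : ∀ (K : WGraph n) (w : K.V), ({i | K.leg i = w}.ncard : ℤ) =
          ∑ i, if K.leg i = w then 1 else 0 := fun K w => by
        rw [Set.ncard_eq_toFinset_card']
        simp
      have h6 : ∀ v, (if F.vMap v = u then ({i | G.leg i = v}.ncard : ℤ) else 0) =
          ∑ i, if G.leg i = v then (if F.vMap (G.leg i) = u then 1 else 0) else 0 := fun v => by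
        rw [h0]
        split_ifs with h
        · refine Finset.sum_congr rfl fun i _ => ?_
          split_ifs with h7 h8
          exacts [rfl, absurd (h7 ▸ h) h8, rfl]
        · refine (Finset.sum_eq_zero fun i _ => ?_).symm
          split_ifs with h7 h8
          exacts [absurd (h7 ▸ h8) h, rfl, rfl]
      rw [Finset.sum_congr rfl fun v _ => h6 v, h0, Finset.sum_comm]
      simp [F.leg_eq]
    have h2 := F.canonical_eq u
    have h3 : 0 < ∑ v, if F.vMap v = u then G.canonical v + {i | G.leg i = v}.ncard else 0 := by
      have h5 : ∀ v, 0 < G.canonical v + {i | G.leg i = v}.ncard := fun v => by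
        have := hG.stable v
        simp only [canonical]
        omega
      obtain ⟨w, hw⟩ := F.vMap_surjective u
      refine Finset.sum_pos' (fun v _ => ?_) ⟨w, Finset.mem_univ w, ?_⟩
      · split_ifs
        exacts [(h5 v).le, le_rfl]
      · rw [if_pos hw]
        exact h5 w
    have h4 : 0 < H.canonical u + {i | H.leg i = u}.ncard := by
      rw [h1, h2, ← Finset.sum_add_distrib]
      refine h3.trans_eq (Finset.sum_congr rfl fun v _ => ?_)
      split_ifs <;> simp
    simp only [canonical] at h4
    omega

/-- The contracted edges are recovered from a point as the edges of length zero, which separates the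
cones on different contractions. -/
theorem Specialization.mem_S_of_ext (F : Specialization G H) {l : H.E → ℝ}
    (hl : ∀ a, 0 < l a) (e : G.E) : e ∈ F.S ↔ F.ext l e = 0 := by
  refine ⟨fun he => F.ext_mem he l, fun he => ?_⟩
  by_contra h
  obtain ⟨a, rfl⟩ := F.exists_incl h
  rw [F.ext_incl] at he
  exact (hl a).ne' he

theorem Specialization.ext_congr {F F' : Specialization G H} (h : ∀ a, F.incl a = F'.incl a) :
    F.ext = F'.ext := by
  refine LinearMap.ext fun p => funext fun e => ?_
  by_cases he : e ∈ F.S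
  · have he' : e ∈ F'.S := by
      rw [mem_S_iff] at he ⊢
      rintro ⟨a, rfl⟩
      exact he ⟨a, h a⟩
    rw [F.ext_mem he, F'.ext_mem he']
  · obtain ⟨a, rfl⟩ := F.exists_incl he
    rw [F.ext_incl, h, F'.ext_incl]

end WGraph

end SpinTrop

end

noncomputable section

namespace SpinTrop

open scoped Classical

open WGraph PseudoDivisor

variable {n : ℕ} {G H K : WGraph n}

/-! ### The decompositions -/

theorem SpinSpec.lamToKap_injOn {y : SpinRoot G} {x : SpinRoot H} {v₀ : H.V}
    (hq : x.pd.Quasistable v₀) (f : SpinSpec y x) : Set.InjOn f.lamToKap x.pd.lam := by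
  intro p hp p' hp' h
  refine len_injOn x.isRoot hq hp hp' (f.base.ext_injective ?_)
  rw [← f.kapLen_lamToKap, ← f.kapLen_lamToKap, h]

/-- Lengths separate the points of the `κ` of a polystable root, and those of an image depend only
on the map on edges. -/
theorem SpinSpec.lamToKap_eqOn {y : SpinRoot G} (hy : y.pd.Polystable) {x : SpinRoot H}
    (f h : SpinSpec y x) (hfh : ∀ a, f.base.incl a = h.base.incl a) :
    Set.EqOn f.lamToKap h.lamToKap x.pd.lam := by
  intro p hp
  refine hy.kapLen_injOn y.isRoot (f.lamToKap_mem hp) (h.lamToKap_mem hp) ?_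
  rw [f.kapLen_lamToKap, h.kapLen_lamToKap, Specialization.ext_congr hfh]

theorem WGraph.Specialization.IsCanonical.incl_eq {S : Set G.E} {f h : Specialization G (G.contract S)}
    (hf : f.IsCanonical) (hh : h.IsCanonical) (a : (G.contract S).E) : f.incl a = h.incl a :=
  (hf.2 a).trans (hh.2 a).symm

/-- Quasistable spin roots on a graph are determined by a specialization and the lengths of a
point of the open cone. -/
theorem spinRoot_eq_of_len {y : SpinRoot G} {x x' : SpinRoot H} {F F' : Specialization G H}
    (hF : Compat F y x) (hF' : Compat F' y x') (hv : ∀ v, F'.vMap v = F.vMap v)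
    (hi : ∀ a, F'.incl a = F.incl a) {v₀ : H.V} (hq : x.pd.Quasistable v₀)
    (hq' : x'.pd.Quasistable v₀) {p : x.pd.sub.E → ℝ} {p' : x'.pd.sub.E → ℝ}
    (hp : p ∈ x.pd.lamOpen) (hp' : p' ∈ x'.pd.lamOpen)
    (hl : len x.pd.exc p = len x'.pd.exc p') : x = x' := by
  obtain ⟨I, hI, -⟩ := exists_id H
  have h1 : Compat I x x' := hF.factor hF' (fun v => by rw [hI.1, hv]) fun a => by rw [hI.2, hi]
  obtain ⟨h2, h3⟩ := (Compat.id_iff hI).1 h1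
  exact SpinRoot.ext_of_pd (eq_of_len x.isRoot hq x'.isRoot hq' h2 hp hp' hl) fun v => (h3 v).symm

/-- Every point of `κ` has the lengths of a point of the open cone of a quasistable spin root on
a contraction. -/
theorem exists_quasistable_contract [NeZero n] (hG : G.b0 = 1) {y : SpinRoot G}
    {q : y.pd.KapSpace} (hq : q ∈ y.pd.kap) :
    ∃ (S : Set G.E) (x : SpinRoot (G.contract S)), x.pd.Quasistable ((G.contract S).leg 0) ∧
      Compat (G.contractSpec S) y x ∧
      ∃ p ∈ x.pd.lamOpen, y.pd.kapLen q = (G.contractSpec S).ext (len x.pd.exc p) := by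
  let S : Set G.E := {e | y.pd.kapLen q e = 0}
  let F := G.contractSpec S
  have hF : F.IsCanonical := G.contractSpec_isCanonical S
  have hl : ∀ a, 0 < y.pd.kapLen q (F.incl a) := fun a => by
    refine lt_of_le_of_ne (kapLen_nonneg hq _) fun h => ?_
    have h1 := hF.2 a
    rw [h1] at h
    exact a.2 h.symm
  obtain ⟨x, hx, hc, p, hp, hpl⟩ :=
    exists_quasistable_compat y F (F.b0_eq_one hG) hl ((G.contract S).leg 0)
  refine ⟨S, x, hx, hc, p, hp, ?_⟩
  rw [hpl]
  funext e
  by_cases he : e ∈ F.S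
  · rw [F.ext_mem he]
    rw [hF.S_eq] at he
    exact he
  · obtain ⟨a, rfl⟩ := F.exists_incl he
    rw [F.ext_incl]

/-- `κ°` is the set of positive length vectors, and `pol(x) = y` means that `x` has the zero edges
and signs of `y`. Each positive length vector belongs to the open cone of exactly one such
quasistable `x`: existence by the distance function, uniqueness by `spinRoot_eq_of_len`. -/
theorem isDecomposition_kapOpen [NeZero n] (hG : G.b0 = 1) {y : SpinRoot G}
    (hy : y.pd.Polystable) :
    IsDecomposition y y.pd.kapOpen (fun _ : PolFibre y => G) (fun i => i.1)
      (fun _ f => f.base.IsId) where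
  exists_spec i := (isSpinPol_iff.1 i.2.2).2.exists_spinSpec hy
  indep i f h hf hh := SpinSpec.lamToKap_eqOn hy f h fun a => (hf.2 a).trans (hh.2 a).symm
  inj i f _ := f.lamToKap_injOn i.2.1
  cover q := by
    rw [hy.mem_kapOpen_iff y.isRoot]
    constructor
    · rintro ⟨hq, hl⟩
      obtain ⟨I, hI, -⟩ := exists_id G
      obtain ⟨x, hx, hc, p, hp, hpl⟩ := exists_quasistable_compat y I hG hl (G.leg 0)
      have hs : y.Same x := by
        obtain ⟨h1, h2⟩ := (Compat.id_iff hI).1 hc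
        exact ⟨h1.symm, fun v => (h2 v).symm⟩
      obtain ⟨f, hf⟩ := hs.exists_spinSpec hy
      refine ⟨⟨x, hx, IsSpinPol.of_same hy hs⟩, f, hf, p, hp, ?_⟩
      refine hy.kapLen_injOn y.isRoot (f.lamToKap_mem hp.1) hq ?_
      rw [f.kapLen_lamToKap, hf.ext_eq, hpl]
    · rintro ⟨i, f, hf, p, hp, rfl⟩
      refine ⟨f.lamToKap_mem hp.1, ?_⟩
      rw [f.kapLen_lamToKap, hf.ext_eq]
      exact len_pos hp.2
  disjoint i j f h hij hf hh := by
    refine Set.disjoint_left.2 ?_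
    rintro _ ⟨p, hp, rfl⟩ ⟨p', hp', heq⟩
    refine hij (Subtype.ext (spinRoot_eq_of_len f.compat h.compat
      (fun v => (hh.1 v).trans (hf.1 v).symm) (fun a => (hh.2 a).trans (hf.2 a).symm)
      i.2.1 j.2.1 hp hp' ?_))
    have h1 := congrArg y.pd.kapLen heq
    rw [f.kapLen_lamToKap, h.kapLen_lamToKap, hf.ext_eq, hh.ext_eq] at h1
    exact h1.symm

/-- The point determines the edges of length zero; after contracting them the lengths are positive
and the argument for `κ°` applies. -/
theorem isDecomposition_kap [NeZero n] (hG : G.b0 = 1) {y : SpinRoot G} (hy : y.pd.Polystable) :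
    IsDecomposition y y.pd.kap (fun i : QuasiSpecs y => G.contract i.1.1) (fun i => i.1.2)
      (fun _ f => f.base.IsCanonical) where
  exists_spec i := i.2.2
  indep i f h hf hh := SpinSpec.lamToKap_eqOn hy f h fun a => hf.incl_eq hh a
  inj i f _ := f.lamToKap_injOn i.2.1
  cover q := by
    constructor
    · intro hq
      obtain ⟨S, x, hx, hc, p, hp, hl⟩ := exists_quasistable_contract hG hq
      obtain ⟨f, hf⟩ := hc.exists_spinSpec hy
      have hf' : f.base.IsCanonical := hf ▸ G.contractSpec_isCanonical S
      refine ⟨⟨⟨S, x⟩, hx, f, hf'⟩, f, hf', p, hp, ?_⟩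
      refine hy.kapLen_injOn y.isRoot (f.lamToKap_mem hp.1) hq ?_
      rw [f.kapLen_lamToKap, hf, hl]
    · rintro ⟨i, f, hf, p, hp, rfl⟩
      exact f.lamToKap_mem hp.1
  disjoint i j f h hij hf hh := by
    refine Set.disjoint_left.2 ?_
    rintro _ ⟨p, hp, rfl⟩ ⟨p', hp', heq⟩
    have h1 := congrArg y.pd.kapLen heq
    rw [f.kapLen_lamToKap, h.kapLen_lamToKap] at h1
    obtain ⟨⟨S, x⟩, hx, hex⟩ := i
    obtain ⟨⟨S', x'⟩, hx', hex'⟩ := j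
    have key : ∀ {T : Set G.E} (g : Specialization G (G.contract T)) (_ : g.IsCanonical)
        (l : (G.contract T).E → ℝ) (_ : ∀ a, 0 < l a), T = {e | g.ext l e = 0} := by
      intro T g hg l hl
      ext e
      rw [Set.mem_ofPred_eq, ← g.mem_S_of_ext hl, hg.S_eq]
    have hS : S = S' := by
      refine (key f.base hf _ (len_pos hp.2)).trans
        (Eq.trans ?_ (key h.base hh _ (len_pos hp'.2)).symm)
      rw [h1]
    subst hS
    have hxx : x = x' := by
      refine spinRoot_eq_of_len f.compat h.compat
        (fun v => (hh.1 v).trans (hf.1 v).symm) (fun a => hh.incl_eq hf a) hx hx' hp hp' ?_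
      refine f.base.ext_injective ?_
      rw [Specialization.ext_congr fun a => hf.incl_eq hh a] at h1 ⊢
      exact h1.symm
    subst hxx
    exact hij rfl

end SpinTrop

end

noncomputable section

namespace SpinTrop

open scoped Classical

open WGraph PseudoDivisor

variable {n : ℕ} {G H K : WGraph n}

/-! ### The cones are rational polyhedral -/

theorem mem_intLattice {E : Type} {p : E → ℝ} : p ∈ intLattice E ↔ ∀ a, ∃ z : ℤ, (z : ℝ) = p a := by
  constructor
  · rintro ⟨z, rfl⟩ a
    exact ⟨z a, rfl⟩
  · intro h
    choose z hz using h
    exact ⟨z, funext hz⟩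

/-- Nonnegative vectors of a subspace are nonnegative combinations of 0/1-vectors if every nonzero
one of them has a nonzero 0/1-vector in its support. -/
theorem exists_combination {E : Type} [Fintype E] {L : Submodule ℝ (E → ℝ)} {s : Finset (E → ℝ)}
    (hs : ∀ g ∈ s, g ∈ L ∧ ∀ a, g a = 0 ∨ g a = 1)
    (h : ∀ p ∈ L, (∀ a, 0 ≤ p a) → p ≠ 0 → ∃ g ∈ s, g ≠ 0 ∧ ∀ a, p a = 0 → g a = 0)
    {p : E → ℝ} (hp : p ∈ L) (h0 : ∀ a, 0 ≤ p a) :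
    ∃ c : (E → ℝ) → ℝ, (∀ v ∈ s, 0 ≤ c v) ∧ p = ∑ v ∈ s, c v • v := by
  induction hm : (Finset.univ.filter fun a => p a ≠ 0).card using Nat.strong_induction_on
    generalizing p with
  | _ m ih =>
    by_cases hp0 : p = 0
    · exact ⟨0, fun _ _ => le_rfl, by simp [hp0]⟩
    obtain ⟨g, hg, hg0, hgp⟩ := h p hp h0 hp0
    have hg1 := (hs g hg).2
    have hne : (Finset.univ.filter fun a => g a = 1).Nonempty := by
      by_contra h1
      refine hg0 (funext fun a => (hg1 a).resolve_right fun h2 => h1 ⟨a, ?_⟩)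
      simp [h2]
    -- The largest multiple of `g` that keeps the vector nonnegative is subtracted; the coordinate
    -- `a₀` then vanishes and the support shrinks.
    obtain ⟨a₀, ha₀, hmin⟩ := Finset.exists_min_image _ p hne
    simp only [Finset.mem_filter, Finset.mem_univ, true_and] at ha₀ hmin
    have hq0 : ∀ a, 0 ≤ (p - p a₀ • g) a := by
      intro a
      rw [Pi.sub_apply, Pi.smul_apply, smul_eq_mul]
      rcases hg1 a with h1 | h1
      · rw [h1]; simpa using h0 a
      · rw [h1]; have := hmin a h1; linarith
    have hpa : p a₀ ≠ 0 := fun h1 => by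
      have := hgp a₀ h1
      rw [ha₀] at this
      exact one_ne_zero this
    obtain ⟨c, hc, hpc⟩ := ih _ (by
      rw [← hm]
      refine Finset.card_lt_card ⟨fun a ha => ?_, fun h1 => ?_⟩
      · simp only [Finset.mem_filter, Finset.mem_univ, true_and] at ha ⊢
        intro h1
        apply ha
        rw [Pi.sub_apply, Pi.smul_apply, h1, hgp a h1]; simp
      · have h2 := h1 (show a₀ ∈ _ by simp [hpa])
        simp [ha₀] at h2) (L.sub_mem hp (L.smul_mem (p a₀) (hs g hg).1)) hq0 rfl
    refine ⟨fun v => c v + if v = g then p a₀ else 0, fun v hv => ?_, ?_⟩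
    · have := h0 a₀
      have := hc v hv
      positivity
    · simp only [add_smul, Finset.sum_add_distrib, ← hpc, ite_smul, zero_smul]
      rw [Finset.sum_ite_eq', if_pos hg]
      simp

namespace PseudoDivisor

variable {x : PseudoDivisor G}

/-- The linear span of the equations of the cone. -/
def lamSpace (x : PseudoDivisor G) : Submodule ℝ (x.sub.E → ℝ) where
  carrier := {p | ∀ γ : x.sub.OrientedCycle, ∑ i, (x.flow (γ.dart i) : ℝ) * p (γ.dart i).1 = 0}
  add_mem' hp hq γ := by
    have h1 := hp γ
    have h2 := hq γ
    simp only [Pi.add_apply, mul_add, Finset.sum_add_distrib, h1, h2, add_zero]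
  zero_mem' γ := by simp
  smul_mem' r p hp γ := by
    have h1 := hp γ
    simp only [Pi.smul_apply, smul_eq_mul, mul_left_comm _ r, ← Finset.mul_sum, h1, mul_zero]

theorem mem_lamSpace_of_potential {p : x.sub.E → ℝ} {f : x.sub.V → ℝ}
    (h : ∀ d : x.sub.Dart, (x.flow d : ℝ) * p d.1 = f (x.sub.tgt d) - f (x.sub.src d)) :
    p ∈ x.lamSpace := by
  intro γ
  simp only [h]
  exact γ.sum_potential f

/-- If the flow is zero at an edge of the support, a coordinate vector works. Otherwise the
potential is cut off at its value at the upper end of that edge: the absolute differences of the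
indicator `c` of the superlevel set form a 0/1-vector. As `c` is a nondecreasing function of the
potential, its differences have the signs of the flow and vanish where `p` does. -/
theorem exists_unit_vector (hr : x.IsPseudoRoot) (hs : x.Semistable) {p : x.sub.E → ℝ}
    (hp : p ∈ x.lam) (h0 : p ≠ 0) :
    ∃ g ∈ x.lamSpace, (∀ a, g a = 0 ∨ g a = 1) ∧ g ≠ 0 ∧ ∀ a, p a = 0 → g a = 0 := by
  obtain ⟨a, ha⟩ : ∃ a, p a ≠ 0 := by
    by_contra h
    push Not at h
    exact h0 (funext h)
  have ha' : 0 < p a := lt_of_le_of_ne (hp.1 a) (Ne.symm ha)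
  by_cases hz : ∀ b, x.flow (a, b) = 0
  · refine ⟨Pi.single a 1, mem_lamSpace_of_potential (f := 0) ?_, fun a' => ?_, ?_, fun a' h => ?_⟩
    · rintro ⟨a', b⟩
      by_cases h : a' = a
      · subst h; simp [hz b]
      · simp [h]
    · by_cases h : a' = a
      · subst h; simp
      · simp [h]
    · intro h
      have := congrFun h a
      simp at this
    · have h1 : a' ≠ a := fun h1 => ha (h1 ▸ h)
      simp [h1]
  push Not at hz
  obtain ⟨b, hb⟩ : ∃ b, x.flow (a, b) = 1 := by
    obtain ⟨b, hb⟩ := hz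
    have h1 := hr.flow_le_one hs (a, b)
    have h2 := hr.neg_one_le_flow hs (a, b)
    rcases lt_or_ge (x.flow (a, b)) 0 with h3 | h3
    · refine ⟨!b, ?_⟩
      have := hr.flow_rev (a, b)
      change x.flow (a, !b) = _ at this
      omega
    · exact ⟨b, by omega⟩
  obtain ⟨f, hf⟩ := exists_potential (ω := fun d : x.sub.Dart => (x.flow d : ℝ) * p d.1)
    (fun d => by
      rw [hr.flow_rev]
      change ((-x.flow d : ℤ) : ℝ) * p d.1 = _
      push_cast; ring) hp.2
  let c : x.sub.V → ℝ := fun v => if f (x.sub.tgt (a, b)) ≤ f v then 1 else 0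
  have key : ∀ d : x.sub.Dart, (x.flow d : ℝ) * |c (x.sub.ends d.1 true) - c (x.sub.ends d.1 false)|
      = c (x.sub.tgt d) - c (x.sub.src d) ∧
        (p d.1 = 0 → c (x.sub.ends d.1 true) - c (x.sub.ends d.1 false) = 0) := by
    intro d
    have habs : |c (x.sub.ends d.1 true) - c (x.sub.ends d.1 false)| =
        |c (x.sub.tgt d) - c (x.sub.src d)| := by
      obtain ⟨e, b⟩ := d
      cases b
      · rfl
      · exact abs_sub_comm _ _
    have h1 := hf d
    have h2 := hr.flow_le_one hs d
    have h3 := hr.neg_one_le_flow hs d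
    have h4 := hp.1 d.1
    refine ⟨?_, fun h5 => ?_⟩
    · rw [habs]
      have h6 : x.flow d = -1 ∨ x.flow d = 0 ∨ x.flow d = 1 := by omega
      dsimp only [c]
      rcases h6 with h6 | h6 | h6 <;> rw [h6] at h1 ⊢ <;> push_cast at h1 ⊢ <;>
        split_ifs with h7 h8 h8 <;> first | linarith | norm_num
    · have h6 : |c (x.sub.ends d.1 true) - c (x.sub.ends d.1 false)| = 0 := by
        rw [habs]
        rw [h5, mul_zero] at h1
        have h7 : f (x.sub.tgt d) = f (x.sub.src d) := by linarith
        dsimp only [c]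
        rw [h7, sub_self, abs_zero]
      exact abs_eq_zero.1 h6
  refine ⟨fun a' => |c (x.sub.ends a' true) - c (x.sub.ends a' false)|,
    mem_lamSpace_of_potential fun d => (key d).1, fun a' => ?_, fun h => ?_, fun a' h => ?_⟩
  · dsimp only [c]
    split_ifs <;> norm_num
  · have h1 := (key (a, b)).1
    have h2 := congrFun h a
    simp only [Pi.zero_apply] at h2
    have h3 : c (x.sub.tgt (a, b)) - c (x.sub.src (a, b)) = 0 := by
      rw [← h1]
      change _ * |c (x.sub.ends a true) - c (x.sub.ends a false)| = 0
      rw [h2, mul_zero]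
    have h4 := hf (a, b)
    simp only [hb] at h4
    push_cast at h4
    dsimp only [c] at h3
    rw [if_pos le_rfl, if_neg (by linarith)] at h3
    norm_num at h3
  · exact abs_eq_zero.2 ((key (a', false)).2 h)

theorem finite_unit_vectors (E : Type) [Fintype E] : {g : E → ℝ | ∀ a, g a = 0 ∨ g a = 1}.Finite := by
  have h : {g : E → ℝ | ∀ a, g a = 0 ∨ g a = 1} = Set.pi Set.univ fun _ => ({0, 1} : Set ℝ) := by
    ext g; simp
  rw [h]
  exact Set.Finite.pi fun _ => Set.toFinite ({0, 1} : Set ℝ)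

theorem exists_generators (hr : x.IsPseudoRoot) (hs : x.Semistable) :
    ∃ s : Finset (x.sub.E → ℝ), (∀ v ∈ s, v ∈ intLattice x.sub.E ∧ v ∈ x.lam) ∧
      ∀ p ∈ x.lam, ∃ c : (x.sub.E → ℝ) → ℝ, (∀ v ∈ s, 0 ≤ c v) ∧ p = ∑ v ∈ s, c v • v := by
  have hfin : {g : x.sub.E → ℝ | g ∈ x.lamSpace ∧ ∀ a, g a = 0 ∨ g a = 1}.Finite :=
    (finite_unit_vectors x.sub.E).subset fun g hg => hg.2
  refine ⟨hfin.toFinset, fun v hv => ?_, fun p hp => ?_⟩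
  · rw [Set.Finite.mem_toFinset] at hv
    refine ⟨mem_intLattice.2 fun a => ?_, fun a => ?_, hv.1⟩
    · rcases hv.2 a with h | h
      exacts [⟨0, by rw [h]; norm_num⟩, ⟨1, by rw [h]; norm_num⟩]
    · rcases hv.2 a with h | h <;> rw [h]
      exact zero_le_one
  · refine exists_combination (L := x.lamSpace) (fun g hg => by
      rwa [Set.Finite.mem_toFinset] at hg) (fun q hq hq0 hne => ?_) hp.2 hp.1
    obtain ⟨g, h1, h2, h3, h4⟩ := exists_unit_vector hr hs ⟨hq0, hq⟩ hne
    exact ⟨g, by rw [Set.Finite.mem_toFinset]; exact ⟨h1, h2⟩, h3, h4⟩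

theorem sum_smul_mem_lam {ι : Type*} {s : Finset ι} {c : ι → ℝ} (hc : ∀ i ∈ s, 0 ≤ c i)
    {v : ι → x.sub.E → ℝ} (hv : ∀ i ∈ s, v i ∈ x.lam) : ∑ i ∈ s, c i • v i ∈ x.lam := by
  refine ⟨fun a => ?_, x.lamSpace.sum_mem fun i hi => x.lamSpace.smul_mem _ (hv i hi).2⟩
  rw [Finset.sum_apply]
  exact Finset.sum_nonneg fun i hi => mul_nonneg (hc i hi) ((hv i hi).1 a)

end PseudoDivisor

theorem Qtrop_polyhedral {g : ℕ} [NeZero n] (a : SPQ g n) :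
    ((Qtrop g n).cone a).IsRationalPolyhedral := by
  obtain ⟨s, hs, h⟩ := exists_generators a.root.isRoot a.root.semistable
  refine ⟨s, fun v hv => (hs v hv).1, Set.Subset.antisymm h ?_⟩
  rintro p ⟨c, hc, rfl⟩
  exact sum_smul_mem_lam hc fun v hv => (hs v hv).2

/-- Different generators may have the same image, so their coefficients are collected. -/
theorem map_sum_smul {V W : Type*} [AddCommGroup V] [Module ℝ V] [AddCommGroup W] [Module ℝ W]
    (T : V →ₗ[ℝ] W) (s : Finset V) (c : V → ℝ) : T (∑ v ∈ s, c v • v) =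
      ∑ w ∈ s.image T, (∑ v ∈ s.filter (fun v => T v = w), c v) • w := by
  rw [map_sum]
  simp only [map_smul]
  rw [← Finset.sum_fiberwise_of_maps_to (g := T) (t := s.image T)
    fun v hv => Finset.mem_image_of_mem T hv]
  refine Finset.sum_congr rfl fun w _ => ?_
  rw [Finset.sum_smul]
  refine Finset.sum_congr rfl fun v hv => ?_
  rw [(Finset.mem_filter.1 hv).2]

theorem Strop_polyhedral {g : ℕ} (a : SP g n) : ((Strop g n).cone a).IsRationalPolyhedral := by
  obtain ⟨s, hs, h⟩ := exists_generators a.root.isRoot a.root.semistable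
  let T := (excSpace a.graph a.root.pd.exc).mkQ
  have hsec : ∀ w : a.root.pd.KapSpace, ∃ v, w ∈ s.image T → v ∈ s ∧ T v = w := by
    intro w
    by_cases hw : w ∈ s.image T
    · obtain ⟨v, hv, h1⟩ := Finset.mem_image.1 hw
      exact ⟨v, fun _ => ⟨hv, h1⟩⟩
    · exact ⟨0, fun h1 => absurd h1 hw⟩
  choose sec hsec using hsec
  refine ⟨s.image T, fun w hw => ?_, Set.Subset.antisymm ?_ ?_⟩
  · obtain ⟨v, hv, rfl⟩ := Finset.mem_image.1 hw
    exact ⟨v, (hs v hv).1, rfl⟩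
  · rintro _ ⟨p, hp, rfl⟩
    obtain ⟨c, hc, hpc⟩ := h p hp
    refine ⟨fun w => ∑ v ∈ s.filter (fun v => T v = w), c v,
      fun w _ => Finset.sum_nonneg fun v hv => hc v (Finset.mem_filter.1 hv).1, ?_⟩
    exact (congrArg T hpc).trans (map_sum_smul T s c)
  · rintro _ ⟨c, hc, rfl⟩
    refine ⟨∑ w ∈ s.image T, c w • sec w,
      sum_smul_mem_lam hc fun w hw => (hs _ (hsec w hw).1).2, ?_⟩
    change T _ = _
    rw [map_sum]
    refine Finset.sum_congr rfl fun w hw => ?_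
    rw [map_smul, (hsec w hw).2]
    rfl

/-! ### Face morphisms -/

theorem WGraph.Specialization.ext_mem_intLattice (F : Specialization G H) {p : H.E → ℝ}
    (hp : p ∈ intLattice H.E) : F.ext p ∈ intLattice G.E := by
  rw [mem_intLattice] at hp ⊢
  intro e
  by_cases h : e ∈ F.S
  · exact ⟨0, by rw [F.ext_mem h]; simp⟩
  · obtain ⟨a, rfl⟩ := F.exists_incl h
    rw [F.ext_incl]
    exact hp a

theorem WGraph.Specialization.ext_comp_incl (F : Specialization G H) {p : G.E → ℝ}
    (hp : ∀ e ∈ F.S, p e = 0) : F.ext (fun a => p (F.incl a)) = p := by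
  funext e
  by_cases h : e ∈ F.S
  · rw [F.ext_mem h, hp e h]
  · obtain ⟨a, rfl⟩ := F.exists_incl h
    rw [F.ext_incl]

/-- The sum of the coordinates in a set. -/
def sumOn {E : Type} [Fintype E] (S : Set E) : (E → ℝ) →ₗ[ℝ] ℝ :=
  ∑ e ∈ Finset.univ.filter (· ∈ S), LinearMap.proj e

theorem sumOn_apply {E : Type} [Fintype E] (S : Set E) (p : E → ℝ) :
    sumOn S p = ∑ e ∈ Finset.univ.filter (· ∈ S), p e := by
  simp [sumOn]

theorem sumOn_nonneg {E : Type} [Fintype E] (S : Set E) {p : E → ℝ} (hp : ∀ a, 0 ≤ p a) :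
    0 ≤ sumOn S p := by
  rw [sumOn_apply]
  exact Finset.sum_nonneg fun a _ => hp a

theorem sumOn_eq_zero {E : Type} [Fintype E] (S : Set E) {p : E → ℝ} (hp : ∀ a, 0 ≤ p a) :
    sumOn S p = 0 ↔ ∀ a ∈ S, p a = 0 := by
  rw [sumOn_apply, Finset.sum_eq_zero_iff_of_nonneg fun a _ => hp a]
  simp

/-- The face is the vanishing of the sum of the contracted coordinates, and the inverse forgets
these coordinates. -/
theorem Qtrop_face {g : ℕ} [NeZero n] {a b : SPQ g n} (f : SpinSpec a.root b.root) :
    LatticeCone.IsFaceMorphism (A := (Qtrop g n).cone b) (B := (Qtrop g n).cone a)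
      f.hat.ext := by
  refine ⟨{p | p ∈ a.root.pd.lam ∧ sumOn f.hat.S p = 0},
    ⟨sumOn f.hat.S, fun p hp => sumOn_nonneg _ hp.1, rfl⟩,
    ⟨fun v hv => f.hat.ext_mem_intLattice hv, fun p hp => ?_⟩,
    LinearMap.funLeft ℝ ℝ f.hat.incl, ⟨fun v hv => ?_, fun p hp => ?_⟩, fun p _ => ?_,
    fun q hq => ?_⟩
  · have h1 := f.ext_mem_lam b.root.isRoot hp
    exact ⟨h1, (sumOn_eq_zero _ h1.1).2 fun e he => f.hat.ext_mem he p⟩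
  · exact mem_intLattice.2 fun e => mem_intLattice.1 hv _
  · exact f.restrict_mem_lam a.root.isRoot hp.1 ((sumOn_eq_zero _ hp.1.1).1 hp.2)
  · exact funext fun e => f.hat.ext_incl e p
  · exact f.hat.ext_comp_incl ((sumOn_eq_zero _ hq.1.1).1 hq.2)

/-- The difference of the values of `c` at two vertices as an integral linear form in `delta c`. -/
theorem exists_delta_form {A S : Set G.E} {u v : G.V} (huv : G.connSetoid (S ∪ Aᶜ) u v) :
    ∃ l : ((G.subdivide A).E → ℝ) →ₗ[ℝ] ℝ,
      (∀ p ∈ intLattice (G.subdivide A).E, ∃ z : ℤ, (z : ℝ) = l p) ∧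
      (∀ p, (∀ a, G.below A a ∈ S → p a = 0) → l p = 0) ∧
      ∀ c : G.V → ℝ, (∀ e ∉ A, c (G.ends e false) = c (G.ends e true)) →
        l (delta A c) = c v - c u := by
  refine connSetoid_le ⟨fun u v => ∃ l : ((G.subdivide A).E → ℝ) →ₗ[ℝ] ℝ,
      (∀ p ∈ intLattice (G.subdivide A).E, ∃ z : ℤ, (z : ℝ) = l p) ∧
      (∀ p, (∀ a, G.below A a ∈ S → p a = 0) → l p = 0) ∧
      ∀ c : G.V → ℝ, (∀ e ∉ A, c (G.ends e false) = c (G.ends e true)) →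
        l (delta A c) = c v - c u, ?_, ?_, ?_⟩ ?_ huv
  · exact fun u => ⟨0, fun p _ => ⟨0, by simp⟩, by simp, by simp⟩
  · rintro u v ⟨l, h1, h2, h3⟩
    refine ⟨-l, fun p hp => ?_, fun p hp => ?_, fun c hc => ?_⟩
    · obtain ⟨z, hz⟩ := h1 p hp
      exact ⟨-z, by rw [LinearMap.neg_apply, ← hz]; push_cast; rfl⟩
    · rw [LinearMap.neg_apply, h2 p hp, neg_zero]
    · rw [LinearMap.neg_apply, h3 c hc]; ring
  · rintro u v w ⟨l, h1, h2, h3⟩ ⟨l', h1', h2', h3'⟩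
    refine ⟨l + l', fun p hp => ?_, fun p hp => ?_, fun c hc => ?_⟩
    · obtain ⟨z, hz⟩ := h1 p hp
      obtain ⟨z', hz'⟩ := h1' p hp
      exact ⟨z + z', by rw [LinearMap.add_apply, ← hz, ← hz']; push_cast; rfl⟩
    · rw [LinearMap.add_apply, h2 p hp, h2' p hp, add_zero]
    · rw [LinearMap.add_apply, h3 c hc, h3' c hc]; ring
  · intro e he
    by_cases hA : e ∈ A
    · have hS : e ∈ S := he.resolve_right fun h => h hA
      -- The coordinate of `delta A c` at the half at the end `true` is the required difference; it
      -- vanishes whenever `p` vanishes over `S`.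
      refine ⟨LinearMap.proj (half e hA true), fun p hp => mem_intLattice.1 hp _,
        fun p hp => hp _ (by rwa [below_half]), fun c _ => rfl⟩
    · refine ⟨0, fun p _ => ⟨0, by simp⟩, by simp, fun c hc => ?_⟩
      rw [hc e hA]; simp

end SpinTrop

end

/-! ### Face morphisms between the cones `κ` -/

noncomputable section

namespace SpinTrop

open scoped Classical

open WGraph PseudoDivisor

variable {n : ℕ} {G H K : WGraph n}

namespace PDSpec

variable {x : PseudoDivisor G} {y : PseudoDivisor H} (f : PDSpec x y)

/-- The restriction of the vector `delta c` for functions `c` on the vertices of the target. -/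
theorem delta_comp_incl (hexc : ∀ e, f.base.incl e ∈ x.exc → e ∈ y.exc) {c : G.V → ℝ} {c' : H.V → ℝ}
    (hc : ∀ v, c v = c' (f.base.vMap v)) (a : y.sub.E) :
    delta x.exc c (f.hat.incl a) = delta y.exc c' a := by
  induction a using edge_cases with
  | h1 e he => rw [f.incl_kept e he fun h => he (hexc e h), delta_kept, delta_kept]
  | h2 e he b =>
    have hex := f.exc_sub e he
    obtain ⟨b', hb'⟩ : ∃ b', f.hat.incl (half e he b) = half (f.base.incl e) hex b' := by
      have h1 := f.edge_comm (half e he b)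
      rw [below_half] at h1
      rcases edge_cases (p := fun a => a = f.hat.incl (half e he b) → (∃ b', a = half (f.base.incl e) hex b'))
        (fun e' h' h2 => by
          rw [← h2, below_kept] at h1
          exact absurd hex (h1 ▸ h'))
        (fun e' h' b' h2 => by
          rw [← h2, below_half] at h1
          subst h1
          exact ⟨b', rfl⟩) _ rfl with ⟨b', hb'⟩
      exact ⟨b', hb'⟩
    rw [hb', delta_half, delta_half, hc, hc]
    have h1 := f.vMap_half ⟨e, he⟩ b ⟨_, hex⟩ b' hb'
    change f.base.vMap (G.ends (f.base.incl e) b') = H.ends e b at h1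
    have h2 : f.base.vMap (G.ends (f.base.incl e) !b') = H.ends e !b := by
      rw [f.base.vMap_ends_tw] at h1 ⊢
      revert h1
      cases b <;> cases b' <;> cases f.base.tw e <;>
        simp only [Bool.xor_false, Bool.xor_true, Bool.not_true, Bool.not_false] <;>
        intro h1 <;> first | exact h1.symm | trivial
    rw [h1, h2]

variable (hexc : ∀ e, f.base.incl e ∈ x.exc → e ∈ y.exc)
include hexc

theorem exists_hat_incl {a : x.sub.E} (h : G.below x.exc a ∉ f.base.S) :
    ∃ a', f.hat.incl a' = a := by
  induction a using edge_cases with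
  | h1 e he =>
    obtain ⟨e', rfl⟩ := f.base.exists_incl h
    exact ⟨kept e' fun h1 => he (f.exc_sub e' h1), f.incl_kept _ _ _⟩
  | h2 e he b =>
    obtain ⟨e', rfl⟩ := f.base.exists_incl h
    obtain ⟨c, hc⟩ := f.exists_incl_half ⟨e', hexc e' he⟩ he b
    exact ⟨_, hc⟩

theorem len_comp_incl (p : x.sub.E → ℝ) (e : H.E) :
    len y.exc (fun a => p (f.hat.incl a)) e = len x.exc p (f.base.incl e) := by
  have h1 := congrFun (f.len_ext fun a => p (f.hat.incl a)) (f.base.incl e)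
  rw [f.base.ext_incl] at h1
  rw [← h1, len_eq_sum, len_eq_sum]
  refine Finset.sum_congr rfl fun a _ => ?_
  split_ifs with h
  · obtain ⟨a', rfl⟩ := f.exists_hat_incl hexc (a := a) (by rw [h]; exact f.base.incl_notMem e)
    rw [f.hat.ext_incl]
  · rfl

end PDSpec

/-- For polystable roots, exceptional means nonzero on both sides, so a subdivided edge that
survives stays subdivided. -/
theorem SpinSpec.mem_exc {x : SpinRoot G} {y : SpinRoot H} (f : SpinSpec x y)
    (hx : x.pd.Polystable) (hy : y.pd.Polystable) (e : H.E) (h : f.base.incl e ∈ x.pd.exc) :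
    e ∈ y.pd.exc := by
  rw [hy.exc_eq y.isRoot]
  rw [hx.exc_eq x.isRoot] at h
  exact fun h1 => h ((f.compat.zero e).1 h1)

/-- An integral linear map that is inverse to the linear map of a specialization of polystable
pseudo-roots on the corresponding face. -/
theorem exists_retraction {x : SpinRoot G} {y : SpinRoot H} (f : SpinSpec x y)
    (hx : x.pd.Polystable) (hy : y.pd.Polystable) :
    ∃ h : x.pd.KapSpace →ₗ[ℝ] y.pd.KapSpace,
      (∀ p ∈ intLattice x.pd.sub.E, ∃ q ∈ intLattice y.pd.sub.E,
        h ((excSpace G x.pd.exc).mkQ p) = (excSpace H y.pd.exc).mkQ q) ∧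
      ∀ p : x.pd.sub.E → ℝ, (∀ a, G.below x.pd.exc a ∈ f.base.S → p a = 0) →
        h ((excSpace G x.pd.exc).mkQ p) =
          (excSpace H y.pd.exc).mkQ fun a => p (f.hat.incl a) := by
  have hexc := f.mem_exc hx hy
  let A := x.pd.exc
  -- Restriction `R` alone need not respect the subspaces, as `c` may vary along contracted edges.
  -- The forms `l v` recover `c v` minus the value at the representative of its class from `delta
  -- c`, so subtracting the correction replaces `c` by a function constant on the classes, which
  -- descends to `H`. The forms are integral, and vanish on vectors that vanish over the contracted
  -- edges.
  let r : Setoid G.V := G.connSetoid (f.base.S ∪ Aᶜ)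
  have hrep : ∀ v, G.connSetoid (f.base.S ∪ Aᶜ) (Quotient.mk r v).out v := fun v =>
    Quotient.exact (Quotient.out_eq _)
  choose l hl1 hl2 hl3 using fun v => exists_delta_form (hrep v)
  let R : (x.pd.sub.E → ℝ) →ₗ[ℝ] (y.pd.sub.E → ℝ) := LinearMap.funLeft ℝ ℝ f.hat.incl
  let C : (x.pd.sub.E → ℝ) →ₗ[ℝ] (G.V → ℝ) := LinearMap.pi l
  let T : (x.pd.sub.E → ℝ) →ₗ[ℝ] (y.pd.sub.E → ℝ) := R - R ∘ₗ delta A ∘ₗ C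
  have hle : excSpace G A ≤ (excSpace H y.pd.exc).comap T := by
    refine Submodule.span_le.2 ?_
    rintro u ⟨W, hW, rfl⟩
    rw [uVec_eq]
    let c : G.V → ℝ := fun v => if v ∈ W then 1 else 0
    have hc : ∀ e ∉ A, c (G.ends e false) = c (G.ends e true) := by
      intro e he
      have h1 : ¬ e ∈ G.cut W := fun h => he (hW h)
      simp only [cut, Set.mem_ofPred_eq, not_not] at h1
      simp only [c, h1]
    have h1 : T (delta A c) = R (delta A fun v => c (Quotient.mk r v).out) := by
      change R (delta A c) - R (delta A (C (delta A c))) = _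
      rw [← map_sub, ← map_sub]
      congr 2
      funext v
      change c v - l v (delta A c) = _
      rw [hl3 v c hc]
      ring
    have h2 : ∀ u v, f.base.vMap u = f.base.vMap v →
        c (Quotient.mk r u).out = c (Quotient.mk r v).out := by
      intro u v huv
      have h3 : r u v := connSetoid_mono Set.subset_union_left (f.base.vMap_eq_iff.1 huv)
      rw [Quotient.sound h3]
    let c' : H.V → ℝ := fun w => c (Quotient.mk r (f.base.vMap_surjective w).choose).out
    have h4 : ∀ v, c (Quotient.mk r v).out = c' (f.base.vMap v) := fun v =>
      h2 _ _ (f.base.vMap_surjective (f.base.vMap v)).choose_spec.symm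
    have h5 : T (delta A c) = delta y.pd.exc c' := by
      rw [h1]
      exact funext fun a => f.delta_comp_incl hexc h4 a
    change T (delta A c) ∈ excSpace H y.pd.exc
    rw [h5]
    refine delta_mem_excSpace fun e he => ?_
    have h6 : f.base.incl e ∉ A := fun h => he (hexc e h)
    have h7 : ∀ b, c' (H.ends e b) = c (Quotient.mk r (G.ends (f.base.incl e) (xor b (f.base.tw e)))).out := by
      intro b
      rw [h4, f.base.vMap_ends_tw]
      congr 2
      cases b <;> cases f.base.tw e <;> rfl
    rw [h7, h7]
    have h8 : r (G.ends (f.base.incl e) (xor false (f.base.tw e)))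
        (G.ends (f.base.incl e) (xor true (f.base.tw e))) :=
      connSetoid_of_mem (Or.inr h6) _ _
    rw [Quotient.sound h8]
  refine ⟨(excSpace G A).mapQ (excSpace H y.pd.exc) T hle, fun p hp => ⟨T p, ?_, rfl⟩,
    fun p hp => ?_⟩
  · refine mem_intLattice.2 fun a => ?_
    have h1 : ∀ a, ∃ z : ℤ, (z : ℝ) = delta A (C p) a := by
      intro a
      induction a using edge_cases with
      | h1 e he => exact ⟨0, by rw [delta_kept]; simp⟩
      | h2 e he b =>
        obtain ⟨z, hz⟩ := hl1 (G.ends e b) p hp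
        obtain ⟨z', hz'⟩ := hl1 (G.ends e !b) p hp
        refine ⟨z - z', ?_⟩
        rw [delta_half]
        push_cast
        rw [hz, hz']
        rfl
    obtain ⟨z, hz⟩ := mem_intLattice.1 hp (f.hat.incl a)
    obtain ⟨z', hz'⟩ := h1 (f.hat.incl a)
    refine ⟨z - z', ?_⟩
    push_cast
    rw [hz, hz']
    rfl
  · have h1 : C p = 0 := funext fun v => hl2 v p hp
    have h2 : T p = R p := by
      change R p - R (delta A (C p)) = R p
      rw [h1, map_zero, map_zero, sub_zero]
    change (excSpace H y.pd.exc).mkQ (T p) = _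
    rw [h2]
    rfl

/-- In terms of lengths the face is the part of the orthant where the contracted lengths vanish. The
retraction is evaluated on the representative `mid`, whose coordinates over contracted edges vanish
on this face. -/
theorem Strop_face {g : ℕ} {a b : SP g n} (f : SpinSpec a.root b.root) :
    LatticeCone.IsFaceMorphism (A := (Strop g n).cone b) (B := (Strop g n).cone a)
      f.kapMap := by
  have hx := a.polystable
  have hy := b.polystable
  have hexc := f.mem_exc hx hy
  obtain ⟨h, h1, h2⟩ := exists_retraction f hx hy
  have hker : ∀ {q : a.root.pd.KapSpace}, q ∈ a.root.pd.kap →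
      (sumOn f.base.S (a.root.pd.kapLen q) = 0 ↔ ∀ e ∈ f.base.S, a.root.pd.kapLen q e = 0) :=
    fun hq => sumOn_eq_zero _ (kapLen_nonneg hq)
  have hF : ∀ q : a.root.pd.KapSpace, q ∈ a.root.pd.kap →
      (∀ e ∈ f.base.S, a.root.pd.kapLen q e = 0) → h q ∈ b.root.pd.kap ∧
        b.root.pd.kapLen (h q) = fun e => a.root.pd.kapLen q (f.base.incl e) := by
    intro q hq hq0
    have h3 := hx.eq_mk_mid a.root.isRoot hq
    have h4 : h q = (excSpace _ b.root.pd.exc).mkQ fun e =>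
        mid a.root.pd.exc (a.root.pd.kapLen q) (f.hat.incl e) := by
      conv_lhs => rw [h3]
      refine h2 _ fun e he => ?_
      induction e using edge_cases with
      | h1 e _ => exact hq0 e he
      | h2 e _ _ =>
        change a.root.pd.kapLen q e / 2 = 0
        rw [hq0 e he, zero_div]
    constructor
    · rw [h4]
      refine ⟨_, f.restrict_mem_lam a.root.isRoot
        (hx.mid_mem_lam a.root.isRoot (kapLen_nonneg hq)) fun e he => ?_, rfl⟩
      have h5 : a.graph.below a.root.pd.exc e ∈ f.base.S := by
        by_contra h6
        obtain ⟨e', rfl⟩ := f.exists_hat_incl hexc h6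
        exact f.hat.incl_notMem e' he
      induction e using edge_cases with
      | h1 e _ => exact hq0 e h5
      | h2 e _ _ =>
        change a.root.pd.kapLen q e / 2 = 0
        rw [hq0 e h5, zero_div]
    · rw [h4, kapLen_mk]
      funext e
      rw [f.len_comp_incl hexc, len_mid]
  refine ⟨{q | q ∈ a.root.pd.kap ∧ (sumOn f.base.S ∘ₗ a.root.pd.kapLen) q = 0},
    ⟨sumOn f.base.S ∘ₗ a.root.pd.kapLen, fun q hq => sumOn_nonneg _ (kapLen_nonneg hq), rfl⟩,
    ⟨?_, fun q hq => ?_⟩, h, ⟨?_, fun q hq => ?_⟩, fun q hq => ?_, fun q hq => ?_⟩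
  · rintro _ ⟨p, hp, rfl⟩
    exact ⟨f.hat.ext p, f.hat.ext_mem_intLattice hp, rfl⟩
  · refine ⟨f.kapMap_mem hq, (hker (f.kapMap_mem hq)).2 fun e he => ?_⟩
    exact (congrFun (f.kapLen_kapMap q) e).trans (f.base.ext_mem he _)
  · rintro _ ⟨p, hp, rfl⟩
    obtain ⟨q, hq, h3⟩ := h1 p hp
    exact ⟨q, hq, h3.symm⟩
  · exact (hF q hq.1 ((hker hq.1).1 hq.2)).1
  · obtain ⟨p, hp, rfl⟩ := hq
    change h (f.kapMap ((excSpace _ b.root.pd.exc).mkQ p)) = (excSpace _ b.root.pd.exc).mkQ p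
    rw [f.kapMap_mk, h2 _ fun e he => f.hat.ext_mem (f.mem_hat_S_of_below he) p]
    congr 1
    exact funext fun e => f.hat.ext_incl e p
  · obtain ⟨h3, h4⟩ := hF q hq.1 ((hker hq.1).1 hq.2)
    refine hx.kapLen_injOn a.root.isRoot (f.kapMap_mem h3) hq.1 ?_
    refine (f.kapLen_kapMap (h q)).trans ?_
    rw [h4, f.base.ext_comp_incl ((hker hq.1).1 hq.2)]

end SpinTrop

end

noncomputable section

namespace SpinTrop

open scoped Classical

open WGraph PseudoDivisor

variable {n : ℕ} {G H K : WGraph n}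

/-! ### Finiteness -/

instance : Finite (GraphIso G H) :=
  Finite.of_injective (β := (G.V → H.V) × (G.E → H.E) × (G.E → Bool))
    (fun i => (i.vert, i.edge, i.flip)) fun i j h => by
    obtain ⟨v, e, f, h1, h2, h3⟩ := i
    obtain ⟨v', e', f', h1', h2', h3'⟩ := j
    simp only [Prod.mk.injEq] at h
    obtain ⟨ha, hb, rfl⟩ := h
    have := Equiv.coe_fn_injective ha
    subst this
    have := Equiv.coe_fn_injective hb
    subst this
    rfl

instance : Finite (Specialization G H) :=
  Finite.of_injective (β := Σ S : Set G.E, GraphIso (G.contract S) H)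
    (fun f => ⟨f.S, f.iso⟩) fun f g h => by
    obtain ⟨S, i⟩ := f
    obtain ⟨S', i'⟩ := g
    simp only [Sigma.mk.injEq] at h
    obtain ⟨rfl, h⟩ := h
    rw [eq_of_heq h]

instance {x : PseudoDivisor G} {y : PseudoDivisor H} : Finite (PDSpec x y) :=
  Finite.of_injective (β := Specialization G H × Specialization x.sub y.sub)
    (fun f => (f.base, f.hat)) fun f g h => by
    obtain ⟨b, i, _, _, _, _⟩ := f
    obtain ⟨b', i', _, _, _, _⟩ := g
    simp only [Prod.mk.injEq] at h
    obtain ⟨rfl, rfl⟩ := h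
    rfl

instance {x : SpinRoot G} {y : SpinRoot H} : Finite (SpinSpec x y) :=
  Finite.of_injective (β := PDSpec x.pd y.pd) (fun f => f.toPDSpec) fun f g h => by
    obtain ⟨⟨f, _⟩, _⟩ := f
    obtain ⟨⟨g, _⟩, _⟩ := g
    simp only at h
    subst h
    rfl

/-- Isomorphisms of spin roots. -/
structure SpinIso (x : SpinRoot G) (y : SpinRoot H) where
  vert : G.V ≃ H.V
  edge : G.E ≃ H.E
  ends_eq : ∀ e b, vert (G.ends e b) = H.ends (edge e) b
  weight_eq : ∀ v, H.weight (vert v) = G.weight v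
  leg_eq : ∀ i, vert (G.leg i) = H.leg i
  exc_iff : ∀ e, edge e ∈ y.pd.exc ↔ e ∈ x.pd.exc
  flow_eq : ∀ e h h', y.pd.flow (kept (edge e) h, false) = x.pd.flow (kept e h', false)
  sign_eq : ∀ v, y.sign (H.contractMk _ (vert v)) = x.sign (G.contractMk _ v)

namespace SpinIso

variable {x : SpinRoot G} {y : SpinRoot H} (i : SpinIso x y)

def symm : SpinIso y x where
  vert := i.vert.symm
  edge := i.edge.symm
  ends_eq e b := by
    rw [Equiv.symm_apply_eq, i.ends_eq, i.edge.apply_symm_apply]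
  weight_eq v := by rw [← i.weight_eq, i.vert.apply_symm_apply]
  leg_eq j := by rw [Equiv.symm_apply_eq, i.leg_eq]
  exc_iff e := by rw [← i.exc_iff, i.edge.apply_symm_apply]
  flow_eq e h h' := by
    have h1 : ∀ (e' : H.E) (he' : e' = e) (h2 : e' ∉ y.pd.exc),
        y.pd.flow (kept e' h2, false) = y.pd.flow (kept e h', false) := by
      rintro _ rfl _; rfl
    rw [← h1 (i.edge (i.edge.symm e)) (i.edge.apply_symm_apply e)
      (by rw [i.edge.apply_symm_apply]; exact h')]
    exact (i.flow_eq _ _ _).symm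
  sign_eq v := by rw [← i.sign_eq, i.vert.apply_symm_apply]

theorem mem_zeroEdges (e : G.E) : i.edge e ∈ y.pd.zeroEdges ↔ e ∈ x.pd.zeroEdges := by
  rw [y.isRoot.mem_zeroEdges y.semistable, x.isRoot.mem_zeroEdges x.semistable]
  constructor
  · rintro ⟨h, h0⟩
    have h' : e ∉ x.pd.exc := fun h1 => h ((i.exc_iff e).2 h1)
    exact ⟨h', by rw [← i.flow_eq e h h', h0]⟩
  · rintro ⟨h, h0⟩
    have h' : i.edge e ∉ y.pd.exc := fun h1 => h ((i.exc_iff e).1 h1)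
    exact ⟨h', by rw [i.flow_eq e h' h, h0]⟩

theorem degIn_eq (S : Set H.E) (v : G.V) : H.degIn S (i.vert v) = G.degIn (i.edge ⁻¹' S) v := by
  rw [degIn_eq_sum, degIn_eq_sum]
  refine (Fintype.sum_equiv (i.edge.prodCongr (Equiv.refl Bool)) _ _ fun d => ?_).symm
  have h : H.src (i.edge d.1, d.2) = i.vert (G.src d) := (i.ends_eq d.1 d.2).symm
  change _ = if i.edge d.1 ∈ S ∧ H.src (i.edge d.1, d.2) = i.vert v then 1 else 0
  rw [h, i.vert.apply_eq_iff_eq]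
  rfl

theorem contractMk_eq_iff (u v : G.V) : H.contractMk y.pd.zeroEdges (i.vert u) =
    H.contractMk y.pd.zeroEdges (i.vert v) ↔
      G.contractMk x.pd.zeroEdges u = G.contractMk x.pd.zeroEdges v := by
  rw [WGraph.contractMk_eq_iff, WGraph.contractMk_eq_iff]
  constructor
  · intro h
    have h1 := connSetoid_le ((G.connSetoid x.pd.zeroEdges).comap i.vert.symm) (fun e he => ?_) h
    · change G.connSetoid _ (i.vert.symm (i.vert u)) (i.vert.symm (i.vert v)) at h1
      rwa [i.vert.symm_apply_apply, i.vert.symm_apply_apply] at h1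
    · change G.connSetoid _ (i.symm.vert _) (i.symm.vert _)
      rw [i.symm.ends_eq, i.symm.ends_eq]
      exact connSetoid_of_mem ((i.symm.mem_zeroEdges e).2 he) _ _
  · intro h
    refine connSetoid_le ((H.connSetoid y.pd.zeroEdges).comap i.vert) (fun e he => ?_) h
    change H.connSetoid _ (i.vert _) (i.vert _)
    rw [i.ends_eq, i.ends_eq]
    exact connSetoid_of_mem ((i.mem_zeroEdges e).2 he) _ _

theorem exists_base : ∃ F : Specialization G H, (∀ v, F.vMap v = i.vert v) ∧
    (∀ a, F.incl a = i.edge.symm a) ∧ ∀ a, F.tw a = false := by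
  have hr : Set.range i.edge.symm = Set.univ := i.edge.symm.surjective.range_eq
  obtain ⟨F, -, h1, h2, h3⟩ := exists_specialization (G := G) (H := H) i.vert i.edge.symm
    (fun _ => false) i.vert.surjective i.edge.symm.injective
    (fun a b => by rw [i.ends_eq, i.edge.apply_symm_apply, Bool.xor_false])
    (fun e he => absurd (by rw [hr]; trivial) he)
    (fun u v h => by rw [i.vert.injective h])
    (fun u => by
      rw [Finset.sum_eq_single (i.vert.symm u)]
      · rw [if_pos (i.vert.apply_symm_apply u)]
        conv_lhs => rw [← i.vert.apply_symm_apply u]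
        rw [canonical, canonical, i.weight_eq, deg, i.degIn_eq]
        rfl
      · intro v _ hv
        rw [if_neg]
        rintro rfl
        exact hv (i.vert.symm_apply_apply v).symm
      · simp)
    i.leg_eq
  exact ⟨F, h1, h2, h3⟩

theorem exists_spinSpec : ∃ f : SpinSpec x y,
    (∀ e (h : e ∉ y.pd.exc) (h' : i.edge.symm e ∉ x.pd.exc),
      f.hat.incl (kept e h) = kept (i.edge.symm e) h') ∧
    ∀ e (h : e ∈ y.pd.exc) (h' : i.edge.symm e ∈ x.pd.exc) b,
      f.hat.incl (half e h b) = half (i.edge.symm e) h' b := by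
  obtain ⟨F, h1, h2, h3⟩ := i.exists_base
  have hex : ∀ e, e ∈ y.pd.exc ↔ F.incl e ∈ x.pd.exc := fun e => by
    rw [h2]; exact (i.symm.exc_iff e).symm
  have hz : ∀ e, e ∈ y.pd.zeroEdges ↔ F.incl e ∈ x.pd.zeroEdges := fun e => by
    rw [h2]; exact (i.symm.mem_zeroEdges e).symm
  have hkept : ∀ e (a : G.E) (_ : a = i.edge.symm e) (h' : a ∉ x.pd.exc)
      (h'' : i.edge.symm e ∉ x.pd.exc), (kept a h' : x.pd.sub.E) = kept (i.edge.symm e) h'' := by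
    rintro e _ rfl _ _; rfl
  have hhalf : ∀ e (a : G.E) (_ : a = i.edge.symm e) (h' : a ∈ x.pd.exc)
      (h'' : i.edge.symm e ∈ x.pd.exc) (b : Bool),
      (half a h' b : x.pd.sub.E) = half (i.edge.symm e) h'' b := by
    rintro e _ rfl _ _ _; rfl
  obtain ⟨f, hf, hf1, hf2⟩ := exists_rootSpec x.isRoot x.semistable y.isRoot y.semistable F
    (fun e he => (hex e).1 he)
    (fun e h h' => by
      rw [h3, hkept e _ (h2 e) h' (by rwa [← h2])]
      exact (i.symm.flow_eq e _ _).symm)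
    (fun e h h' => absurd ((hex e).2 h') h)
  have hc : Compat F x y := by
    refine ⟨hz, fun u' => ?_⟩
    obtain ⟨w, rfl⟩ := contractMk_surjective y.pd.zeroEdges u'
    obtain ⟨v, rfl⟩ := i.vert.surjective w
    rw [i.sign_eq, Finset.sum_eq_single (G.contractMk x.pd.zeroEdges v)]
    · rw [if_pos ⟨v, rfl, by rw [h1]⟩]
    · intro u _ hu
      rw [if_neg]
      rintro ⟨v', rfl, hv'⟩
      rw [h1, i.contractMk_eq_iff] at hv'
      exact hu hv'
    · simp
  obtain ⟨g, rfl⟩ := SpinTrop.exists_spinSpec hc hf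
  refine ⟨g, fun e h h' => ?_, fun e h h' b => ?_⟩
  · rw [hf1 e h (by rwa [h2])]
    exact hkept e _ (h2 e) _ _
  · rw [hf2 e h (by rwa [h2]), h3, Bool.xor_false]
    exact hhalf e _ (h2 e) _ _ _

include i in
theorem exists_inverse : ∃ (f : SpinSpec x y) (h : SpinSpec y x),
    f.hat.ext ∘ₗ h.hat.ext = LinearMap.id ∧ h.hat.ext ∘ₗ f.hat.ext = LinearMap.id := by
  have key : ∀ {K L : WGraph n} (f : Specialization K L) (h : Specialization L K)
      (_ : ∀ a, f.incl (h.incl a) = a), f.ext ∘ₗ h.ext = LinearMap.id := by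
    intro K L f h hfh
    refine LinearMap.ext fun p => funext fun e => ?_
    change f.ext (h.ext p) e = p e
    rw [← hfh e, f.ext_incl, h.ext_incl, hfh]
  have key2 : ∀ {K L : WGraph n} {z : SpinRoot K} {w : SpinRoot L} (j : SpinIso z w)
      (f : SpinSpec z w) (h : SpinSpec w z)
      (_ : ∀ e (h : e ∉ w.pd.exc) (h' : j.edge.symm e ∉ z.pd.exc),
        f.hat.incl (kept e h) = kept (j.edge.symm e) h')
      (_ : ∀ e (h : e ∈ w.pd.exc) (h' : j.edge.symm e ∈ z.pd.exc) b,
        f.hat.incl (half e h b) = half (j.edge.symm e) h' b)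
      (_ : ∀ e (h' : e ∉ z.pd.exc) (h'' : j.edge e ∉ w.pd.exc),
        h.hat.incl (kept e h') = kept (j.edge e) h'')
      (_ : ∀ e (h' : e ∈ z.pd.exc) (h'' : j.edge e ∈ w.pd.exc) b,
        h.hat.incl (half e h' b) = half (j.edge e) h'' b) (a),
      f.hat.incl (h.hat.incl a) = a := by
    intro K L z w j f h h1 h2 h3 h4 a
    induction a using edge_cases with
    | h1 e he =>
      have he' : j.edge e ∉ w.pd.exc := fun h => he ((j.exc_iff e).1 h)
      rw [h3 e he he', h1 _ he' (by rwa [j.edge.symm_apply_apply])]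
      simp
    | h2 e he b =>
      have he' : j.edge e ∈ w.pd.exc := (j.exc_iff e).2 he
      rw [h4 e he he', h2 _ he' (by rwa [j.edge.symm_apply_apply])]
      simp
  obtain ⟨f, f1, f2⟩ := i.exists_spinSpec
  obtain ⟨h, h1, h2⟩ := i.symm.exists_spinSpec
  exact ⟨f, h, key _ _ (key2 i f h f1 f2 h1 h2), key _ _ (key2 i.symm h f h1 h2 f1 f2)⟩

end SpinIso

/-! The isomorphism classes of spin roots on bounded graphs are encoded by elements of a finite
type. -/

/-- A graph with a spin root the vertices and edges of which are numbered, in a finite type. -/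
abbrev Code (n N : ℕ) : Type :=
  Set (Fin N) × Set (Fin N) × Set (Fin N × Bool × Fin N) × Set (Fin N × Fin N) ×
    (Fin n → Fin N) × Set (Fin N) × Set (Fin N × ({-1, 0, 1} : Set ℤ)) × Set (Fin N × ZMod 2)

/-- The code belongs to the spin root. -/
def IsCode {N : ℕ} (x : SpinRoot G) (c : Code n N) : Prop :=
  ∃ (iv : G.V ↪ Fin N) (ie : G.E ↪ Fin N), c = (Set.range iv, Set.range ie,
    {q | ∃ e b, q = (ie e, b, iv (G.ends e b))}, {q | ∃ v, q.1 = iv v ∧ (q.2 : ℕ) = G.weight v},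
    fun j => iv (G.leg j), ie '' x.pd.exc,
    {q | ∃ e h, q.1 = ie e ∧ (q.2 : ℤ) = x.pd.flow (kept e h, false)},
    {q | ∃ v, q = (iv v, x.sign (G.contractMk _ v))})

theorem exists_equiv {α β γ : Type*} (i : α ↪ γ) (j : β ↪ γ) (h : Set.range i = Set.range j) :
    ∃ f : α ≃ β, ∀ a, j (f a) = i a := by
  refine ⟨(Equiv.ofInjective i i.injective).trans
    ((Equiv.setCongr h).trans (Equiv.ofInjective j j.injective).symm), fun a => ?_⟩
  exact Equiv.apply_ofInjective_symm j.injective _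

/-- A code records incidences, weights, legs, exceptional edges, the flow off them and the signs;
the divisor need not be recorded since the flow determines it. -/
theorem exists_spinIso {N : ℕ} {x : SpinRoot G} {y : SpinRoot H} {c : Code n N}
    (hw : ∀ v, G.weight v < N) (hx : IsCode x c) (hy : IsCode y c) : Nonempty (SpinIso x y) := by
  obtain ⟨iv, ie, rfl⟩ := hx
  obtain ⟨jv, je, h⟩ := hy
  simp only [Prod.mk.injEq] at h
  obtain ⟨h1, h2, h3, h4, h5, h6, h7, h8⟩ := h
  obtain ⟨vert, hv⟩ := exists_equiv iv jv h1
  obtain ⟨edge, he⟩ := exists_equiv ie je h2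
  have hexc : ∀ e, edge e ∈ y.pd.exc ↔ e ∈ x.pd.exc := fun e => by
    rw [← je.injective.mem_set_image, ← h6, he, ie.injective.mem_set_image]
  refine ⟨⟨vert, edge, fun e b => ?_, fun v => ?_, fun k => ?_, hexc, fun e h h' => ?_, fun v => ?_⟩⟩
  · have h9 : (ie e, b, iv (G.ends e b)) ∈ {q | ∃ e b, q = (ie e, b, iv (G.ends e b))} :=
      ⟨e, b, rfl⟩
    rw [h3] at h9
    obtain ⟨e', b', h10⟩ := h9
    simp only [Prod.mk.injEq] at h10
    obtain ⟨h11, rfl, h12⟩ := h10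
    rw [← he] at h11
    rw [← hv] at h12
    rw [je.injective h11, jv.injective h12]
  · have h9 : (iv v, (⟨G.weight v, hw v⟩ : Fin N)) ∈
        {q : Fin N × Fin N | ∃ v, q.1 = iv v ∧ (q.2 : ℕ) = G.weight v} := ⟨v, rfl, rfl⟩
    rw [h4] at h9
    obtain ⟨v', h10, h11⟩ := h9
    change iv v = jv v' at h10
    rw [← hv] at h10
    rw [jv.injective h10]
    exact h11.symm
  · have h9 := congrFun h5 k
    rw [← hv] at h9
    exact jv.injective h9
  · have h9 : x.pd.flow (kept e h', false) ∈ ({-1, 0, 1} : Set ℤ) := by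
      have h10 := x.isRoot.flow_le_one x.semistable (kept e h', false)
      have h11 := x.isRoot.neg_one_le_flow x.semistable (kept e h', false)
      simp only [Set.mem_insert_iff, Set.mem_singleton_iff]
      omega
    have h12 : (ie e, (⟨_, h9⟩ : ({-1, 0, 1} : Set ℤ))) ∈
        {q : Fin N × ({-1, 0, 1} : Set ℤ) |
          ∃ e h, q.1 = ie e ∧ (q.2 : ℤ) = x.pd.flow (kept e h, false)} := ⟨e, h', rfl, rfl⟩
    rw [h7] at h12
    obtain ⟨e', h13, h14, h15⟩ := h12
    change ie e = je e' at h14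
    rw [← he] at h14
    obtain rfl := je.injective h14
    exact h15.symm
  · have h9 : (iv v, x.sign (G.contractMk _ v)) ∈
        {q | ∃ v, q = (iv v, x.sign (G.contractMk _ v))} := ⟨v, rfl⟩
    rw [h8] at h9
    obtain ⟨v', h10⟩ := h9
    simp only [Prod.mk.injEq] at h10
    obtain ⟨h11, h12⟩ := h10
    rw [← hv] at h11
    obtain rfl := jv.injective h11
    exact h12.symm

/-- The stability quantity is at least `1` at every vertex and sums to `2g - 2 + n`, which bounds
the vertices and the weights. A degree exceeds it by at most `2`, which bounds the edges. One
generous constant serves for all three. -/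
theorem WGraph.IsStable.bounds {g : ℕ} (hG : G.IsStable g) :
    Fintype.card G.V < 6 * g + 3 * n + 4 ∧ Fintype.card G.E < 6 * g + 3 * n + 4 ∧
      ∀ v, G.weight v < 6 * g + 3 * n + 4 := by
  let t : G.V → ℤ := fun v => G.canonical v + {i | G.leg i = v}.ncard
  have ht : ∀ v, 1 ≤ t v := fun v => by
    have := hG.stable v
    simp only [t, canonical]
    omega
  have hsum : ∑ v, t v = 2 * g - 2 + n := by
    have h1 := sum_canonical (G := G)
    rw [hG.connected, hG.genus_eq] at h1
    have h2 : ∑ v, ({i | G.leg i = v}.ncard : ℤ) = n := by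
      have h0 : ∀ v, ({i | G.leg i = v}.ncard : ℤ) = ∑ i, if G.leg i = v then 1 else 0 :=
        fun v => by
          rw [Set.ncard_eq_toFinset_card']
          simp
      simp only [h0]
      rw [Finset.sum_comm]
      simp
    simp only [t]
    rw [Finset.sum_add_distrib, h1, h2]
    push_cast
    ring
  have hV : (Fintype.card G.V : ℤ) ≤ 2 * g - 2 + n := by
    rw [← hsum]
    calc (Fintype.card G.V : ℤ) = ∑ v : G.V, 1 := by simp
      _ ≤ _ := Finset.sum_le_sum fun v _ => ht v
  have hle : ∀ v, t v ≤ 2 * g - 2 + n := fun v => by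
    rw [← hsum]
    exact Finset.single_le_sum (f := t) (fun u _ => (by linarith [ht u] : (0 : ℤ) ≤ t u))
      (Finset.mem_univ v)
  have hE : 2 * (Fintype.card G.E : ℤ) ≤ 3 * (2 * g - 2 + n) := by
    have h : ∑ v, (G.deg v : ℤ) = 2 * Fintype.card G.E := by
      simp only [deg, degIn_eq_sum, Set.mem_univ, true_and]
      push_cast
      rw [Finset.sum_comm]
      simp [mul_comm]
    have h1 : ∑ v, (G.deg v : ℤ) ≤ ∑ v, (t v + 2) := by
      refine Finset.sum_le_sum fun v _ => ?_
      simp only [t, canonical]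
      have : (0 : ℤ) ≤ G.weight v := Int.natCast_nonneg _
      have : (0 : ℤ) ≤ ({i | G.leg i = v}.ncard : ℤ) := Int.natCast_nonneg _
      linarith
    rw [Finset.sum_add_distrib, hsum, h] at h1
    simp only [Finset.sum_const, Finset.card_univ, nsmul_eq_mul] at h1
    linarith
  refine ⟨by omega, by omega, fun v => ?_⟩
  have h1 := hle v
  simp only [t, canonical] at h1
  omega

theorem exists_code {g : ℕ} (hG : G.IsStable g) (x : SpinRoot G) :
    ∃ c : Code n (6 * g + 3 * n + 4), IsCode x c := by
  obtain ⟨h1, h2, h3⟩ := hG.bounds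
  obtain ⟨iv⟩ : Nonempty (G.V ↪ Fin (6 * g + 3 * n + 4)) :=
    Function.Embedding.nonempty_of_card_le (by rw [Fintype.card_fin]; exact h1.le)
  obtain ⟨ie⟩ : Nonempty (G.E ↪ Fin (6 * g + 3 * n + 4)) :=
    Function.Embedding.nonempty_of_card_le (by rw [Fintype.card_fin]; exact h2.le)
  exact ⟨_, iv, ie, rfl⟩

/-- Representatives of the classes of a relation that is implied by the equality of codes in a
finite type. -/
theorem exists_finite_representatives {α : Type*} {T : Type*} [Finite T] {r : α → α → Prop}
    {code : α → T → Prop} (hex : ∀ a, ∃ c, code a c) (h : ∀ a b c, code a c → code b c → r a b) :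
    ∃ F : Set α, F.Finite ∧ ∀ a, ∃ b ∈ F, r a b := by
  choose f hf using hex
  refine ⟨Set.range fun c : Set.range f => c.2.choose, Set.finite_range _, fun a => ?_⟩
  refine ⟨_, ⟨⟨f a, a, rfl⟩, rfl⟩, h _ _ (f a) (hf a) ?_⟩
  have h1 : f (Exists.choose (⟨a, rfl⟩ : ∃ b, f b = f a)) = f a :=
    Exists.choose_spec (⟨a, rfl⟩ : ∃ b, f b = f a)
  have h2 := hf (Exists.choose (⟨a, rfl⟩ : ∃ b, f b = f a))
  rwa [h1] at h2

theorem isGeneralizedConeComplex_Qtrop (g n : ℕ) [NeZero n] :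
    (Qtrop g n).IsGeneralizedConeComplex where
  polyhedral := Qtrop_polyhedral
  face := Qtrop_face
  finite_hom a b := inferInstanceAs (Finite (SpinSpec a.root b.root))
  finite_obj := by
    refine exists_finite_representatives (T := Code n (6 * g + 3 * n + 4))
      (code := fun a c => IsCode a.root c) (fun a => exists_code a.stable a.root)
      fun a b c ha hb => ?_
    obtain ⟨i⟩ := exists_spinIso a.stable.bounds.2.2 ha hb
    obtain ⟨f, h, h1, h2⟩ := i.exists_inverse
    exact ⟨f, h, h1, h2⟩

theorem isGeneralizedConeComplex_Strop (g n : ℕ) : (Strop g n).IsGeneralizedConeComplex where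
  polyhedral := Strop_polyhedral
  face := Strop_face
  finite_hom a b := inferInstanceAs (Finite (SpinSpec a.root b.root))
  finite_obj := by
    refine exists_finite_representatives (T := Code n (6 * g + 3 * n + 4))
      (code := fun a c => IsCode a.root c) (fun a => exists_code a.stable a.root)
      fun a b c ha hb => ?_
    obtain ⟨i⟩ := exists_spinIso a.stable.bounds.2.2 ha hb
    obtain ⟨f, h, h1, h2⟩ := i.exists_inverse
    have key : ∀ {K L : WGraph n} {z : PseudoDivisor K} {w : PseudoDivisor L} (f : PDSpec z w)
        (h : PDSpec w z), f.hat.ext ∘ₗ h.hat.ext = LinearMap.id →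
          f.kapMap ∘ₗ h.kapMap = LinearMap.id := by
      intro K L z w f h hfh
      refine LinearMap.ext fun q => ?_
      obtain ⟨p, rfl⟩ := (excSpace K z.exc).mkQ_surjective q
      refine (congrArg f.kapMap (h.kapMap_mk p)).trans ((f.kapMap_mk _).trans ?_)
      exact congrArg (excSpace K z.exc).mkQ (LinearMap.congr_fun hfh p)
    exact ⟨f, h, key _ _ h1, key _ _ h2⟩

end SpinTrop

end

noncomputable section

namespace SpinTrop

open scoped Classical

open WGraph PseudoDivisor

variable {n : ℕ} {G H K : WGraph n}

/-! ### The refinement -/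

theorem WGraph.Specialization.ext_comp {F : Specialization G H} {F' : Specialization H K}
    {F'' : Specialization G K} (h : ∀ a, F''.incl a = F.incl (F'.incl a)) (p : K.E → ℝ) :
    F''.ext p = F.ext (F'.ext p) := by
  funext e
  by_cases h1 : e ∈ F''.S
  · rw [F''.ext_mem h1]
    by_cases h2 : e ∈ F.S
    · rw [F.ext_mem h2]
    · obtain ⟨e', rfl⟩ := F.exists_incl h2
      rw [F.ext_incl]
      by_cases h3 : e' ∈ F'.S
      · rw [F'.ext_mem h3]
      · obtain ⟨a, rfl⟩ := F'.exists_incl h3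
        rw [← h] at h1
        exact absurd h1 (F''.incl_notMem a)
  · obtain ⟨a, rfl⟩ := F''.exists_incl h1
    rw [F''.ext_incl, h, F.ext_incl, F'.ext_incl]

variable {g : ℕ}

/-- A compatible specialization of graphs always lifts when the source is polystable, and lengths
separate the points of `κ`; so equal lengths suffice for gluing. -/
theorem Strop_pt_eq {y z : SP g n} {F : Specialization y.graph z.graph}
    (hF : Compat F y.root z.root) {q : y.root.pd.KapSpace} (hq : q ∈ y.root.pd.kap)
    {q' : z.root.pd.KapSpace} (hq' : q' ∈ z.root.pd.kap)
    (h : y.root.pd.kapLen q = F.ext (z.root.pd.kapLen q')) :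
    (Strop g n).pt y q hq = (Strop g n).pt z q' hq' := by
  obtain ⟨f, rfl⟩ := hF.exists_spinSpec y.polystable
  refine (Quot.sound ⟨f, ?_⟩).symm
  refine y.polystable.kapLen_injOn y.root.isRoot (f.kapMap_mem hq') hq ?_
  exact (f.kapLen_kapMap q').trans h.symm

theorem SpinSpec.kapLen_lamToKap_of_isId {y x : SpinRoot G} {f : SpinSpec y x} (hf : f.base.IsId)
    (p : x.pd.sub.E → ℝ) : y.pd.kapLen (f.lamToKap p) = len x.pd.exc p := by
  rw [f.kapLen_lamToKap, hf.ext_eq]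

theorem PDSpec.continuous_lamToKap {x : PseudoDivisor G} {y : PseudoDivisor H} (f : PDSpec x y) :
    Continuous f.lamToKap :=
  (continuous_quot_mk (r := _)).comp (LinearMap.continuous_of_finiteDimensional f.hat.ext)

variable [NeZero n]

/-- Between quasistable roots a compatible specialization of graphs need not lift. It does once a
point of the open cone of the target has the lengths of a point of the source, since positive
lengths tie the flows together. -/
theorem Qtrop_pt_eq {a b : SPQ g n} {F : Specialization a.graph b.graph}
    (hF : Compat F a.root b.root) {p : a.root.pd.sub.E → ℝ} (hp : p ∈ a.root.pd.lam)
    {q : b.root.pd.sub.E → ℝ} (hq : q ∈ b.root.pd.lamOpen)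
    (h : len a.root.pd.exc p = F.ext (len b.root.pd.exc q)) :
    (Qtrop g n).pt a p hp = (Qtrop g n).pt b q hq.1 := by
  obtain ⟨f, hf⟩ := hF.exists_spinSpec_of_len a.quasistable
    (by rw [F.leg_eq]; exact b.quasistable) hp hq h
  exact (Quot.sound ⟨f, hf⟩).symm

namespace SPQ

variable (a : SPQ g n)

/-- The polystable spin root of a quasistable one. -/
def polRoot : SpinRoot a.graph := (existsUnique_spinPol a.root).choose

theorem isSpinPol_polRoot : IsSpinPol a.polRoot a.root := (existsUnique_spinPol a.root).choose_spec.1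

theorem polRoot_same : a.polRoot.Same a.root := a.isSpinPol_polRoot.same

def pol : SP g n := ⟨a.graph, a.stable, a.polRoot, a.isSpinPol_polRoot.1.1⟩

/-- The specialization of the polystable spin root to the quasistable one. -/
def polSpec : SpinSpec a.polRoot a.root :=
  (a.polRoot_same.exists_spinSpec a.isSpinPol_polRoot.1.1).choose

theorem polSpec_isId : a.polSpec.base.IsId :=
  (a.polRoot_same.exists_spinSpec a.isSpinPol_polRoot.1.1).choose_spec

end SPQ

/-- The map `λ → κ` into the cone of the polystable spin root, on the disjoint unions. -/
def rhoTotal (t : (Qtrop g n).Total) : (Strop g n).Total :=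
  ⟨t.1.pol, t.1.polSpec.lamToKap t.2.1, t.1.polSpec.lamToKap_mem t.2.2⟩

/-- The map `Q → S`. -/
def rho (g n : ℕ) [NeZero n] : (Qtrop g n).Space → (Strop g n).Space :=
  Quot.lift (fun t => Quot.mk _ (rhoTotal t)) <| by
    rintro ⟨a, p, hp⟩ ⟨b, q, hq⟩ ⟨f, hf⟩
    change f.hat.ext p = q at hf
    -- Taking `pol` changes neither zero edges nor signs, so a gluing arrow in `Q` is compatible
    -- with the polystable roots as well.
    refine (Strop_pt_eq (y := b.pol) (z := a.pol) (F := f.base)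
      (b.polRoot_same.compat_left (a.polRoot_same.compat_right f.compat))
      (b.polSpec.lamToKap_mem hq) (a.polSpec.lamToKap_mem hp) ?_).symm
    refine (SpinSpec.kapLen_lamToKap_of_isId b.polSpec_isId q).trans ?_
    refine ((congrArg (len _) hf.symm).trans (f.len_ext p)).trans ?_
    exact congrArg f.base.ext (SpinSpec.kapLen_lamToKap_of_isId a.polSpec_isId p).symm

theorem rho_pt (a : SPQ g n) (p : a.root.pd.sub.E → ℝ) (hp : p ∈ a.root.pd.lam) :
    rho g n ((Qtrop g n).pt a p hp) =
      (Strop g n).pt a.pol (a.polSpec.lamToKap p) (a.polSpec.lamToKap_mem hp) := rfl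

theorem isRhoS_rho : IsRhoS (rho g n) := by
  intro a y hy f hf p hp
  refine ⟨f.lamToKap_mem hp, ?_⟩
  rw [rho_pt]
  obtain ⟨I, hI, -⟩ := exists_id a.graph
  refine Strop_pt_eq (y := a.pol) (z := ⟨a.graph, a.stable, y, hy.1.1⟩) (F := I)
    (hy.same.compat_right (a.polRoot_same.compat hI)) _ _ ?_
  exact ((SpinSpec.kapLen_lamToKap_of_isId a.polSpec_isId p).trans
    (SpinSpec.kapLen_lamToKap_of_isId hf p).symm).trans (hI.ext_eq _).symm

theorem IsRhoS.unique {ρ ρ' : (Qtrop g n).Space → (Strop g n).Space} (h : IsRhoS ρ)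
    (h' : IsRhoS ρ') : ρ = ρ' := by
  funext t
  induction t using Quot.ind with
  | mk t =>
    obtain ⟨a, p, hp⟩ := t
    obtain ⟨_, h1⟩ := h a a.polRoot a.isSpinPol_polRoot a.polSpec a.polSpec_isId p hp
    obtain ⟨_, h2⟩ := h' a a.polRoot a.isSpinPol_polRoot a.polSpec a.polSpec_isId p hp
    exact h1.trans h2.symm

theorem isMorphism_rho : ConeDiagram.IsMorphism (rho g n) := by
  constructor
  · refine continuous_quot_lift _ (continuous_quot_mk.comp ?_)
    refine continuous_sigma fun a => ?_
    have h : Continuous fun p : {p // p ∈ a.root.pd.lam} =>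
        (⟨a.polSpec.lamToKap p.1, a.polSpec.lamToKap_mem p.2⟩ : {q // q ∈ a.polRoot.pd.kap}) :=
      (a.polSpec.continuous_lamToKap.comp continuous_subtype_val).subtype_mk _
    exact (continuous_sigmaMk (σ := fun y : (Strop g n).Obj =>
      {q : ((Strop g n).cone y).W // q ∈ ((Strop g n).cone y).carrier}) (i := a.pol)).comp h
  · intro a
    refine ⟨a.pol, a.polSpec.lamToKap, ⟨?_, fun p hp => a.polSpec.lamToKap_mem hp⟩,
      fun p hp => ⟨_, rho_pt a p hp⟩⟩
    intro v hv
    exact ⟨_, a.polSpec.hat.ext_mem_intLattice hv, rfl⟩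

/-- A point of the open cone of a quasistable spin root represents a point of the cone of a
polystable one if they are related by a specialization of graphs. -/
def Represents (t : (Strop g n).Total) (u : (Qtrop g n).Total) : Prop :=
  ∃ F : Specialization t.1.graph u.1.graph, Compat F t.1.root u.1.root ∧
    u.2.1 ∈ u.1.root.pd.lamOpen ∧ t.1.root.pd.kapLen t.2.1 = F.ext (len u.1.root.pd.exc u.2.1)

theorem exists_represents (t : (Strop g n).Total) : ∃ u : (Qtrop g n).Total, Represents t u := by
  obtain ⟨y, q, hq⟩ := t
  obtain ⟨S, x, hx, hc, p, hp, hl⟩ := exists_quasistable_contract y.stable.connected hq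
  exact ⟨⟨⟨_, (y.graph.contractSpec S).isStable y.stable, x, hx⟩, p, hp.1⟩, _, hc, hp, hl⟩

/-- A representative contracts exactly the edges of length zero, so one specialization factors
through the other, and the two points have equal lengths along the factor. -/
theorem Represents.unique {t : (Strop g n).Total} {u u' : (Qtrop g n).Total}
    (h : Represents t u) (h' : Represents t u') :
    (Quot.mk _ u : (Qtrop g n).Space) = Quot.mk _ u' := by
  obtain ⟨a, p, hp⟩ := u
  obtain ⟨a', p', hp'⟩ := u'
  obtain ⟨F, hc, ho, hl⟩ := h
  obtain ⟨F', hc', ho', hl'⟩ := h'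
  have hS : F.S ⊆ F'.S := fun e he => by
    rw [F'.mem_S_of_ext (len_pos ho'.2), ← hl', hl]
    exact F.ext_mem he _
  obtain ⟨h, h1, h2⟩ := Specialization.exists_factor F F' hS
  refine Qtrop_pt_eq (F := h) (hc.factor hc' (fun v => (h1 v).symm) fun e => (h2 e).symm) hp ho'
    (F.ext_injective ?_)
  rw [← hl, hl', Specialization.ext_comp fun e => (h2 e).symm]

/-- The gluing arrow specializes the root of `t'` to that of `t` and composes with the
specialization from `t` to `u`. -/
theorem Represents.glue {t t' : (Strop g n).Total} (h : (Strop g n).Glue t t')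
    {u : (Qtrop g n).Total} (hu : Represents t u) : Represents t' u := by
  obtain ⟨f, hf⟩ := h
  obtain ⟨F, hc, ho, hl⟩ := hu
  obtain ⟨h, h1, h2⟩ := Specialization.exists_comp f.base F
  refine ⟨h, f.compat.comp hc h1 h2, ho, ?_⟩
  rw [Specialization.ext_comp h2, ← hl, ← hf]
  exact f.kapLen_kapMap _

/-- The inverse of the map `Q → S`. -/
def rhoInv (g n : ℕ) [NeZero n] : (Strop g n).Space → (Qtrop g n).Space :=
  Quot.lift (fun t => Quot.mk _ (exists_represents t).choose) fun t t' h =>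
    ((exists_represents t).choose_spec.glue h).unique (exists_represents t').choose_spec

theorem rhoInv_mk {t : (Strop g n).Total} {u : (Qtrop g n).Total} (h : Represents t u) :
    rhoInv g n (Quot.mk _ t) = Quot.mk _ u :=
  (exists_represents t).choose_spec.unique h

/-- The representative of the image is compatible with the polystable root, hence with the
quasistable root itself, and has the same lengths; so it is the same point of `Q`. -/
theorem rhoInv_rho (t : (Qtrop g n).Space) : rhoInv g n (rho g n t) = t := by
  induction t using Quot.ind with
  | mk t =>
    obtain ⟨a, p, hp⟩ := t
    obtain ⟨⟨b, q, hq⟩, F, hc, ho, hl⟩ := exists_represents (rhoTotal ⟨a, p, hp⟩)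
    refine (rhoInv_mk ⟨F, hc, ho, hl⟩).trans ?_
    refine (Qtrop_pt_eq (F := F) (a.polRoot_same.symm.compat_left hc) hp ho ?_).symm
    exact (SpinSpec.kapLen_lamToKap_of_isId a.polSpec_isId p).symm.trans hl

theorem rho_rhoInv (t : (Strop g n).Space) : rho g n (rhoInv g n t) = t := by
  induction t using Quot.ind with
  | mk t =>
    obtain ⟨⟨a, p, hp⟩, F, hc, ho, hl⟩ := exists_represents t
    rw [rhoInv_mk ⟨F, hc, ho, hl⟩]
    refine (Strop_pt_eq (F := F) (y := t.1) (z := a.pol) (a.polRoot_same.compat_right hc) t.2.2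
      (a.polSpec.lamToKap_mem hp) (hl.trans ?_)).symm
    exact congrArg F.ext (SpinSpec.kapLen_lamToKap_of_isId a.polSpec_isId p).symm

theorem isRefinement_rho : ConeDiagram.IsRefinement (rho g n) :=
  ⟨isMorphism_rho, Function.LeftInverse.injective rhoInv_rho,
    Function.RightInverse.surjective rho_rhoInv⟩

end SpinTrop

end

theorem theoremA (g n : ℕ) [NeZero n] :
    (Qtrop g n).IsGeneralizedConeComplex ∧
    (Strop g n).IsGeneralizedConeComplex ∧
    (∀ a : SPQ g n, (∃! y : SpinRoot a.graph, IsSpinPol y a.root) ∧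
      ∀ y : SpinRoot a.graph, IsSpinPol y a.root → ∃ f : SpinSpec y a.root, f.base.IsId) ∧
    (∃ ρ : (Qtrop g n).Space → (Strop g n).Space,
      IsRhoS ρ ∧ (∀ ρ₁, IsRhoS ρ₁ → ρ₁ = ρ) ∧ ConeDiagram.IsRefinement ρ) ∧
    ∀ G : WGraph n, G.IsStable g → ∀ y : SpinRoot G, y.pd.Polystable →
      IsDecomposition y y.pd.kapOpen
        (fun _ : PolFibre y => G) (fun i => i.1) (fun _ f => f.base.IsId) ∧
      IsDecomposition y y.pd.kap
        (fun i : QuasiSpecs y => G.contract i.1.1) (fun i => i.1.2)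
        (fun _ f => f.base.IsCanonical) :=
  ⟨isGeneralizedConeComplex_Qtrop g n, isGeneralizedConeComplex_Strop g n,
    fun a => ⟨existsUnique_spinPol a.root, fun _ hy => hy.same.exists_spinSpec hy.1.1⟩,
    ⟨rho g n, isRhoS_rho, fun _ h => h.unique isRhoS_rho, isRefinement_rho⟩,
    fun _ hG _ hy => ⟨isDecomposition_kapOpen hG.connected hy, isDecomposition_kap hG.connected hy⟩⟩
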